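/- Let $\mathbf k$ be a field and let $B=\bigoplus_{i\ge 0}B_i$ be a finitely generated connected graded (not necessarily commutative) $\mathbf k$-algebra, i.e. $B_0=\mathbf k$, of finite homological dimension (there is $d$ such that every right $B$-module has projective dimension at most $d$). Let $W\in B_n$ ($n\ge 0$) be a central element of degree $n$ that is not a zero-divisor, and let $A=B/WB$ with the induced grading; assume that $A$ is right Noetherian. Let $\operatorname{gr}\!-A$ be the abelian category of finitely generated $\mathbb Z$-graded right $A$-modules with morphisms of degree zero, and let $$\mathbf D^{gr}_{sg}(A)=\mathbf D^b(\operatorname{gr}\!-A)/\operatorname{Perf}$$ be the Verdier quotient by the full triangulated subcategory $\operatorname{Perf}$ of objects isomorphic to bounded complexes of projective objects of $\operatorname{gr}\!-A$. Let $\operatorname{GrPair}(W)$ be the category whose objects are pairs of finitely generated free graded right $B$-modules $P_1,P_0$ with degree-zero maps $p_1:P_1\to P_0$ and $p_0:P_0\to P_1(n)$ such that $p_0p_1$ and $p_1(n)p_0$ are multiplication by $W$ (here $M(n)_i=M_{n+i}$), and whose morphisms $f:P\to Q$ are pairs of degree-zero maps $f_1:P_1\to Q_1$, $f_0:P_0\to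 Q_0$ with $f_1(n)p_0=q_0f_0$ and $q_1f_1=f_0p_1$. Let $\operatorname{DGrB}(W)$ be the quotient of $\operatorname{GrPair}(W)$ by the null-homotopic morphisms, i.e. those for which there are $s:P_0\to Q_1$ and $t:P_1\to Q_0(-n)$ with $f_1=q_0(-n)t+sp_1$ and $f_0=t(n)p_0+q_1s$. Its translation functor sends $(P_1,P_0,p_1,p_0)$ to $(P_0,P_1(n),-p_0,-p_1(n))$, and its exact triangles are those isomorphic to a standard triangle $P\xrightarrow{f}Q\xrightarrow{(\mathrm{id},0)}C(f)\xrightarrow{(0,-\mathrm{id})}P[1]$, where $C(f)$ is the mapping cone: $C(f)_1=Q_1\oplus P_0$ and $C(f)_0=Q_0\oplus P_1(n)$, with the maps $\begin{pmatrix}q_1&f_0\\0&-p_0\end{pmatrix}$ and $\begin{pmatrix}q_0&f_1(n)\\0&-p_1(n)\end{pmatrix}$. For a graded pair $P$ the cokernel of $p_1$ is annihilated by $W$, which gives a functor $\operatorname{Cok}:\operatorname{GrPair}(W)\to\operatorname{gr}\!-A$, $P\mapsto\operatorname{Coker}p_1$. Then there is a unique functor $F:\operatorname{DGrB}(W)\to\mathbf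 D^{gr}_{sg}(A)$ whose composition with the projection $\operatorname{GrPair}(W)\to\operatorname{DGrB}(W)$ equals the composition of $\operatorname{Cok}$ with the natural functor $\operatorname{gr}\!-A\to\mathbf D^{gr}_{sg}(A)$, and $F$ is an equivalence of triangulated categories: it is an equivalence of categories, and there is a natural isomorphism $F\circ[1]\cong[1]\circ F$ under which a triangle in $\operatorname{DGrB}(W)$ is exact if and only if its image under $F$ is exact. -/

import Mathlib

open CategoryTheory CategoryTheory.Limits MulOpposite

universe w v u

noncomputable section

/-- A `ℤ`-graded right module over a ring `R` equipped with the family of subsets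
`𝒜 i` (`i : ℕ`) of homogeneous elements of degree `i`.  A right `R`-module is a module over `Rᵐᵒᵖ`. -/
structure GrMod {R : Type u} [Ring R] {σ : Type*} [SetLike σ R] (𝒜 : ℕ → σ) where
  carrier : Type u
  [addCommGroup : AddCommGroup carrier]
  [module : Module Rᵐᵒᵖ carrier]
  /-- the homogeneous component of each degree -/
  gr : ℤ → AddSubgroup carrier
  isInternal : DirectSum.IsInternal gr
  smul_mem : ∀ {i : ℕ} {j : ℤ} {a : R} {x : carrier},
    a ∈ 𝒜 i → x ∈ gr j → op a • x ∈ gr (j + i)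

namespace GrMod

attribute [instance] addCommGroup module

variable {R : Type u} [Ring R] {σ : Type*} [SetLike σ R] {𝒜 : ℕ → σ}

instance : CoeSort (GrMod 𝒜) (Type u) := ⟨carrier⟩

/-- Morphisms of graded modules: linear maps of degree zero. -/
@[ext]
structure Hom (M N : GrMod 𝒜) where
  lin : M →ₗ[Rᵐᵒᵖ] N
  map_mem : ∀ {i : ℤ} {x : M}, x ∈ M.gr i → lin x ∈ N.gr i

instance : Category (GrMod 𝒜) where
  Hom := Hom
  id M := ⟨LinearMap.id, fun h => h⟩
  comp f g := ⟨g.lin ∘ₗ f.lin, fun h => g.map_mem (f.map_mem h)⟩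

/-- The linear map underlying a morphism. -/
def Hom.toLin {M N : GrMod 𝒜} (f : M ⟶ N) : M →ₗ[Rᵐᵒᵖ] N := Hom.lin f

lemma Hom.toLin_mem {M N : GrMod 𝒜} (f : M ⟶ N) {i : ℤ} {x : M} (h : x ∈ M.gr i) :
    Hom.toLin f x ∈ N.gr i := Hom.map_mem f h

/-- Construct a morphism from a linear map of degree zero. -/
def homMk {M N : GrMod 𝒜} (f : M →ₗ[Rᵐᵒᵖ] N)
    (hf : ∀ (i : ℤ) (x : M), x ∈ M.gr i → f x ∈ N.gr i) : M ⟶ N :=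
  Hom.mk f (fun {i} {x} h => hf i x h)

@[simp] lemma toLin_homMk {M N : GrMod 𝒜} (f : M →ₗ[Rᵐᵒᵖ] N)
    (hf : ∀ (i : ℤ) (x : M), x ∈ M.gr i → f x ∈ N.gr i) : Hom.toLin (homMk f hf) = f := rfl

@[ext] lemma hom_ext {M N : GrMod 𝒜} {f g : M ⟶ N} (h : ∀ x, Hom.toLin f x = Hom.toLin g x) :
    f = g := Hom.ext (LinearMap.ext h)

@[simp] lemma id_apply {M : GrMod 𝒜} (x : M) : Hom.toLin (𝟙 M) x = x := rfl

@[simp] lemma comp_apply {M N P : GrMod 𝒜} (f : M ⟶ N) (g : N ⟶ P) (x : M) :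
    Hom.toLin (f ≫ g) x = Hom.toLin g (Hom.toLin f x) := rfl

instance (M N : GrMod 𝒜) : Zero (M ⟶ N) := ⟨homMk 0 fun i _ _ => (N.gr i).zero_mem⟩
instance (M N : GrMod 𝒜) : Add (M ⟶ N) := ⟨fun f g => homMk (Hom.toLin f + Hom.toLin g)
  fun i _ h => (N.gr i).add_mem (Hom.toLin_mem f h) (Hom.toLin_mem g h)⟩
instance (M N : GrMod 𝒜) : Neg (M ⟶ N) := ⟨fun f => homMk (-Hom.toLin f)
  fun i _ h => (N.gr i).neg_mem (Hom.toLin_mem f h)⟩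
instance (M N : GrMod 𝒜) : Sub (M ⟶ N) := ⟨fun f g => homMk (Hom.toLin f - Hom.toLin g)
  fun i _ h => (N.gr i).sub_mem (Hom.toLin_mem f h) (Hom.toLin_mem g h)⟩
instance (M N : GrMod 𝒜) : SMul ℕ (M ⟶ N) := ⟨fun n f => homMk (n • Hom.toLin f)
  fun i _ h => (N.gr i).nsmul_mem (Hom.toLin_mem f h) n⟩
instance (M N : GrMod 𝒜) : SMul ℤ (M ⟶ N) := ⟨fun n f => homMk (n • Hom.toLin f)
  fun i _ h => (N.gr i).zsmul_mem (Hom.toLin_mem f h) n⟩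

lemma toLin_injective (M N : GrMod 𝒜) :
    Function.Injective (Hom.toLin : (M ⟶ N) → (M →ₗ[Rᵐᵒᵖ] N)) :=
  fun _ _ h => Hom.ext h

instance (M N : GrMod 𝒜) : AddCommGroup (M ⟶ N) :=
  (toLin_injective M N).addCommGroup _ rfl (fun _ _ => rfl) (fun _ => rfl) (fun _ _ => rfl)
    (fun _ _ => rfl) (fun _ _ => rfl)

@[simp] lemma zero_apply {M N : GrMod 𝒜} (x : M) : Hom.toLin (0 : M ⟶ N) x = 0 := rfl
@[simp] lemma add_apply {M N : GrMod 𝒜} (f g : M ⟶ N) (x : M) :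
    Hom.toLin (f + g) x = Hom.toLin f x + Hom.toLin g x := rfl
@[simp] lemma neg_apply {M N : GrMod 𝒜} (f : M ⟶ N) (x : M) :
    Hom.toLin (-f) x = -Hom.toLin f x := rfl
@[simp] lemma sub_apply {M N : GrMod 𝒜} (f g : M ⟶ N) (x : M) :
    Hom.toLin (f - g) x = Hom.toLin f x - Hom.toLin g x := rfl

instance : Preadditive (GrMod 𝒜) where
  add_comp _ _ _ _ _ h := by ext x; exact map_add (Hom.toLin h) _ _
  comp_add _ _ _ _ _ _ := by ext x; rfl

lemma isInternal_of {M : Type*} [AddCommGroup M] (ℳ : ℤ → AddSubgroup M)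
    (hspan : ∀ x : M, ∃ (s : Finset ℤ) (v : ℤ → M), (∀ i, v i ∈ ℳ i) ∧ ∑ i ∈ s, v i = x)
    (hind : ∀ (s : Finset ℤ) (v : ℤ → M), (∀ i, v i ∈ ℳ i) → ∑ i ∈ s, v i = 0 →
      ∀ i ∈ s, v i = 0) : DirectSum.IsInternal ℳ := by
  classical
  refine ⟨(injective_iff_map_eq_zero _).2 fun v hv => ?_, fun x => ?_⟩
  · ext i
    by_cases hi : i ∈ DFinsupp.support v
    · rw [DirectSum.coeAddMonoidHom_eq_dfinsuppSum, DFinsupp.sum] at hv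
      exact hind _ (fun i => (v i : M)) (fun i => (v i).2) hv i hi
    · simpa using hi
  · obtain ⟨s, v, hv, rfl⟩ := hspan x
    refine ⟨∑ i ∈ s, DirectSum.of (fun i => ℳ i) i ⟨v i, hv i⟩, ?_⟩
    simp [map_sum]

/-- The component of degree `i` of an element. -/
def proj (M : GrMod 𝒜) (i : ℤ) : M →+ M := by
  classical
  letI : DirectSum.Decomposition M.gr := M.isInternal.chooseDecomposition
  exact (M.gr i).subtype.comp ((DFinsupp.evalAddMonoidHom i).comp
    (DirectSum.decomposeAddEquiv M.gr).toAddMonoidHom)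

lemma proj_mem (M : GrMod 𝒜) (i : ℤ) (x : M) : M.proj i x ∈ M.gr i := by
  classical
  let _ : DirectSum.Decomposition M.gr := M.isInternal.chooseDecomposition
  exact (DirectSum.decompose M.gr x i).2

lemma proj_of_mem (M : GrMod 𝒜) {i : ℤ} {x : M} (hx : x ∈ M.gr i) : M.proj i x = x := by
  classical
  let _ : DirectSum.Decomposition M.gr := M.isInternal.chooseDecomposition
  exact DirectSum.decompose_of_mem_same M.gr hx

lemma proj_of_mem_ne (M : GrMod 𝒜) {i j : ℤ} {x : M} (hx : x ∈ M.gr i) (hij : i ≠ j) :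
    M.proj j x = 0 := by
  classical
  let _ : DirectSum.Decomposition M.gr := M.isInternal.chooseDecomposition
  exact DirectSum.decompose_of_mem_ne M.gr hx hij

lemma exists_sum_proj (M : GrMod 𝒜) (x : M) :
    ∃ s : Finset ℤ, ∀ t : Finset ℤ, s ⊆ t → ∑ i ∈ t, M.proj i x = x := by
  classical
  let _ : DirectSum.Decomposition M.gr := M.isInternal.chooseDecomposition
  refine ⟨DFinsupp.support (DirectSum.decompose M.gr x), fun t ht => ?_⟩
  conv_rhs => rw [← DirectSum.sum_support_decompose M.gr x]
  refine (Finset.sum_subset ht fun i _ hi => ?_).symm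
  have h : DirectSum.decompose M.gr x i = 0 := DFinsupp.notMem_support_iff.1 hi
  exact congrArg Subtype.val h

lemma proj_sum (M : GrMod 𝒜) (s : Finset ℤ) (v : ℤ → M) (hv : ∀ i, v i ∈ M.gr i) {j : ℤ}
    (hj : j ∈ s) : M.proj j (∑ i ∈ s, v i) = v j := by
  classical
  rw [map_sum, Finset.sum_eq_single j, M.proj_of_mem (hv j)]
  · exact fun i _ hij => M.proj_of_mem_ne (hv i) hij
  · exact fun h => (h hj).elim

lemma map_proj {M N : GrMod 𝒜} (f : M ⟶ N) (i : ℤ) (x : M) :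
    Hom.toLin f (M.proj i x) = N.proj i (Hom.toLin f x) := by
  classical
  obtain ⟨s, hs⟩ := M.exists_sum_proj x
  have h := hs (insert i s) (Finset.subset_insert _ _)
  conv_rhs => rw [← h, map_sum]
  rw [N.proj_sum _ (fun j => Hom.toLin f (M.proj j x))
    (fun j => Hom.toLin_mem f (M.proj_mem j x)) (Finset.mem_insert_self _ _)]

lemma exists_homogeneous_preimage {M N : GrMod 𝒜} (f : M ⟶ N) {i : ℤ} {y : N} (hy : y ∈ N.gr i)
    {x : M} (hx : Hom.toLin f x = y) : ∃ x' ∈ M.gr i, Hom.toLin f x' = y :=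
  ⟨M.proj i x, M.proj_mem i x, by rw [map_proj, hx, N.proj_of_mem hy]⟩

/-- The kernel of a morphism, with the induced grading. -/
def ker {M N : GrMod 𝒜} (f : M ⟶ N) : GrMod 𝒜 where
  carrier := LinearMap.ker (Hom.toLin f)
  gr i := (M.gr i).comap (LinearMap.ker (Hom.toLin f)).subtype.toAddMonoidHom
  isInternal := by
    refine isInternal_of _ (fun x => ?_) (fun s v hv h i hi => ?_)
    · obtain ⟨s, hs⟩ := M.exists_sum_proj x
      refine ⟨s, fun i => ⟨M.proj i x, ?_⟩, fun i => M.proj_mem i _, Subtype.ext ?_⟩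
      · rw [LinearMap.mem_ker, map_proj, LinearMap.mem_ker.1 x.2, map_zero]
      · simpa using hs s subset_rfl
    · have h' : ∑ i ∈ s, (v i : M) = 0 := by
        simpa using congrArg (Subtype.val) h
      have := M.proj_sum s (fun i => (v i : M)) hv hi
      rw [h', map_zero] at this
      exact Subtype.ext this.symm
  smul_mem ha hx := M.smul_mem ha hx

/-- The inclusion of the kernel. -/
def kerι {M N : GrMod 𝒜} (f : M ⟶ N) : ker f ⟶ M :=
  homMk (LinearMap.ker (Hom.toLin f)).subtype fun _ _ h => h

/-- The cokernel of a morphism, with the induced grading. -/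
def coker {M N : GrMod 𝒜} (f : M ⟶ N) : GrMod 𝒜 where
  carrier := N ⧸ LinearMap.range (Hom.toLin f)
  gr i := (N.gr i).map (LinearMap.range (Hom.toLin f)).mkQ.toAddMonoidHom
  isInternal := by
    refine isInternal_of _ (fun x => ?_) (fun s v hv h i hi => ?_)
    · obtain ⟨y, rfl⟩ := Submodule.mkQ_surjective _ x
      obtain ⟨s, hs⟩ := N.exists_sum_proj y
      refine ⟨s, fun i => Submodule.mkQ _ (N.proj i y), fun i => ⟨_, N.proj_mem i y, rfl⟩, ?_⟩
      rw [← map_sum, hs s subset_rfl]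
    · choose n hn hnv using hv
      have hsum : Submodule.mkQ (LinearMap.range (Hom.toLin f)) (∑ i ∈ s, n i) = 0 := by
        rw [map_sum, ← h]
        exact Finset.sum_congr rfl fun i _ => hnv i
      rw [Submodule.mkQ_apply, Submodule.Quotient.mk_eq_zero] at hsum
      obtain ⟨m, hm⟩ := hsum
      have := N.proj_sum s n hn hi
      rw [← hm, ← map_proj] at this
      rw [← hnv i, ← this]
      exact (Submodule.Quotient.mk_eq_zero _).2 ⟨_, rfl⟩
  smul_mem := by
    rintro i j a _ ha ⟨x, hx, rfl⟩
    exact ⟨op a • x, N.smul_mem ha hx, rfl⟩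

/-- The projection to the cokernel. -/
def cokerπ {M N : GrMod 𝒜} (f : M ⟶ N) : N ⟶ coker f :=
  homMk (LinearMap.range (Hom.toLin f)).mkQ fun _ x h => ⟨x, h, rfl⟩

lemma comp_cokerπ {M N : GrMod 𝒜} (f : M ⟶ N) : f ≫ cokerπ f = 0 := by
  ext x
  exact (Submodule.Quotient.mk_eq_zero _).2 ⟨x, rfl⟩

lemma kerι_comp {M N : GrMod 𝒜} (f : M ⟶ N) : kerι f ≫ f = 0 := by
  ext x
  exact x.2

/-- The universal property of the cokernel. -/
def cokerDesc {M N P : GrMod 𝒜} (f : M ⟶ N) (g : N ⟶ P) (h : f ≫ g = 0) : coker f ⟶ P :=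
  homMk ((LinearMap.range (Hom.toLin f)).liftQ (Hom.toLin g) (by
    rintro _ ⟨x, rfl⟩
    exact congrArg (fun φ => Hom.toLin φ x) h)) (by
    rintro i _ ⟨x, hx, rfl⟩
    exact Hom.toLin_mem g hx)

/-- The direct sum of two graded modules. -/
def prod (M N : GrMod 𝒜) : GrMod 𝒜 where
  carrier := M × N
  gr i := (M.gr i).prod (N.gr i)
  isInternal := by
    classical
    refine isInternal_of _ (fun x => ?_) (fun s v hv h i hi => ?_)
    · obtain ⟨s, hs⟩ := M.exists_sum_proj x.1
      obtain ⟨t, ht⟩ := N.exists_sum_proj x.2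
      refine ⟨s ∪ t, fun i => (M.proj i x.1, N.proj i x.2),
        fun i => ⟨M.proj_mem i _, N.proj_mem i _⟩, Prod.ext ?_ ?_⟩
      · simpa [Prod.fst_sum] using hs _ Finset.subset_union_left
      · simpa [Prod.snd_sum] using ht _ Finset.subset_union_right
    · have h₁ := M.proj_sum s (fun i => (v i).1) (fun i => (hv i).1) hi
      have h₂ := N.proj_sum s (fun i => (v i).2) (fun i => (hv i).2) hi
      rw [← Prod.fst_sum, h, Prod.fst_zero, map_zero] at h₁
      rw [← Prod.snd_sum, h, Prod.snd_zero, map_zero] at h₂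
      exact Prod.ext h₁.symm h₂.symm
  smul_mem ha hx := ⟨M.smul_mem ha hx.1, N.smul_mem ha hx.2⟩

/-- The zero graded module. -/
def zeroObj (𝒜 : ℕ → σ) : GrMod 𝒜 where
  carrier := PUnit
  gr _ := ⊤
  isInternal := isInternal_of _ (fun _ => ⟨∅, 0, fun _ => trivial, Subsingleton.elim _ _⟩)
    (fun _ _ _ _ _ _ => Subsingleton.elim _ _)
  smul_mem _ _ := trivial

instance : HasZeroObject (GrMod 𝒜) := ⟨zeroObj 𝒜, by
  rw [IsZero.iff_id_eq_zero]
  ext x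
  exact Subsingleton.elim (α := PUnit) _ _⟩

instance : HasBinaryBiproducts (GrMod 𝒜) := by
  refine ⟨fun M N => HasBinaryBiproduct.mk ⟨
    { pt := M.prod N
      fst := homMk (LinearMap.fst _ _ _) fun _ _ h => h.1
      snd := homMk (LinearMap.snd _ _ _) fun _ _ h => h.2
      inl := homMk (LinearMap.inl _ _ _) fun i _ h => ⟨h, (N.gr i).zero_mem⟩
      inr := homMk (LinearMap.inr _ _ _) fun i _ h => ⟨(M.gr i).zero_mem, h⟩
      inl_fst := rfl
      inl_snd := rfl
      inr_fst := rfl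
      inr_snd := rfl }, isBinaryBilimitOfTotal _ ?_⟩⟩
  ext x
  · exact Prod.ext (add_zero _) (zero_add _)

instance : HasFiniteProducts (GrMod 𝒜) :=
  hasFiniteProducts_of_has_binary_and_terminal

/-- The explicit kernel is a kernel. -/
def kerIsLimit {M N : GrMod 𝒜} (f : M ⟶ N) :
    IsLimit (KernelFork.ofι (kerι f) (kerι_comp f)) :=
  KernelFork.IsLimit.ofι _ _
    (fun g hg => homMk ((Hom.toLin g).codRestrict _
      (fun x => congrArg (fun φ => Hom.toLin φ x) hg)) fun _ _ h => Hom.toLin_mem g h)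
    (fun g hg => rfl)
    (fun g hg m hm => by
      ext x
      exact Subtype.ext (congrArg (fun φ => Hom.toLin φ x) hm))

/-- The explicit cokernel is a cokernel. -/
def cokerIsColimit {M N : GrMod 𝒜} (f : M ⟶ N) :
    IsColimit (CokernelCofork.ofπ (cokerπ f) (comp_cokerπ f)) :=
  CokernelCofork.IsColimit.ofπ _ _
    (fun g hg => cokerDesc f g hg)
    (fun g hg => rfl)
    (fun g hg m hm => by
      ext x
      obtain ⟨y, rfl⟩ := Submodule.mkQ_surjective _ x
      exact congrArg (fun φ => Hom.toLin φ y) hm)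

instance : HasKernels (GrMod 𝒜) := ⟨fun f => ⟨⟨⟨_, kerIsLimit f⟩⟩⟩⟩

instance : HasCokernels (GrMod 𝒜) := ⟨fun f => ⟨⟨⟨_, cokerIsColimit f⟩⟩⟩⟩

lemma injective_of_mono {M N : GrMod 𝒜} (f : M ⟶ N) [Mono f] :
    Function.Injective (Hom.toLin f) := by
  rw [injective_iff_map_eq_zero]
  intro x hx
  have h : kerι f = 0 := by rw [← cancel_mono f, kerι_comp, zero_comp]
  exact congrArg (fun φ => Hom.toLin φ (⟨x, hx⟩ : LinearMap.ker (Hom.toLin f))) h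

lemma surjective_of_epi {M N : GrMod 𝒜} (f : M ⟶ N) [Epi f] :
    Function.Surjective (Hom.toLin f) := by
  intro y
  have h : cokerπ f = 0 := by rw [← cancel_epi f, comp_cokerπ, comp_zero]
  exact (Submodule.Quotient.mk_eq_zero _).1 (congrArg (fun φ => Hom.toLin φ y) h)

lemma mem_gr_of_injective {M N : GrMod 𝒜} (f : M ⟶ N) (hf : Function.Injective (Hom.toLin f))
    {i : ℤ} {x : M} (hx : Hom.toLin f x ∈ N.gr i) : x ∈ M.gr i := by
  obtain ⟨x', hx', h⟩ := exists_homogeneous_preimage f hx rfl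
  rwa [← hf h]

instance : IsNormalMonoCategory (GrMod 𝒜) where
  normalMonoOfMono {M N} f _ := by
    have hinj := injective_of_mono f
    have key : ∀ {P : GrMod 𝒜} (g : P ⟶ N), g ≫ cokerπ f = 0 →
        ∃ l : P ⟶ M, l ≫ f = g := by
      intro P g hg
      have hr : ∀ x, Hom.toLin g x ∈ LinearMap.range (Hom.toLin f) := fun x =>
        (Submodule.Quotient.mk_eq_zero _).1 (congrArg (fun φ => Hom.toLin φ x) hg)
      have e : ∀ x, Hom.toLin f ((LinearEquiv.ofInjective (Hom.toLin f) hinj).symm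
          ⟨Hom.toLin g x, hr x⟩) = Hom.toLin g x := fun x => by
        have := (LinearEquiv.ofInjective (Hom.toLin f) hinj).apply_symm_apply
          ⟨Hom.toLin g x, hr x⟩
        exact congrArg Subtype.val this
      refine ⟨homMk ((LinearEquiv.ofInjective (Hom.toLin f) hinj).symm.toLinearMap ∘ₗ
        (Hom.toLin g).codRestrict _ hr) fun i x hx => mem_gr_of_injective f hinj ?_, ?_⟩
      · exact (e x).symm ▸ Hom.toLin_mem g hx
      · ext x
        exact e x
    choose l hl using @key
    exact ⟨{ Z := coker f, g := cokerπ f, w := comp_cokerπ f,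
             isLimit := KernelFork.IsLimit.ofι _ _ (fun g hg => l g hg) (fun g hg => hl g hg)
              (fun g hg m hm => by rw [← cancel_mono f, hm, hl]) }⟩

instance : IsNormalEpiCategory (GrMod 𝒜) where
  normalEpiOfEpi {M N} f _ := by
    have hsurj := surjective_of_epi f
    have key : ∀ {P : GrMod 𝒜} (g : M ⟶ P), kerι f ≫ g = 0 →
        ∃ l : N ⟶ P, f ≫ l = g := by
      intro P g hg
      have hk : LinearMap.ker (Hom.toLin f) ≤ LinearMap.ker (Hom.toLin g) := fun x hx =>
        LinearMap.mem_ker.2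
          (congrArg (fun φ => Hom.toLin φ (⟨x, hx⟩ : LinearMap.ker (Hom.toLin f))) hg)
      have e : ∀ x, ((LinearMap.ker (Hom.toLin f)).liftQ (Hom.toLin g) hk)
          (((Hom.toLin f).quotKerEquivOfSurjective hsurj).symm (Hom.toLin f x)) =
            Hom.toLin g x := fun x => by
        have : ((Hom.toLin f).quotKerEquivOfSurjective hsurj).symm (Hom.toLin f x) =
            Submodule.Quotient.mk x := by
          rw [LinearEquiv.symm_apply_eq]
          rfl
        rw [this]
        rfl
      refine ⟨homMk ((LinearMap.ker (Hom.toLin f)).liftQ (Hom.toLin g) hk ∘ₗ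
        ((Hom.toLin f).quotKerEquivOfSurjective hsurj).symm.toLinearMap) fun i y hy => ?_, ?_⟩
      · obtain ⟨x, hx⟩ := hsurj y
        obtain ⟨x', hx', rfl⟩ := exists_homogeneous_preimage f hy hx
        exact (e x').symm ▸ Hom.toLin_mem g hx'
      · ext x
        exact e x
    choose l hl using @key
    exact ⟨{ W := ker f, g := kerι f, w := kerι_comp f,
             isColimit := CokernelCofork.IsColimit.ofπ _ _ (fun g hg => l g hg)
              (fun g hg => hl g hg) (fun g hg m hm => by rw [← cancel_epi f, hm, hl]) }⟩

instance : Abelian (GrMod 𝒜) where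

end GrMod
section SingularityCategory

open DerivedCategory Pretriangulated ZeroObject

variable (C : Type*) [Category* C] [Abelian C] [HasDerivedCategory.{w} C]

/-- The bounded derived category of an abelian category. -/
abbrev BoundedDerivedCategory : Type _ :=
  (TStructure.t : Triangulated.TStructure (DerivedCategory C)).bounded.FullSubcategory

/-- An object of the derived category is perfect if it is isomorphic to
(the image of) a bounded complex of projective objects. -/
def IsPerfectComplex : ObjectProperty (DerivedCategory C) := fun X =>
  ∃ (K : CochainComplex C ℤ) (a b : ℤ), K.IsStrictlyGE a ∧ K.IsStrictlyLE b ∧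
    (∀ i, Projective (K.X i)) ∧ Nonempty (X ≅ Q.obj K)

instance : (IsPerfectComplex C).IsClosedUnderIsomorphisms where
  of_iso := by
    rintro X Y e ⟨K, a, b, ha, hb, hK, ⟨e'⟩⟩
    exact ⟨K, a, b, ha, hb, hK, ⟨e.symm ≪≫ e'⟩⟩

instance : (IsPerfectComplex C).IsStableUnderShift ℤ where
  isStableUnderShiftBy n :=
    { le_shift := by
        rintro X ⟨K, a, b, ha, hb, hK, ⟨e⟩⟩
        exact ⟨K⟦n⟧, a - n, b - n, K.isStrictlyGE_shift a n _ (by lia),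
          K.isStrictlyLE_shift b n _ (by lia), fun i => hK (i + n),
          ⟨(shiftFunctor _ n).mapIso e ≪≫ ((Q.commShiftIso n).app K).symm⟩⟩ }

instance : (IsPerfectComplex C).ContainsZero where
  exists_zero := ⟨0, isZero_zero _, (0 : CochainComplex C ℤ), 0, 0, inferInstance, inferInstance,
    fun i => ((HomologicalComplex.eval C (ComplexShape.up ℤ) i).map_isZero (isZero_zero _)).projective,
    ⟨Q.mapZeroObject.symm⟩⟩

lemma exists_chain_map {K L : CochainComplex C ℤ} (b : ℤ) [K.IsStrictlyLE b]
    (hK : ∀ i, Projective (K.X i)) (f : Q.obj K ⟶ Q.obj L) : ∃ g : K ⟶ L, Q.map g = f := by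
  have := K.isKProjective_of_projective b
  obtain ⟨h, hh⟩ := (CochainComplex.IsKProjective.Qh_map_bijective K
    ((HomotopyCategory.quotient _ _).obj L)).2
      ((quotientCompQhIso C).hom.app K ≫ f ≫ (quotientCompQhIso C).inv.app L)
  obtain ⟨g, rfl⟩ := (HomotopyCategory.quotient _ _).map_surjective h
  refine ⟨g, ?_⟩
  have h₁ := (quotientCompQhIso C).hom.naturality g
  rw [Functor.comp_map, hh] at h₁
  simpa using h₁.symm

instance : (IsPerfectComplex C).IsTriangulatedClosed₃ := .mk' (by
  rintro T hT ⟨K, a, b, ha, hb, hK, ⟨e⟩⟩ ⟨L, a', b', ha', hb', hL, ⟨e'⟩⟩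
  obtain ⟨g, hg⟩ := exists_chain_map C b hK (e.inv ≫ T.mor₁ ≫ e'.hom)
  have iso := isoTriangleOfIso₁₂ _ _ hT (mappingCone_triangle_distinguished g) e e'
    (by
      change T.mor₁ ≫ e'.hom = e.hom ≫ Q.map g
      simp [hg])
  refine ⟨CochainComplex.mappingCone g, min (a - 1) a', max (b - 1) b', ?_, ?_, fun i => ?_,
    ⟨Triangle.π₃.mapIso iso⟩⟩
  · rw [CochainComplex.isStrictlyGE_iff]
    intro i hi
    rw [CochainComplex.mappingCone.isZero_X_iff]
    exact ⟨K.isZero_of_isStrictlyGE a _ (by lia), L.isZero_of_isStrictlyGE a' _ (by lia)⟩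
  · rw [CochainComplex.isStrictlyLE_iff]
    intro i hi
    rw [CochainComplex.mappingCone.isZero_X_iff]
    exact ⟨K.isZero_of_isStrictlyLE b _ (by lia), L.isZero_of_isStrictlyLE b' _ (by lia)⟩
  · have := hK (i + 1)
    have := hL i
    exact Projective.of_iso
      (HomologicalComplex.homotopyCofiber.XIsoBiprod g i (i + 1) rfl).symm inferInstance)

instance : (IsPerfectComplex C).IsTriangulated where
  toIsTriangulatedClosed₂ := .of_isTriangulatedClosed₃

/-- The full subcategory of perfect complexes in the bounded derived category. -/
abbrev perfectComplexes : ObjectProperty (BoundedDerivedCategory C) :=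
  (IsPerfectComplex C).inverseImage (ObjectProperty.ι _)

/-- The singularity category: the Verdier quotient of the bounded derived category by
the full triangulated subcategory of perfect complexes, i.e. its localization with respect to the
morphisms whose cone is perfect.  It carries the triangulated structure induced from the
bounded derived category. -/
abbrev SingularityCategory : Type _ := (perfectComplexes C).trW.Localization

/-- The functor to the singularity category sending an object to the corresponding
complex concentrated in degree `0`. -/
def toSingularityCategory : C ⥤ SingularityCategory C :=
  ObjectProperty.lift _ (DerivedCategory.singleFunctor C 0)
    (fun _ => ⟨⟨0, inferInstance⟩, ⟨0, inferInstance⟩⟩) ⋙ (perfectComplexes C).trW.Q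


end SingularityCategory

namespace GrMod

section

variable {R : Type u} [Ring R] {σ : Type*} [SetLike σ R] {𝒜 : ℕ → σ}

/-- The property of being finitely generated. -/
def isFG (𝒜 : ℕ → σ) : ObjectProperty (GrMod 𝒜) := fun M => Module.Finite Rᵐᵒᵖ M

instance : (isFG 𝒜).IsClosedUnderQuotients where
  prop_of_epi f _ hX :=
    have : Module.Finite Rᵐᵒᵖ _ := hX
    Module.Finite.of_surjective (Hom.toLin f) (surjective_of_epi f)

instance [IsNoetherianRing Rᵐᵒᵖ] : (isFG 𝒜).IsClosedUnderSubobjects where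
  prop_of_mono f _ hY :=
    have : Module.Finite Rᵐᵒᵖ _ := hY
    Module.Finite.of_injective (Hom.toLin f) (injective_of_mono f)

lemma isFG_coker {M N : GrMod 𝒜} (f : M ⟶ N) (hN : isFG 𝒜 N) : isFG 𝒜 (coker f) :=
  have : Module.Finite Rᵐᵒᵖ N := hN
  Module.Finite.of_surjective (LinearMap.range (Hom.toLin f)).mkQ (Submodule.mkQ_surjective _)

instance : (isFG 𝒜).ContainsZero where
  exists_zero := ⟨zeroObj 𝒜, by
    rw [IsZero.iff_id_eq_zero]
    ext x
    exact Subsingleton.elim (α := PUnit) _ _, inferInstanceAs (Module.Finite Rᵐᵒᵖ PUnit.{u + 1})⟩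

lemma isFG_prod {M N : GrMod 𝒜} (hM : isFG 𝒜 M) (hN : isFG 𝒜 N) : isFG 𝒜 (M.prod N) :=
  have : Module.Finite Rᵐᵒᵖ M := hM
  have : Module.Finite Rᵐᵒᵖ N := hN
  inferInstanceAs (Module.Finite Rᵐᵒᵖ (M × N))

/-- The first projection from a direct sum. -/
def fst (M N : GrMod 𝒜) : M.prod N ⟶ M := homMk (LinearMap.fst _ _ _) fun _ _ h => h.1

/-- The second projection from a direct sum. -/
def snd (M N : GrMod 𝒜) : M.prod N ⟶ N := homMk (LinearMap.snd _ _ _) fun _ _ h => h.2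

/-- The first inclusion into a direct sum. -/
def inl (M N : GrMod 𝒜) : M ⟶ M.prod N :=
  homMk (LinearMap.inl _ _ _) fun i _ h => ⟨h, (N.gr i).zero_mem⟩

/-- The morphism into a direct sum with given components. -/
def lift {P M N : GrMod 𝒜} (f : P ⟶ M) (g : P ⟶ N) : P ⟶ M.prod N :=
  homMk (LinearMap.prod (Hom.toLin f) (Hom.toLin g))
    fun _ _ h => ⟨Hom.toLin_mem f h, Hom.toLin_mem g h⟩

/-- The explicit direct sum is a product. -/
def prodIsLimit (M N : GrMod 𝒜) : IsLimit (BinaryFan.mk (fst M N) (snd M N)) :=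
  BinaryFan.IsLimit.mk _ (fun f g => lift f g) (fun _ _ => rfl) (fun _ _ => rfl)
    (fun f g m h₁ h₂ => by
      ext x
      exact Prod.ext (congrArg (fun φ => Hom.toLin φ x) h₁)
        (congrArg (fun φ => Hom.toLin φ x) h₂))

instance : (isFG 𝒜).IsClosedUnderBinaryProducts where
  limitsOfShape_le := by
    rintro X ⟨p⟩
    exact (isFG 𝒜).prop_of_iso (IsLimit.conePointUniqueUpToIso (prodIsLimit _ _)
      ((IsLimit.postcomposeHomEquiv (diagramIsoPair p.diag) _).2 p.isLimit))
      (isFG_prod (p.prop_diag_obj (.mk .left)) (p.prop_diag_obj (.mk .right)))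

instance : (isFG 𝒜).IsClosedUnderFiniteProducts := .mk'

/-- The category of finitely generated graded right modules. -/
abbrev FG (𝒜 : ℕ → σ) : Type _ := (isFG 𝒜).FullSubcategory

/-- A graded module is finitely generated free if it has a finite basis of homogeneous
elements, i.e. if it is a finite direct sum of twists of the free module of rank one. -/
def IsFiniteFree (M : GrMod 𝒜) : Prop :=
  ∃ (ι : Type) (_ : Finite ι) (b : Module.Basis ι Rᵐᵒᵖ M) (d : ι → ℤ), ∀ i, b i ∈ M.gr (d i)

lemma IsFiniteFree.isFG {M : GrMod 𝒜} (h : IsFiniteFree M) : isFG 𝒜 M := by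
  obtain ⟨ι, _, b, -⟩ := h
  exact Module.Finite.of_basis b

lemma IsFiniteFree.prod {M N : GrMod 𝒜} (hM : IsFiniteFree M) (hN : IsFiniteFree N) :
    IsFiniteFree (M.prod N) := by
  obtain ⟨ι, _, b, d, hb⟩ := hM
  obtain ⟨κ, _, c, e, hc⟩ := hN
  refine ⟨ι ⊕ κ, inferInstance, b.prod c, Sum.elim d e, ?_⟩
  rintro (i | i)
  · have h : b.prod c (Sum.inl i) = (b i, 0) := by simp [Module.Basis.prod_apply]
    exact (congrArg (· ∈ (M.gr (d i)).prod (N.gr (d i))) h).mpr ⟨hb i, (N.gr _).zero_mem⟩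
  · have h : b.prod c (Sum.inr i) = (0, c i) := by simp [Module.Basis.prod_apply]
    exact (congrArg (· ∈ (M.gr (e i)).prod (N.gr (e i))) h).mpr ⟨(M.gr _).zero_mem, hc i⟩

/-- The twist `M(n)` of a graded module: `M(n)_i = M_{n+i}`. -/
def twistObj (n : ℤ) (M : GrMod 𝒜) : GrMod 𝒜 where
  carrier := M
  gr i := M.gr (n + i)
  isInternal := by
    refine isInternal_of _ (fun x => ?_) (fun s v hv h i hi => ?_)
    · obtain ⟨s, hs⟩ := M.exists_sum_proj x
      refine ⟨s.map (addLeftEmbedding (-n)), fun i => M.proj (n + i) x,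
        fun i => M.proj_mem _ _, ?_⟩
      simpa using hs s subset_rfl
    · have := M.proj_sum (s.map (addLeftEmbedding n)) (fun j => v (-n + j))
        (fun j => by simpa using hv (-n + j)) (j := n + i) (by simpa using hi)
      simpa [h] using this.symm
  smul_mem {i j a x} ha hx := by
    rw [← add_assoc]
    exact M.smul_mem ha hx

/-- The twist functor `M ↦ M(n)`, which is the identity on the underlying linear maps. -/
def twist (n : ℤ) : GrMod 𝒜 ⥤ GrMod 𝒜 where
  obj M := twistObj n M
  map {M N} f := homMk (M := twistObj n M) (N := twistObj n N) (Hom.toLin (M := M) (N := N) f)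
    fun _ _ h => Hom.toLin_mem f h

lemma twist_map_apply (n : ℤ) {M N : GrMod 𝒜} (f : M ⟶ N) (x : M) :
    Hom.toLin ((twist n).map f) x = Hom.toLin f x := rfl

instance (n : ℤ) : (twist (𝒜 := 𝒜) n).Additive where
  map_add := rfl

lemma IsFiniteFree.twist {M : GrMod 𝒜} (h : IsFiniteFree M) (n : ℤ) :
    IsFiniteFree ((twist n).obj M) := by
  obtain ⟨ι, _, b, d, hb⟩ := h
  refine ⟨ι, inferInstance, (b : Module.Basis ι Rᵐᵒᵖ M), fun i => -n + d i, fun i => ?_⟩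
  change b i ∈ M.gr (n + (-n + d i))
  simpa using hb i

end

end GrMod

/-- A homogeneous central element `W` of degree `n` of a graded algebra that is not a
zero-divisor. -/
structure Superpotential {k : Type*} [Field k] {B : Type u} [Ring B] [Algebra k B]
    (𝒜 : ℕ → Submodule k B) (n : ℕ) where
  elt : B
  mem : elt ∈ 𝒜 n
  central : ∀ b : B, elt * b = b * elt
  regular : ∀ b : B, b * elt = 0 → b = 0

namespace Superpotential

variable {k : Type*} [Field k] {B : Type u} [Ring B] [Algebra k B] {𝒜 : ℕ → Submodule k B}
  {n : ℕ} (W : Superpotential 𝒜 n)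

/-- The two-sided ideal `BW = WB`. -/
def ideal : Ideal B := Ideal.span {W.elt}

instance : W.ideal.IsTwoSided where
  mul_mem_of_left {a} b ha := by
    obtain ⟨c, rfl⟩ := Ideal.mem_span_singleton'.1 ha
    exact Ideal.mem_span_singleton'.2 ⟨c * b, by rw [mul_assoc, mul_assoc, W.central]⟩

/-- The quotient algebra `A = B / WB`. -/
abbrev Quot : Type u := B ⧸ W.ideal

/-- The grading of the quotient algebra induced by the grading of `B`. -/
def quotGrading (i : ℕ) : Submodule k W.Quot :=
  (𝒜 i).map (Ideal.Quotient.mkₐ k W.ideal).toLinearMap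

/-- Multiplication by `W` as a natural morphism `M ⟶ M(n)`. -/
def mul (M : GrMod 𝒜) : M ⟶ (GrMod.twist n).obj M :=
  GrMod.homMk
    { toFun := fun x => op W.elt • x
      map_add' := fun x y => smul_add _ x y
      map_smul' := fun b x => by
        change op W.elt • b • x = b • op W.elt • x
        rw [smul_smul, smul_smul]
        congr 1
        exact unop_injective (W.central b.unop).symm }
    (fun i x hx => by
      change op W.elt • x ∈ M.gr (n + i)
      rw [add_comm]
      exact M.smul_mem W.mem hx)

lemma mul_apply (M : GrMod 𝒜) (x : M) : GrMod.Hom.toLin (W.mul M) x = op W.elt • x := rfl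

/-- The right action of `B / WB` on a right `B`-module annihilated by `W`. -/
def quotAction (M : Type*) [AddCommGroup M] [Module Bᵐᵒᵖ M] (h : ∀ x : M, op W.elt • x = 0) :
    (W.Quot)ᵐᵒᵖ →+* AddMonoid.End M :=
  (RingEquiv.opOp (AddMonoid.End M)).symm.toRingHom.comp (RingHom.op
    (Ideal.Quotient.lift W.ideal
      ((RingHom.op (Module.toAddMonoidEnd Bᵐᵒᵖ M)).comp (RingEquiv.opOp B).toRingHom)
      (fun b hb => by
        obtain ⟨c, rfl⟩ := Ideal.mem_span_singleton'.1 hb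
        refine unop_injective (AddMonoidHom.ext fun x => ?_)
        change op (c * W.elt) • x = 0
        rw [op_mul, mul_smul, h])))

lemma quotAction_apply (M : Type*) [AddCommGroup M] [Module Bᵐᵒᵖ M]
    (h : ∀ x : M, op W.elt • x = 0) (b : B) (x : M) :
    W.quotAction M h (op (Ideal.Quotient.mk W.ideal b)) x = op b • x := rfl

/-- A graded `B`-module annihilated by `W`, viewed as a graded module over `A = B / WB`. -/
def quotModule (M : GrMod 𝒜) (h : ∀ x : M, op W.elt • x = 0) : GrMod W.quotGrading where
  carrier := M
  module := Module.compHom M (W.quotAction M h)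
  gr := M.gr
  isInternal := M.isInternal
  smul_mem := by
    rintro i j _ x ⟨b, hb, rfl⟩ hx
    exact M.smul_mem hb hx

/-- Morphisms between `B`-modules annihilated by `W` are morphisms of `A`-modules. -/
def quotMap {M N : GrMod 𝒜} (hM : ∀ x : M, op W.elt • x = 0) (hN : ∀ x : N, op W.elt • x = 0)
    (f : M ⟶ N) : W.quotModule M hM ⟶ W.quotModule N hN :=
  GrMod.homMk (M := W.quotModule M hM) (N := W.quotModule N hN)
    { toFun := fun x => GrMod.Hom.toLin f x
      map_add' := fun x y => map_add (GrMod.Hom.toLin f) x y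
      map_smul' := by
        intro a x
        obtain ⟨b, hb⟩ := Ideal.Quotient.mk_surjective a.unop
        obtain rfl : op (Ideal.Quotient.mk W.ideal b) = a := unop_injective hb
        exact (GrMod.Hom.toLin f).map_smul (op b) x }
    (fun _ _ h => GrMod.Hom.toLin_mem f h)

lemma isFG_quotModule {M : GrMod 𝒜} (h : ∀ x : M, op W.elt • x = 0) (hM : GrMod.isFG 𝒜 M) :
    GrMod.isFG W.quotGrading (W.quotModule M h) := by
  obtain ⟨s, hs⟩ := hM.fg_top
  let _ : Module (W.Quot)ᵐᵒᵖ M := Module.compHom M (W.quotAction M h)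
  change Module.Finite (W.Quot)ᵐᵒᵖ M
  refine ⟨⟨s, eq_top_iff.2 fun x _ => ?_⟩⟩
  have hx : x ∈ Submodule.span Bᵐᵒᵖ (s : Set M) := hs ▸ Submodule.mem_top
  induction hx using Submodule.span_induction with
  | mem x hx => exact Submodule.subset_span hx
  | zero => exact Submodule.zero_mem _
  | add x y _ _ hx hy => exact Submodule.add_mem _ (hx trivial) (hy trivial)
  | smul a x _ hx =>
    exact Submodule.smul_mem _ (op (Ideal.Quotient.mk W.ideal a.unop)) (hx trivial)

end Superpotential

/-- The objects of the category of graded pairs: pairs of finitely generated free graded right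
`B`-modules with morphisms `p₁ : P₁ ⟶ P₀` and `p₀ : P₀ ⟶ P₁(n)` whose compositions
`p₀ p₁` and `p₁(n) p₀` are the multiplication by `W`. -/
structure GrPair {k : Type*} [Field k] {B : Type u} [Ring B] [Algebra k B]
    {𝒜 : ℕ → Submodule k B} {n : ℕ} (W : Superpotential 𝒜 n) where
  P₁ : GrMod 𝒜
  P₀ : GrMod 𝒜
  free₁ : GrMod.IsFiniteFree P₁
  free₀ : GrMod.IsFiniteFree P₀
  p₁ : P₁ ⟶ P₀
  p₀ : P₀ ⟶ (GrMod.twist n).obj P₁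
  p₁_p₀ : p₁ ≫ p₀ = W.mul P₁
  p₀_p₁ : p₀ ≫ (GrMod.twist n).map p₁ = W.mul P₀

namespace GrPair

open GrMod

variable {k : Type*} [Field k] {B : Type u} [Ring B] [Algebra k B] {𝒜 : ℕ → Submodule k B}
  {n : ℕ} {W : Superpotential 𝒜 n}

/-- Morphisms of graded pairs. -/
@[ext]
structure Hom (P Q : GrPair W) where
  f₁ : P.P₁ ⟶ Q.P₁
  f₀ : P.P₀ ⟶ Q.P₀
  comm₁ : P.p₁ ≫ f₀ = f₁ ≫ Q.p₁
  comm₀ : P.p₀ ≫ (twist n).map f₁ = f₀ ≫ Q.p₀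

lemma Hom.comm₁_assoc {P Q : GrPair W} (f : Hom P Q) {M : GrMod 𝒜} (h : Q.P₀ ⟶ M) :
    P.p₁ ≫ f.f₀ ≫ h = f.f₁ ≫ Q.p₁ ≫ h := by
  rw [← Category.assoc, f.comm₁, Category.assoc]

lemma Hom.comm₀_assoc {P Q : GrPair W} (f : Hom P Q) {M : GrMod 𝒜}
    (h : (twist n).obj Q.P₁ ⟶ M) :
    P.p₀ ≫ (twist n).map f.f₁ ≫ h = f.f₀ ≫ Q.p₀ ≫ h := by
  rw [← Category.assoc, f.comm₀, Category.assoc]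

/-- The category `GrPair(W)`. -/
instance : Category (GrPair W) where
  Hom := Hom
  id P := ⟨𝟙 _, 𝟙 _, by simp, by simp⟩
  comp f g := ⟨f.f₁ ≫ g.f₁, f.f₀ ≫ g.f₀,
    by rw [f.comm₁_assoc, g.comm₁, Category.assoc],
    by rw [Functor.map_comp, f.comm₀_assoc, g.comm₀, Category.assoc]⟩

@[ext] lemma hom_ext {P Q : GrPair W} {f g : P ⟶ Q} (h₁ : Hom.f₁ f = Hom.f₁ g)
    (h₀ : Hom.f₀ f = Hom.f₀ g) : f = g := Hom.ext h₁ h₀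

@[simp] lemma id_f₁ (P : GrPair W) : Hom.f₁ (𝟙 P) = 𝟙 _ := rfl
@[simp] lemma id_f₀ (P : GrPair W) : Hom.f₀ (𝟙 P) = 𝟙 _ := rfl
@[simp] lemma comp_f₁ {P Q R : GrPair W} (f : P ⟶ Q) (g : Q ⟶ R) :
    Hom.f₁ (f ≫ g) = Hom.f₁ f ≫ Hom.f₁ g := rfl
@[simp] lemma comp_f₀ {P Q R : GrPair W} (f : P ⟶ Q) (g : Q ⟶ R) :
    Hom.f₀ (f ≫ g) = Hom.f₀ f ≫ Hom.f₀ g := rfl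

/-- Two morphisms are homotopic if their difference is null-homotopic: there are
`s : P₀ ⟶ Q₁` and `t : P₁ ⟶ Q₀(-n)` such that `f₁ - g₁ = q₀(-n) t + s p₁` and
`f₀ - g₀ = t(n) p₀ + q₁ s`.  Below `t` stands for `t(n) : P₁(n) ⟶ Q₀`, and the first equation is
twisted by `n`. -/
def Homotopic : HomRel (GrPair W) := fun P Q f g =>
  ∃ (s : P.P₀ ⟶ Q.P₁) (t : (twist n).obj P.P₁ ⟶ Q.P₀),
    (twist n).map (Hom.f₁ f - Hom.f₁ g) = t ≫ Q.p₀ + (twist n).map (P.p₁ ≫ s) ∧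
    Hom.f₀ f - Hom.f₀ g = P.p₀ ≫ t + s ≫ Q.p₁

instance : Congruence (Homotopic (W := W)) where
  equivalence :=
    { refl := fun f => ⟨0, 0, by simp, by simp⟩
      symm := by
        rintro f g ⟨s, t, h₁, h₀⟩
        refine ⟨-s, -t, ?_, ?_⟩
        · rw [← neg_sub, Functor.map_neg, h₁]
          simp [add_comm]
        · rw [← neg_sub, h₀]
          simp [add_comm]
      trans := by
        rintro f g h ⟨s, t, h₁, h₀⟩ ⟨s', t', h₁', h₀'⟩
        refine ⟨s + s', t + t', ?_, ?_⟩
        · rw [← sub_add_sub_cancel _ (Hom.f₁ g), Functor.map_add, h₁, h₁']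
          simp only [Preadditive.comp_add, Preadditive.add_comp, Functor.map_add]
          abel
        · rw [← sub_add_sub_cancel _ (Hom.f₀ g), h₀, h₀']
          simp only [Preadditive.comp_add, Preadditive.add_comp]
          abel }
  comp_left := by
    rintro P Q R f g g' ⟨s, t, h₁, h₀⟩
    refine ⟨Hom.f₀ f ≫ s, (twist n).map (Hom.f₁ f) ≫ t, ?_, ?_⟩
    · simp only [comp_f₁, ← Preadditive.comp_sub, Functor.map_comp, h₁, Preadditive.comp_add,
        Category.assoc]
      simp only [← Functor.map_comp, Hom.comm₁_assoc]
    · simp only [comp_f₀, ← Preadditive.comp_sub, h₀, Preadditive.comp_add, Category.assoc,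
        Hom.comm₀_assoc]
  comp_right := by
    rintro P Q R f f' g ⟨s, t, h₁, h₀⟩
    refine ⟨s ≫ Hom.f₁ g, t ≫ Hom.f₀ g, ?_, ?_⟩
    · simp only [comp_f₁, ← Preadditive.sub_comp, Functor.map_comp, h₁, Preadditive.add_comp,
        Category.assoc, Hom.comm₀]
    · simp only [comp_f₀, ← Preadditive.sub_comp, h₀, Preadditive.add_comp, Category.assoc,
        Hom.comm₁]

lemma p₀_p₁_apply (P : GrPair W) (x : P.P₁) :
    GrMod.Hom.toLin P.p₀ (GrMod.Hom.toLin P.p₁ x) = GrMod.Hom.toLin (W.mul P.P₁) x :=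
  congrArg (fun φ => GrMod.Hom.toLin φ x) P.p₁_p₀

lemma p₁_p₀_apply (P : GrPair W) (x : P.P₀) :
    GrMod.Hom.toLin ((twist n).map P.p₁) (GrMod.Hom.toLin P.p₀ x) = GrMod.Hom.toLin (W.mul P.P₀) x :=
  congrArg (fun φ => GrMod.Hom.toLin φ x) P.p₀_p₁

/-- The translation of a graded pair `(P₁, P₀)`, which is `(P₀, P₁(n))` with the
morphisms `-p₀` and `-p₁(n)`. -/
def translationObj (P : GrPair W) : GrPair W where
  P₁ := P.P₀
  P₀ := (twist n).obj P.P₁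
  free₁ := P.free₀
  free₀ := P.free₁.twist n
  p₁ := -P.p₀
  p₀ := -(twist n).map P.p₁
  p₁_p₀ := by simpa using P.p₀_p₁
  p₀_p₁ := by
    simp only [Functor.map_neg, Preadditive.neg_comp_neg, ← Functor.map_comp, P.p₁_p₀]
    ext x
    rfl

/-- The translation functor on graded pairs. -/
def translation : GrPair W ⥤ GrPair W where
  obj := translationObj
  map {P Q} f :=
    { f₁ := Hom.f₀ f
      f₀ := (twist n).map (Hom.f₁ f)
      comm₁ := (Preadditive.neg_comp _ _).trans
        ((congrArg Neg.neg (Hom.comm₀ f)).trans (Preadditive.comp_neg _ _).symm)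
      comm₀ := (Preadditive.neg_comp _ _).trans
        ((congrArg (fun φ => -(twist n).map φ) (Hom.comm₁ f)).trans
          (Preadditive.comp_neg ((twist n).map (Hom.f₁ f)) ((twist n).map Q.p₁)).symm) }

/-- The mapping cone of a morphism of graded pairs. -/
def cone {P Q : GrPair W} (f : P ⟶ Q) : GrPair W where
  P₁ := Q.P₁.prod P.P₀
  P₀ := Q.P₀.prod ((twist n).obj P.P₁)
  free₁ := Q.free₁.prod P.free₀
  free₀ := Q.free₀.prod (P.free₁.twist n)
  p₁ := GrMod.lift (fst _ _ ≫ Q.p₁ + snd _ _ ≫ Hom.f₀ f) (-(snd _ _ ≫ P.p₀))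
  p₀ := (GrMod.lift (fst _ _ ≫ Q.p₀ + snd _ _ ≫ (twist n).map (Hom.f₁ f))
    (-(snd _ _ ≫ (twist n).map P.p₁)) : _ ⟶ ((twist n).obj Q.P₁).prod ((twist n).obj P.P₀))
  p₁_p₀ := by
    ext x
    refine Prod.ext ?_ ?_
    · have h := congrArg (fun φ => GrMod.Hom.toLin φ x.2) (Hom.comm₀ f)
      change GrMod.Hom.toLin Q.p₀ (GrMod.Hom.toLin Q.p₁ x.1 + GrMod.Hom.toLin (Hom.f₀ f) x.2) +
        GrMod.Hom.toLin ((twist n).map (Hom.f₁ f)) (-GrMod.Hom.toLin P.p₀ x.2) = op W.elt • x.1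
      rw [map_add, map_neg]
      have h' : GrMod.Hom.toLin ((twist n).map (Hom.f₁ f)) (GrMod.Hom.toLin P.p₀ x.2) =
        GrMod.Hom.toLin Q.p₀ (GrMod.Hom.toLin (Hom.f₀ f) x.2) := h
      rw [h', add_neg_cancel_right]
      exact Q.p₀_p₁_apply x.1
    · change -GrMod.Hom.toLin ((twist n).map P.p₁) (-GrMod.Hom.toLin P.p₀ x.2) = op W.elt • x.2
      rw [map_neg, neg_neg]
      exact P.p₁_p₀_apply x.2
  p₀_p₁ := by
    ext x
    refine Prod.ext ?_ ?_
    · have h := congrArg (fun φ => GrMod.Hom.toLin φ (show P.P₁ from x.2)) (Hom.comm₁ f)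
      change GrMod.Hom.toLin ((twist n).map Q.p₁) (GrMod.Hom.toLin Q.p₀ x.1 +
          GrMod.Hom.toLin ((twist n).map (Hom.f₁ f)) x.2) +
        GrMod.Hom.toLin ((twist n).map (Hom.f₀ f))
          (-GrMod.Hom.toLin ((twist n).map P.p₁) x.2) = op W.elt • x.1
      rw [map_add, map_neg]
      have h' : GrMod.Hom.toLin ((twist n).map (Hom.f₀ f))
            (GrMod.Hom.toLin ((twist n).map P.p₁) x.2) =
          GrMod.Hom.toLin ((twist n).map Q.p₁)
            (GrMod.Hom.toLin ((twist n).map (Hom.f₁ f)) x.2) := h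
      rw [h', add_neg_cancel_right]
      exact Q.p₁_p₀_apply x.1
    · change -GrMod.Hom.toLin P.p₀ (-GrMod.Hom.toLin P.p₁ x.2) = op W.elt • x.2
      rw [map_neg, neg_neg]
      exact P.p₀_p₁_apply x.2

/-- The inclusion of the target in the mapping cone. -/
def coneInclusion {P Q : GrPair W} (f : P ⟶ Q) : Q ⟶ cone f where
  f₁ := inl _ _
  f₀ := inl _ _
  comm₁ := by
    ext x
    refine Prod.ext ?_ ?_
    · change GrMod.Hom.toLin Q.p₁ x = GrMod.Hom.toLin Q.p₁ x + GrMod.Hom.toLin (Hom.f₀ f) 0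
      rw [map_zero, add_zero]
    · change 0 = -GrMod.Hom.toLin P.p₀ 0
      rw [map_zero, neg_zero]
  comm₀ := by
    ext x
    refine Prod.ext ?_ ?_
    · change GrMod.Hom.toLin Q.p₀ x =
        GrMod.Hom.toLin Q.p₀ x + GrMod.Hom.toLin ((twist n).map (Hom.f₁ f)) 0
      rw [map_zero, add_zero]
    · change 0 = -GrMod.Hom.toLin ((twist n).map P.p₁) 0
      rw [map_zero, neg_zero]

/-- Minus the projection of the mapping cone to the translation of the source. -/
def coneProjection {P Q : GrPair W} (f : P ⟶ Q) : cone f ⟶ translation.obj P where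
  f₁ := (show Q.P₁.prod P.P₀ ⟶ P.P₀ from -snd _ _)
  f₀ := (show Q.P₀.prod ((twist n).obj P.P₁) ⟶ (twist n).obj P.P₁ from -snd _ _)
  comm₁ := by
    ext x
    change -(-GrMod.Hom.toLin P.p₀ x.2) = -GrMod.Hom.toLin P.p₀ (-x.2)
    rw [map_neg]
  comm₀ := by
    ext x
    change -(-GrMod.Hom.toLin ((twist n).map P.p₁) x.2) =
      -GrMod.Hom.toLin ((twist n).map P.p₁) (-x.2)
    rw [map_neg]

lemma smul_coker (P : GrPair W) (x : coker P.p₁) : op W.elt • x = 0 := by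
  obtain ⟨y, rfl⟩ := Submodule.mkQ_surjective _ x
  refine (Submodule.Quotient.mk_eq_zero _).2 ⟨Hom.toLin P.p₀ y, ?_⟩
  have h := congrArg (fun φ => GrMod.Hom.toLin φ y) P.p₀_p₁
  exact h

/-- The map induced on cokernels. -/
def cokerMap {P Q : GrPair W} (f : P ⟶ Q) : coker P.p₁ ⟶ coker Q.p₁ :=
  cokerDesc P.p₁ (Hom.f₀ f ≫ cokerπ Q.p₁) (by
    rw [Hom.comm₁_assoc, comp_cokerπ, comp_zero])

/-- The functor `Cok` from graded pairs to finitely generated graded `A`-modules. -/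
def cok (W : Superpotential 𝒜 n) : GrPair W ⥤ FG W.quotGrading where
  obj P := ⟨W.quotModule (coker P.p₁) P.smul_coker,
    W.isFG_quotModule _ (isFG_coker P.p₁ P.free₀.isFG)⟩
  map f := ObjectProperty.homMk (W.quotMap _ _ (cokerMap f))
  map_id P := by
    apply ObjectProperty.hom_ext
    ext x
    obtain ⟨y, rfl⟩ := Submodule.mkQ_surjective _ x
    rfl
  map_comp f g := by
    apply ObjectProperty.hom_ext
    ext x
    obtain ⟨y, rfl⟩ := Submodule.mkQ_surjective _ x
    rfl

end GrPair

/-- The category `DGrB(W)` of graded D-branes of type B: graded pairs with homotopy classes of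
morphisms. -/
abbrev DGrB {k : Type*} [Field k] {B : Type u} [Ring B] [Algebra k B]
    {𝒜 : ℕ → Submodule k B} {n : ℕ} (W : Superpotential 𝒜 n) : Type _ :=
  CategoryTheory.Quotient (GrPair.Homotopic (W := W))

namespace DGrB

variable {k : Type*} [Field k] {B : Type u} [Ring B] [Algebra k B] {𝒜 : ℕ → Submodule k B}
  {n : ℕ} (W : Superpotential 𝒜 n)

/-- The projection functor from `GrPair(W)` to `DGrB(W)`. -/
abbrev proj : GrPair W ⥤ DGrB W := CategoryTheory.Quotient.functor _

/-- The translation functor of `DGrB(W)`. -/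
def translation : DGrB W ⥤ DGrB W :=
  CategoryTheory.Quotient.lift _ (GrPair.translation ⋙ proj W) (by
    rintro P Q f g ⟨s, t, h₁, h₀⟩
    refine CategoryTheory.Quotient.sound _ ⟨(show (GrMod.twist n).obj P.P₁ ⟶ Q.P₀ from -t),
      (show (GrMod.twist n).obj P.P₀ ⟶ (GrMod.twist n).obj Q.P₁ from -(GrMod.twist n).map s),
      ?_, ?_⟩
    · change (GrMod.twist n).map (GrPair.Hom.f₀ f - GrPair.Hom.f₀ g) =
        (-(GrMod.twist n).map s) ≫ (-(GrMod.twist n).map Q.p₁) +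
          (GrMod.twist n).map ((-P.p₀) ≫ (-t))
      rw [h₀]
      simp [add_comm]
    · change (GrMod.twist n).map (GrPair.Hom.f₁ f) - (GrMod.twist n).map (GrPair.Hom.f₁ g) =
        (-(GrMod.twist n).map P.p₁) ≫ (-(GrMod.twist n).map s) + (-t) ≫ (-Q.p₀)
      rw [← Functor.map_sub, h₁]
      simp [add_comm])

variable {W}

/-- The exact triangles of `DGrB(W)` are those isomorphic to a standard triangle
`K ⟶ L ⟶ C(f) ⟶ K[1]`, where `f` is a morphism of graded pairs. -/
def IsExactTriangle {X Y Z : DGrB W} (u : X ⟶ Y) (v : Y ⟶ Z)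
    (w : Z ⟶ (translation W).obj X) : Prop :=
  ∃ (K L : GrPair W) (f : K ⟶ L) (a : X ≅ (proj W).obj K) (b : Y ≅ (proj W).obj L)
    (c : Z ≅ (proj W).obj (GrPair.cone f)),
    u ≫ b.hom = a.hom ≫ (proj W).map f ∧
    v ≫ c.hom = b.hom ≫ (proj W).map (GrPair.coneInclusion f) ∧
    w ≫ (translation W).map a.hom = c.hom ≫ (proj W).map (GrPair.coneProjection f)

end DGrB

end

/-! For a graded pair `P`, regularity of `W` makes `p₁` injective, so `P₁ → P₀` is a free resolution
over `B` of the cokernel. Lifting maps to these resolutions makes `cok` full (`exists_cok_map_eq`).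
The contractible pairs `trivial`, namely `(F, F(n))` with maps `W` and `id`, have the free
`A`-modules `F(n)/WF` as cokernels, and two morphisms of pairs are homotopic exactly when the
difference of their cokernel maps factors through a projective (`exists_factorization_of_homotopic`,
`homotopic_of_factorization`).

The singularity category sees the same morphisms. The cone of the identity of `P` gives an exact
sequence from the cokernel of `P` to that of `P[1]` with projective middle term, and every map from
the first term to a projective extends to the middle one. As every pair is a translation, dimension
shifting yields `Ext^i(Cok P, L) = 0` for `i > 0` and `L` projective. A map from such a module `M`
to a perfect complex factors through a perfect complex in nonnegative degrees. Hence morphisms `M →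
N` in the quotient come from module maps, and those that become zero factor through a projective. So
the functor is fully faithful.

A mapping cone gives a short exact sequence of cokernels, hence a distinguished triangle; the
connecting morphism of the cone of an identity is, up to sign, the comparison of translations.
Conversely, a distinguished triangle is determined up to isomorphism by its first map, which lifts
to a morphism of pairs.

For essential surjectivity, modules generate the singularity category. Free `A`-modules have
projective dimension at most one over `B`, so taking syzygies over `A` lowers the `B`-projective
dimension of a module to at most one. The kernel over `B` of a free cover is then projective, hence
free by graded Nakayama (`isFiniteFree_of_projective`), and since `W` kills the module the inclusion
of this kernel is half of a graded pair (`exists_cok_iso`).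

`ConeSystem` records the properties of pairs from which the triangulated part follows formally. -/

noncomputable section

namespace SingularityCategory

open DerivedCategory Pretriangulated

/-! ### Morphisms in Verdier quotients -/

section Verdier

open ZeroObject

variable {T : Type*} [Category* T] [HasZeroObject T] [HasShift T ℤ] [Preadditive T]
  [∀ n : ℤ, (shiftFunctor T n).Additive] [Pretriangulated T]

lemma distTriang_yoneda₂ {X Y Z A : T} {f : X ⟶ Y} {g : Y ⟶ Z} {h : Z ⟶ X⟦(1 : ℤ)⟧}
    (hT : Triangle.mk f g h ∈ distTriang T) (φ : Y ⟶ A) (hφ : f ≫ φ = 0) :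
    ∃ ψ : Z ⟶ A, g ≫ ψ = φ := by
  obtain ⟨ψ, hψ⟩ := Triangle.yoneda_exact₂ _ hT φ hφ
  exact ⟨ψ, hψ.symm⟩

lemma distTriang_yoneda₃ {X Y Z A : T} {f : X ⟶ Y} {g : Y ⟶ Z} {h : Z ⟶ X⟦(1 : ℤ)⟧}
    (hT : Triangle.mk f g h ∈ distTriang T) (φ : Z ⟶ A) (hφ : g ≫ φ = 0) :
    ∃ ψ : X⟦(1 : ℤ)⟧ ⟶ A, h ≫ ψ = φ := by
  obtain ⟨ψ, hψ⟩ := Triangle.yoneda_exact₃ _ hT φ hφ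
  exact ⟨ψ, hψ.symm⟩

/-- The obstruction to extending `φ` along `f` is its restriction to `Z⟦-1⟧`, the vertex preceding
`X` in the rotated triangle. -/
lemma distTriang_yoneda₁ {X Y Z A : T} {f : X ⟶ Y} {g : Y ⟶ Z} {h : Z ⟶ X⟦(1 : ℤ)⟧}
    (hT : Triangle.mk f g h ∈ distTriang T) (φ : X ⟶ A) (hA : ∀ ψ : Z⟦(-1 : ℤ)⟧ ⟶ A, ψ = 0) :
    ∃ ψ : Y ⟶ A, f ≫ ψ = φ := by
  obtain ⟨ψ, hψ⟩ := Triangle.yoneda_exact₂ _ (inv_rot_of_distTriang _ hT) φ (hA _)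
  exact ⟨ψ, hψ.symm⟩

lemma distTriang_coyoneda₂ {X Y Z A : T} {f : X ⟶ Y} {g : Y ⟶ Z} {h : Z ⟶ X⟦(1 : ℤ)⟧}
    (hT : Triangle.mk f g h ∈ distTriang T) (φ : A ⟶ Y) (hφ : φ ≫ g = 0) :
    ∃ ψ : A ⟶ X, ψ ≫ f = φ := by
  obtain ⟨ψ, hψ⟩ := Triangle.coyoneda_exact₂ _ hT φ hφ
  exact ⟨ψ, hψ.symm⟩

lemma distTriang_complete₁ {X Y Z X' Y' Z' : T} {f : X ⟶ Y} {g : Y ⟶ Z} {h : Z ⟶ X⟦(1 : ℤ)⟧}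
    {f' : X' ⟶ Y'} {g' : Y' ⟶ Z'} {h' : Z' ⟶ X'⟦(1 : ℤ)⟧}
    (hT : Triangle.mk f g h ∈ distTriang T) (hT' : Triangle.mk f' g' h' ∈ distTriang T)
    (b : Y ⟶ Y') (c : Z ⟶ Z') (hbc : g ≫ c = b ≫ g') : ∃ a : X ⟶ X', f ≫ b = a ≫ f' := by
  obtain ⟨a, ha, -⟩ := complete_distinguished_triangle_morphism₁ _ _ hT hT' b c hbc
  exact ⟨a, ha⟩

variable [IsTriangulated T] (P : ObjectProperty T) [P.IsTriangulated]

/-- A fullness criterion for the localization functor of a Verdier quotient. -/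
lemma exists_map_Q_eq {M N : T}
    (h : ∀ (K : T), P K → ∀ φ : M ⟶ K, ∃ (K' : T) (_ : P K') (α : M ⟶ K') (β : K' ⟶ K),
      α ≫ β = φ ∧ ∀ ψ : K'⟦(-1 : ℤ)⟧ ⟶ N, ψ = 0)
    (φ : P.trW.Q.obj M ⟶ P.trW.Q.obj N) : ∃ f : M ⟶ N, P.trW.Q.map f = φ := by
  -- Write `φ` as a roof `M ← X → N` whose left leg has cone `K` in `P`. The cocone `X'` of `α` maps
  -- to `X` over `M`, so the roof may be refined to `X'`, where the obstruction to extending `X' →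
  -- N` to `M` lies in `Hom(K'⟦-1⟧, N) = 0`.
  obtain ⟨r, rfl⟩ := Localization.exists_rightFraction P.trW.Q P.trW φ
  obtain ⟨K, a, b, hT, hK⟩ := r.hs
  obtain ⟨K', hK', α, β, hαβ, hψ⟩ := h K hK a
  obtain ⟨X', s', c, hT'⟩ := distinguished_cocone_triangle₁ α
  obtain ⟨m, hm⟩ := distTriang_complete₁ hT' hT (𝟙 _) β (by simpa using hαβ)
  have hs' : P.trW s' := ⟨_, _, _, hT', hK'⟩
  obtain ⟨f, hf⟩ := distTriang_yoneda₁ hT' (m ≫ r.f) hψ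
  refine ⟨f, ?_⟩
  have := Localization.inverts P.trW.Q P.trW _ hs'
  rw [← cancel_epi (P.trW.Q.map s'), ← Functor.map_comp]
  have hm' : s' = m ≫ r.s := by simpa using hm
  rw [hf]
  conv_rhs => rw [hm', Functor.map_comp, Category.assoc, r.map_s_comp_map]
  rw [Functor.map_comp]

/-- Morphisms killed in a Verdier quotient factor through the subcategory. -/
lemma exists_factorization_of_map_Q_eq_zero {M N : T} (f : M ⟶ N)
    (hf : P.trW.Q.map f = 0) : ∃ (K : T) (_ : P K) (a : M ⟶ K) (b : K ⟶ N), a ≫ b = f := by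
  -- By calculus of fractions `f` is killed by some `s : X ⟶ M` with cone in `P`, so it factors
  -- through that cone.
  obtain ⟨X, s, ⟨K, a, b, hT, hK⟩, hs⟩ :=
    (MorphismProperty.map_eq_iff_precomp P.trW.Q P.trW f 0).1
      (by rw [hf, Functor.map_zero])
  obtain ⟨g, hg⟩ := distTriang_yoneda₂ hT f (by simpa using hs)
  exact ⟨K, hK, a, g, hg⟩

lemma isZero_Q_obj {K : T} (hK : P K) : IsZero (P.trW.Q.obj K) := by
  have h : P.trW (0 : (0 : T) ⟶ K) := by
    rw [P.trW_iff]
    exact ⟨K, 𝟙 K, 0, contractible_distinguished₁ K, hK⟩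
  have := Localization.inverts P.trW.Q P.trW _ h
  exact (P.trW.Q.map_isZero (isZero_zero T)).of_iso (asIso (P.trW.Q.map (0 : (0 : T) ⟶ K))).symm

end Verdier

/-! ### Perfect complexes and modules without extensions to projectives -/

variable {C : Type*} [Category* C] [Abelian C]

/-- Peeling off the lowest term of a bounded complex of projective objects. -/
lemma exists_ses_of_isStrictlyGE (K : CochainComplex C ℤ) (a b : ℤ) [K.IsStrictlyGE a]
    [K.IsStrictlyLE b] (hK : ∀ i, Projective (K.X i)) :
    ∃ (U : CochainComplex C ℤ) (_ : U.IsStrictlyGE (a + 1)) (_ : U.IsStrictlyLE b)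
      (_ : ∀ i, Projective (U.X i)) (i : U ⟶ K)
      (p : K ⟶ (HomologicalComplex.single C (ComplexShape.up ℤ) a).obj (K.X a))
      (w : i ≫ p = 0), (ShortComplex.mk i p w).ShortExact := by
  -- The projection to the lowest term is a chain map because the term in degree `a - 1` vanishes;
  -- its kernel is the brutal truncation above `a`.
  let p : K ⟶ (HomologicalComplex.single C (ComplexShape.up ℤ) a).obj (K.X a) :=
    HomologicalComplex.mkHomToSingle (𝟙 _) (fun i hi => by
      have : i + 1 = a := hi
      exact (K.isZero_of_isStrictlyGE a i (by lia)).eq_of_src _ _)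
  have hpa : IsIso (p.f a) := by
    dsimp only [p]
    rw [HomologicalComplex.mkHomToSingle_f]
    infer_instance
  have hz : ∀ i, i ≠ a →
      IsZero (((HomologicalComplex.single C (ComplexShape.up ℤ) a).obj (K.X a)).X i) :=
    fun i hi => HomologicalComplex.isZero_single_obj_X _ _ _ _ hi
  have hepi : Epi p := by
    refine @HomologicalComplex.epi_of_epi_f _ _ _ _ _ _ _ _ fun i => ?_
    by_cases hi : i = a
    · subst hi
      infer_instance
    · exact ⟨fun _ _ _ => (hz i hi).eq_of_src _ _⟩
  have hS : (ShortComplex.mk (kernel.ι p) p (kernel.condition p)).ShortExact :=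
    { exact := ShortComplex.exact_kernel p }
  have hSi := fun i => hS.map_of_exact (HomologicalComplex.eval C (ComplexShape.up ℤ) i)
  have hUa : IsZero ((kernel p).X a) := by
    have hw : Mono ((kernel.ι p).f a) := (hSi a).mono_f
    have hc : (kernel.ι p).f a ≫ p.f a = 0 := by
      rw [← HomologicalComplex.comp_f, kernel.condition, HomologicalComplex.zero_f]
    have hc' : (kernel.ι p).f a = 0 := by rw [← cancel_mono (p.f a), hc, zero_comp]
    rw [IsZero.iff_id_eq_zero, ← cancel_mono ((kernel.ι p).f a), hc', comp_zero, comp_zero]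
  have hUi : ∀ i, i ≠ a → IsIso ((kernel.ι p).f i) := fun i hi => by
    have h₁ : Mono ((kernel.ι p).f i) := (hSi i).mono_f
    have h₂ : Epi ((kernel.ι p).f i) := (hSi i).exact.epi_f ((hz i hi).eq_of_tgt _ _)
    exact isIso_of_mono_of_epi ((kernel.ι p).f i)
  have hUz : ∀ i, IsZero (K.X i) → IsZero ((kernel p).X i) := fun i hi => by
    by_cases h : i = a
    · subst h; exact hUa
    · have := hUi i h
      exact hi.of_iso (asIso ((kernel.ι p).f i))
  refine ⟨kernel p, ?_, ?_, fun i => ?_, kernel.ι p, p, kernel.condition p, hS⟩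
  · rw [CochainComplex.isStrictlyGE_iff]
    intro i hi
    by_cases h : i = a
    · subst h; exact hUa
    · exact hUz i (K.isZero_of_isStrictlyGE a i (by lia))
  · rw [CochainComplex.isStrictlyLE_iff]
    intro i hi
    exact hUz i (K.isZero_of_isStrictlyLE b i hi)
  · by_cases h : i = a
    · subst h; exact hUa.projective
    · have := hUi i h
      have := hK i
      exact Projective.of_iso (asIso ((kernel.ι p).f i)).symm inferInstance

lemma projective_single_X (L : C) [Projective L] (a i : ℤ) :
    Projective (((HomologicalComplex.single C (ComplexShape.up ℤ) a).obj L).X i) := by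
  by_cases h : i = a
  · subst h
    exact Projective.of_iso (HomologicalComplex.singleObjXSelf _ _ _).symm inferInstance
  · exact (HomologicalComplex.isZero_single_obj_X _ _ _ _ h).projective

variable [HasDerivedCategory.{w} C]

/-- A bounded above complex of projectives is K-projective, so derived morphisms out of it are
represented by chain maps, and these vanish for degree reasons. -/
lemma Q_map_eq_zero {K L : CochainComplex C ℤ} (b : ℤ) [K.IsStrictlyLE b]
    (hK : ∀ i, Projective (K.X i)) (hKL : ∀ i, IsZero (K.X i) ∨ IsZero (L.X i))
    (f : Q.obj K ⟶ Q.obj L) : f = 0 := by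
  obtain ⟨g, rfl⟩ := exists_chain_map C b hK f
  have : g = 0 := by
    ext i
    exact (hKL i).elim (fun h => h.eq_of_src _ _) (fun h => h.eq_of_tgt _ _)
  rw [this, Functor.map_zero]

/-- The objects without higher extensions to projective objects. -/
def IsExtOrthogonal (M : C) : Prop :=
  ∀ (L : C) [Projective L] (a : ℤ), a < 0 →
    ∀ φ : (singleFunctor C 0).obj M ⟶ (singleFunctor C a).obj L, φ = 0

/-- `singleFunctor C a` places `L` in degree `a`, so the morphisms in question form `Ext^{-a}(M,
L)`. -/
lemma single_hom_eq_zero (M L : C) [Projective M] (a : ℤ) (ha : a < 0)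
    (φ : (singleFunctor C 0).obj M ⟶ (singleFunctor C a).obj L) : φ = 0 := by
  refine Q_map_eq_zero (K := (HomologicalComplex.single C (ComplexShape.up ℤ) 0).obj M)
    (L := (HomologicalComplex.single C (ComplexShape.up ℤ) a).obj L) 0
    (projective_single_X M 0) (fun i => ?_) φ
  by_cases h : i = 0
  · exact Or.inr (HomologicalComplex.isZero_single_obj_X _ _ _ _ (by lia))
  · exact Or.inl (HomologicalComplex.isZero_single_obj_X _ _ _ _ h)

/-- Dimension shifting: a class of objects closed under suitable syzygies has no higher extensions
to projective objects. -/
lemma isExtOrthogonal_of_class (𝓜 : C → Prop)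
    (h : ∀ M, 𝓜 M → ∃ (S : ShortComplex C), S.ShortExact ∧ Nonempty (S.X₃ ≅ M) ∧ 𝓜 S.X₁ ∧
      Projective S.X₂ ∧ ∀ (L : C) [Projective L] (g : S.X₁ ⟶ L), ∃ g', S.f ≫ g' = g)
    {M : C} (hM : 𝓜 M) : IsExtOrthogonal M := by
  intro L hL a ha
  -- With `a = -(n + 1)` the morphism is a class in `Ext^{n+1}(M, L)`; the induction is on `n`.
  obtain ⟨n, rfl⟩ : ∃ n : ℕ, a = -(n + 1 : ℤ) := ⟨(-a - 1).toNat, by lia⟩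
  induction n generalizing M with
  | zero =>
    intro φ
    obtain ⟨S, hS, ⟨e⟩, h₁, h₂, h₃⟩ := h M hM
    rw [← cancel_epi ((singleFunctor C 0).map e.hom), comp_zero]
    -- As `S.X₂` is projective, the class is the connecting morphism followed by the shift of a map
    -- `S.X₁ ⟶ L`. This map extends over `S.X₂`, and the connecting morphism composed with the shift
    -- of `S.f` is zero.
    obtain ⟨ψ, hψ⟩ := distTriang_yoneda₃ hS.singleTriangle_distinguished
      ((singleFunctor C 0).map e.hom ≫ φ) (single_hom_eq_zero _ _ _ ha _)
    let e' := ((singleFunctors C).shiftIso 1 (-((0 : ℕ) + 1 : ℤ)) 0 (by simp)).app L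
    obtain ⟨g, hg⟩ := ((singleFunctor C 0) ⋙ shiftFunctor _ (1 : ℤ)).map_surjective (ψ ≫ e'.inv)
    obtain ⟨g', rfl⟩ := h₃ L g
    rw [← hψ, ← cancel_mono e'.inv, Category.assoc, ← hg]
    have h₀ : hS.singleδ ≫ ((singleFunctor C 0).map S.f)⟦(1 : ℤ)⟧' = 0 :=
      comp_distTriang_mor_zero₃₁ _ hS.singleTriangle_distinguished
    rw [zero_comp, Functor.map_comp]
    exact (Category.assoc _ _ _).symm.trans
      ((congrArg (· ≫ ((singleFunctor C 0).map g')⟦(1 : ℤ)⟧') h₀).trans zero_comp)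
  | succ n ih =>
    intro φ
    obtain ⟨S, hS, ⟨e⟩, h₁, h₂, h₃⟩ := h M hM
    rw [← cancel_epi ((singleFunctor C 0).map e.hom), comp_zero]
    -- Here the connecting morphism is followed by the shift of a class in `Ext^{n+1}(S.X₁, L)`, to
    -- which the induction hypothesis applies.
    obtain ⟨ψ, hψ⟩ := distTriang_yoneda₃ hS.singleTriangle_distinguished
      ((singleFunctor C 0).map e.hom ≫ φ) (single_hom_eq_zero _ _ _ ha _)
    let e' := ((singleFunctors C).shiftIso 1 (-((n + 1 : ℕ) + 1 : ℤ)) (-(n + 1 : ℤ))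
      (by push_cast; ring)).app L
    obtain ⟨g, hg⟩ := (shiftFunctor (DerivedCategory C) (1 : ℤ)).map_surjective (ψ ≫ e'.inv)
    rw [← hψ, ← cancel_mono e'.inv, Category.assoc, ← hg, ih h₁ (by lia) g]
    simp

/-- An object of the abelian category as a bounded complex concentrated in degree `0`. -/
abbrev singleBounded : C ⥤ BoundedDerivedCategory C :=
  ObjectProperty.lift _ (DerivedCategory.singleFunctor C 0)
    (fun _ => ⟨⟨0, inferInstance⟩, ⟨0, inferInstance⟩⟩)

/-- The localization functor to the singularity category. -/
abbrev verdierQ : BoundedDerivedCategory C ⥤ SingularityCategory C := (perfectComplexes C).trW.Q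

/-- Morphisms to a perfect complex factor through perfect complexes in nonnegative degrees. -/
lemma exists_factorization_nonneg {M : C} (hM : IsExtOrthogonal M) (K : CochainComplex C ℤ)
    (a b : ℤ) [K.IsStrictlyGE a] [K.IsStrictlyLE b] (hK : ∀ i, Projective (K.X i))
    (φ : (singleFunctor C 0).obj M ⟶ Q.obj K) :
    ∃ (U : CochainComplex C ℤ) (_ : U.IsStrictlyGE 0) (_ : U.IsStrictlyLE b)
      (_ : ∀ i, Projective (U.X i)) (α : (singleFunctor C 0).obj M ⟶ Q.obj U)
      (β : Q.obj U ⟶ Q.obj K), α ≫ β = φ := by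
  -- The number `n` bounds the negative degrees still to be removed.
  obtain ⟨n, hn⟩ : ∃ n : ℕ, -a ≤ n := ⟨(-a).toNat, by lia⟩
  induction n generalizing a K with
  | zero =>
    have := K.isStrictlyGE_of_ge 0 a (by lia)
    exact ⟨K, inferInstance, inferInstance, hK, φ, 𝟙 _, by simp⟩
  | succ n ih =>
    by_cases ha : 0 ≤ a
    · have := K.isStrictlyGE_of_ge 0 a (by lia)
      exact ⟨K, inferInstance, inferInstance, hK, φ, 𝟙 _, by simp⟩
    obtain ⟨U, hUa, hUb, hU, i, p, w, hS⟩ := exists_ses_of_isStrictlyGE K a b hK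
    have := hK a
    -- The composite of `φ` to the lowest term is a class in `Ext^{-a}(M, K.X a)` with `a < 0`,
    -- hence zero, so `φ` lifts to the truncation.
    obtain ⟨ψ, hψ⟩ := distTriang_coyoneda₂ (triangleOfSES_distinguished hS) φ
      (hM (K.X a) a (by lia) (φ ≫ Q.map p))
    obtain ⟨U', h₁, h₂, h₃, α, β, h⟩ := ih U (a + 1) hU ψ (by lia)
    refine ⟨U', h₁, h₂, h₃, α, β ≫ Q.map i, ?_⟩
    rw [← Category.assoc, h]
    exact hψ

/-- Maps from `M` to `N` in the singularity category come from actual maps if `M` has no higher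
extensions to projective objects. -/
lemma exists_toSingularityCategory_map_eq {M : C} (hM : IsExtOrthogonal M) (N : C)
    (φ : (toSingularityCategory C).obj M ⟶ (toSingularityCategory C).obj N) :
    ∃ f : M ⟶ N, (toSingularityCategory C).map f = φ := by
  obtain ⟨f, hf⟩ := exists_map_Q_eq (perfectComplexes C) (M := singleBounded.obj M)
    (N := singleBounded.obj N) (fun K hK ψ => by
      obtain ⟨L, a, b, ha, hb, hL, ⟨e⟩⟩ := hK
      obtain ⟨U, hU₀, hUb, hU, α, β, hαβ⟩ := exists_factorization_nonneg hM L a b hL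
        (ψ.hom ≫ e.hom)
      let K' : BoundedDerivedCategory C := ⟨Q.obj U, ⟨0, inferInstance⟩, ⟨b, inferInstance⟩⟩
      refine ⟨K', ⟨U, 0, b, hU₀, hUb, hU, ⟨Iso.refl _⟩⟩, ObjectProperty.homMk α,
        ObjectProperty.homMk (β ≫ e.inv), ?_, fun χ => ?_⟩
      · ext
        change α ≫ β ≫ e.inv = ψ.hom
        rw [reassoc_of% hαβ]
        simp
      · ext
        change χ.hom = 0
        -- `U⟦-1⟧` lives in degrees at least `1` and `N` in degree `0`, which gives the vanishing
        -- demanded by `exists_map_Q_eq`.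
        have h₁ := U.isStrictlyLE_shift b (-1) (b + 1) (by lia)
        have h₂ := U.isStrictlyGE_shift 0 (-1) 1 (by lia)
        let ε : Q.obj (U⟦(-1 : ℤ)⟧) ≅ (K'⟦(-1 : ℤ)⟧).obj :=
          (Q.commShiftIso (-1 : ℤ)).app U ≪≫
            ((ObjectProperty.ι _).commShiftIso (-1 : ℤ)).symm.app K'
        have h₃ : ε.hom ≫ χ.hom = 0 := by
          refine Q_map_eq_zero (K := U⟦(-1 : ℤ)⟧)
            (L := (HomologicalComplex.single C (ComplexShape.up ℤ) 0).obj N) (b + 1)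
            (fun i => hU _) (fun i => ?_) (ε.hom ≫ χ.hom)
          by_cases hi : i = 0
          · exact Or.inl (CochainComplex.isZero_of_isStrictlyGE _ 1 i (by lia))
          · exact Or.inr (HomologicalComplex.isZero_single_obj_X _ _ _ _ hi)
        rw [← cancel_epi ε.hom, h₃, comp_zero]) φ
  obtain ⟨g, hg⟩ := (singleFunctor C 0).map_surjective f.hom
  refine ⟨g, ?_⟩
  have : singleBounded.map g = f := by
    ext
    exact hg
  rw [← hf, ← this]
  rfl

/-- Maps out of `M` killed in the singularity category factor through projective objects if `M`
has no higher extensions to projective objects. -/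
lemma exists_factorization_of_toSingularityCategory_map_eq_zero {M : C} (hM : IsExtOrthogonal M)
    {N : C} (f : M ⟶ N) (hf : (toSingularityCategory C).map f = 0) :
    ∃ (L : C) (_ : Projective L) (a : M ⟶ L) (b : L ⟶ N), a ≫ b = f := by
  obtain ⟨K, ⟨L, l, m, hl, hm, hL, ⟨e⟩⟩, a, b, hab⟩ :=
    exists_factorization_of_map_Q_eq_zero (perfectComplexes C) (singleBounded.map f) hf
  obtain ⟨U, hU₀, hUb, hU, α, β, hαβ⟩ := exists_factorization_nonneg hM L l m hL
    (a.hom ≫ e.hom)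
  obtain ⟨U', hUa', hUb', hU', i, p, w, hS⟩ := exists_ses_of_isStrictlyGE U 0 m hU
  -- The part of `U` in degrees at least `1` has no morphism to `N`, so `U → N` factors through `U.X
  -- 0`, the projective being sought.
  obtain ⟨ψ, hψ⟩ := distTriang_yoneda₂ (triangleOfSES_distinguished hS)
    (A := (singleFunctor C 0).obj N) (β ≫ e.inv ≫ b.hom) (by
      refine Q_map_eq_zero (L := (HomologicalComplex.single C (ComplexShape.up ℤ) 0).obj N) m hU'
        (fun j => ?_) _
      by_cases hj : j = 0
      · exact Or.inl (CochainComplex.isZero_of_isStrictlyGE _ (0 + 1) j (by lia))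
      · exact Or.inr (HomologicalComplex.isZero_single_obj_X _ _ _ _ hj))
  obtain ⟨g, hg⟩ := (singleFunctor C 0).map_surjective (X := M) (Y := U.X 0) (α ≫ Q.map p)
  obtain ⟨g', hg'⟩ := (singleFunctor C 0).map_surjective (X := U.X 0) (Y := N) ψ
  refine ⟨U.X 0, hU 0, g, g', (singleFunctor C 0).map_injective ?_⟩
  rw [Functor.map_comp, hg, hg']
  have h₁ : a.hom ≫ b.hom = (singleFunctor C 0).map f :=
    congrArg (fun φ : singleBounded.obj M ⟶ singleBounded.obj N => φ.hom) hab
  have h₂ : Q.map p ≫ ψ = β ≫ e.inv ≫ b.hom := hψ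
  refine (Category.assoc _ _ _).trans ((congrArg (α ≫ ·) h₂).trans ?_)
  rw [reassoc_of% hαβ, ← h₁, e.hom_inv_id_assoc]

end SingularityCategory

/-! ### Short exact sequences as triangles, and generation by modules -/

namespace SingularityCategory

open DerivedCategory Pretriangulated

variable {C : Type*} [Category* C] [Abelian C] [HasDerivedCategory.{w} C]

lemma isZero_toSingularityCategory_obj (L : C) [Projective L] :
    IsZero ((toSingularityCategory C).obj L) :=
  isZero_Q_obj (perfectComplexes C) (K := singleBounded.obj L)
    ⟨(HomologicalComplex.single C (ComplexShape.up ℤ) 0).obj L, 0, 0, inferInstance, inferInstance,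
      projective_single_X L 0, ⟨Iso.refl _⟩⟩

instance : (singleBounded (C := C)).Additive where
  map_add {X Y f g} := by
    ext
    exact (singleFunctor C 0).map_add

instance : (toSingularityCategory C).Additive :=
  inferInstanceAs ((singleBounded (C := C)) ⋙ verdierQ).Additive

lemma toSingularityCategory_map_eq_of_sub_eq_comp {M N L : C} [Projective L] {f g : M ⟶ N}
    {a : M ⟶ L} {b : L ⟶ N} (h : f - g = a ≫ b) :
    (toSingularityCategory C).map f = (toSingularityCategory C).map g := by
  rw [← sub_eq_zero, ← Functor.map_sub, h, Functor.map_comp,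
    (isZero_toSingularityCategory_obj L).eq_of_tgt ((toSingularityCategory C).map a) 0, zero_comp]

lemma exists_sub_eq_comp_of_toSingularityCategory_map_eq {M : C} (hM : IsExtOrthogonal M) {N : C}
    {f g : M ⟶ N} (h : (toSingularityCategory C).map f = (toSingularityCategory C).map g) :
    ∃ (L : C) (_ : Projective L) (a : M ⟶ L) (b : L ⟶ N), a ≫ b = f - g :=
  exists_factorization_of_toSingularityCategory_map_eq_zero hM (f - g)
    (by rw [Functor.map_sub, h, sub_self])

/-- The connecting morphism in the bounded derived category. -/
def boundedδ {S : ShortComplex C} (hS : S.ShortExact) :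
    singleBounded.obj S.X₃ ⟶ (singleBounded.obj S.X₁)⟦(1 : ℤ)⟧ :=
  ObjectProperty.homMk
    (hS.singleδ ≫ ((ObjectProperty.ι _).commShiftIso (1 : ℤ)).inv.app (singleBounded.obj S.X₁))

lemma boundedδ_distinguished {S : ShortComplex C} (hS : S.ShortExact) :
    Triangle.mk (singleBounded.map S.f) (singleBounded.map S.g) (boundedδ hS) ∈ distTriang _ := by
  refine isomorphic_distinguished _ hS.singleTriangle_distinguished _
    (Triangle.isoMk _ _ (Iso.refl _) (Iso.refl _) (Iso.refl _) ?_ ?_ ?_)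
  · exact (Category.comp_id _).trans (Category.id_comp _).symm
  · exact (Category.comp_id _).trans (Category.id_comp _).symm
  · refine Eq.trans ?_ (Category.id_comp _).symm
    change (((hS.singleδ ≫ ((ObjectProperty.ι _).commShiftIso (1 : ℤ)).inv.app
        (singleBounded.obj S.X₁)) ≫ ((ObjectProperty.ι _).commShiftIso (1 : ℤ)).hom.app
          (singleBounded.obj S.X₁)) ≫ (𝟙 _)⟦(1 : ℤ)⟧') = hS.singleδ
    rw [CategoryTheory.Functor.map_id]
    refine (Category.comp_id _).trans ?_
    rw [Category.assoc, Iso.inv_hom_id_app]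
    exact Category.comp_id hS.singleδ

/-- The connecting morphism in the singularity category attached to a short exact sequence. -/
def sesδ {S : ShortComplex C} (hS : S.ShortExact) :
    (toSingularityCategory C).obj S.X₃ ⟶ ((toSingularityCategory C).obj S.X₁)⟦(1 : ℤ)⟧ :=
  verdierQ.map (boundedδ hS) ≫ (verdierQ.commShiftIso (1 : ℤ)).hom.app (singleBounded.obj S.X₁)

lemma sesδ_distinguished {S : ShortComplex C} (hS : S.ShortExact) :
    Triangle.mk ((toSingularityCategory C).map S.f) ((toSingularityCategory C).map S.g)
      (sesδ hS) ∈ distTriang _ :=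
  verdierQ.map_distinguished _ (boundedδ_distinguished hS)

lemma boundedδ_naturality {S₁ S₂ : ShortComplex C} (h₁ : S₁.ShortExact) (h₂ : S₂.ShortExact)
    (f : S₁ ⟶ S₂) :
    boundedδ h₁ ≫ (singleBounded.map f.τ₁)⟦(1 : ℤ)⟧' = singleBounded.map f.τ₃ ≫ boundedδ h₂ := by
  have h : h₁.singleδ ≫ ((singleFunctor C 0).map f.τ₁)⟦(1 : ℤ)⟧' =
      (singleFunctor C 0).map f.τ₃ ≫ h₂.singleδ :=
    (ShortComplex.ShortExact.singleTriangle.map h₁ h₂ f).comm₃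
  apply (ObjectProperty.ι _).map_injective
  rw [← cancel_mono (((ObjectProperty.ι _).commShiftIso (1 : ℤ)).hom.app (singleBounded.obj S₂.X₁)),
    Functor.map_comp, Category.assoc, Functor.commShiftIso_hom_naturality, Functor.map_comp,
    Category.assoc]
  change (h₁.singleδ ≫ ((ObjectProperty.ι _).commShiftIso (1 : ℤ)).inv.app
      (singleBounded.obj S₁.X₁)) ≫
      ((ObjectProperty.ι _).commShiftIso (1 : ℤ)).hom.app (singleBounded.obj S₁.X₁) ≫
        ((singleFunctor C 0).map f.τ₁)⟦(1 : ℤ)⟧' =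
    (singleFunctor C 0).map f.τ₃ ≫ (h₂.singleδ ≫
      ((ObjectProperty.ι _).commShiftIso (1 : ℤ)).inv.app (singleBounded.obj S₂.X₁)) ≫
        ((ObjectProperty.ι _).commShiftIso (1 : ℤ)).hom.app (singleBounded.obj S₂.X₁)
  simp only [Category.assoc, Iso.inv_hom_id_app_assoc, Iso.inv_hom_id_app]
  exact h.trans (congrArg (_ ≫ ·) (Category.comp_id _).symm)

lemma sesδ_naturality {S₁ S₂ : ShortComplex C} (h₁ : S₁.ShortExact) (h₂ : S₂.ShortExact)
    (f : S₁ ⟶ S₂) :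
    sesδ h₁ ≫ ((toSingularityCategory C).map f.τ₁)⟦(1 : ℤ)⟧' =
      (toSingularityCategory C).map f.τ₃ ≫ sesδ h₂ := by
  change (verdierQ.map (boundedδ h₁) ≫ (verdierQ.commShiftIso (1 : ℤ)).hom.app _) ≫
      (verdierQ.map (singleBounded.map f.τ₁))⟦(1 : ℤ)⟧' =
    verdierQ.map (singleBounded.map f.τ₃) ≫ verdierQ.map (boundedδ h₂) ≫
      (verdierQ.commShiftIso (1 : ℤ)).hom.app _
  rw [Category.assoc, ← Functor.commShiftIso_hom_naturality, ← Functor.map_comp_assoc,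
    ← Functor.map_comp_assoc, boundedδ_naturality]

/-- A triangulated subcategory of the singularity category containing all the objects of the
abelian category contains everything. -/
lemma prop_of_isTriangulated (P : ObjectProperty (SingularityCategory C)) [P.IsTriangulated]
    [P.IsClosedUnderIsomorphisms] (hP : ∀ M : C, P ((toSingularityCategory C).obj M))
    (X : SingularityCategory C) : P X := by
  have hsingle : ∀ (n : ℤ) (M : C) (h), P (verdierQ.obj ⟨(singleFunctor C n).obj M, h⟩) := by
    intro n M h
    let e : (singleBounded.obj M)⟦-n⟧ ≅
        (⟨(singleFunctor C n).obj M, h⟩ : BoundedDerivedCategory C) :=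
      ObjectProperty.isoMk _ (((ObjectProperty.ι _).commShiftIso (-n)).app _ ≪≫
        ((singleFunctors C).shiftIso (-n) n 0 (by simp)).app M)
    exact P.prop_of_iso (((verdierQ.commShiftIso (-n)).app _).symm ≪≫ verdierQ.mapIso e)
      (P.le_shift (-n) _ (hP M))
  let t := (TStructure.t (C := C)).onBounded
  have hheart : ∀ (a : ℤ) (Y : BoundedDerivedCategory C), t.IsGE Y a → t.IsLE Y a →
      P (verdierQ.obj Y) := by
    intro a Y h₁ h₂
    have h₁' : Y.obj.IsGE a := (ObjectProperty.tStructure_isGE_iff _ _ _ _).1 h₁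
    have h₂' : Y.obj.IsLE a := (ObjectProperty.tStructure_isLE_iff _ _ _ _).1 h₂
    obtain ⟨M, ⟨e⟩⟩ := exists_iso_singleFunctor_obj_of_isGE_of_isLE Y.obj a
    have h := (TStructure.t (C := C)).bounded.prop_of_iso e Y.property
    exact P.prop_of_iso (verdierQ.mapIso (ObjectProperty.isoMk _ e.symm)) (hsingle a M h)
  -- Induction on the cohomological amplitude: the truncation triangle splits off the part in degree
  -- `a`.
  have key : ∀ (m : ℕ) (a : ℤ) (Y : BoundedDerivedCategory C), t.IsGE Y a → t.IsLE Y (a + m) →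
      P (verdierQ.obj Y) := by
    intro m
    induction m with
    | zero => exact fun a Y h₁ h₂ => hheart a Y h₁ (by simpa using h₂)
    | succ m ih =>
      intro a Y h₁ h₂
      obtain ⟨U, V, hU, hV, f, g, h, hT⟩ := t.exists_triangle Y a (a + 1) rfl
      have hU' : t.IsLE U a := ⟨hU⟩
      have hV' : t.IsGE V (a + 1) := ⟨hV⟩
      have hV₁ := t.isGE_shift V (a + 1) (-1) (a + 2) (by lia)
      have hU₁ := t.isLE_shift U a 1 (a - 1) (by lia)
      -- `U` lies between `V⟦-1⟧` and `Y`, and `V` between `Y` and `U⟦1⟧`, so the truncations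
      -- inherit the missing bounds.
      have hU'' : t.IsGE U a := t.isGE₂ _ (inv_rot_of_distTriang _ hT) a
        (t.isGE_of_ge (V⟦(-1 : ℤ)⟧) a (a + 2) (by lia)) h₁
      have hV'' : t.IsLE V (a + 1 + m) := t.isLE₂ _ (rot_of_distTriang _ hT) (a + 1 + m)
        (by rw [add_right_comm, add_assoc]; exact_mod_cast h₂)
        (t.isLE_of_le (U⟦(1 : ℤ)⟧) (a - 1) _ (by lia))
      exact P.ext_of_isTriangulatedClosed₂ _ (verdierQ.map_distinguished _ hT)
        (hheart a U hU'' hU') (ih (a + 1) V hV' hV'')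
  obtain ⟨Y, rfl⟩ : ∃ Y, verdierQ.obj Y = X := ⟨X.as.obj, rfl⟩
  obtain ⟨⟨a, ha⟩, ⟨b, hb⟩⟩ := Y.property
  have : t.IsLE Y b := (ObjectProperty.tStructure_isLE_iff _ _ _ _).2 hb
  exact key (b - a).toNat a Y ((ObjectProperty.tStructure_isGE_iff _ _ _ _).2 ha)
    (t.isLE_of_le _ b _ (by lia))

end SingularityCategory

/-! ### Graded modules: homogeneous parts, lifting and free covers -/

namespace GrMod

section Homogeneous

variable {R : Type u} [Ring R] {σ : Type*} [SetLike σ R] {𝒜 : ℕ → σ}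

variable (𝒜) in
/-- The ring is additively generated by its homogeneous elements. -/
class IsHomogeneouslyGenerated : Prop where
  mem_closure : ∀ r : R, r ∈ AddSubmonoid.closure {a | ∃ k, a ∈ 𝒜 k}

lemma induction_homogeneous (M : GrMod 𝒜) {p : M → Prop} (hz : p 0)
    (hadd : ∀ x y, p x → p y → p (x + y)) (hgr : ∀ (i : ℤ) (x : M), x ∈ M.gr i → p x) (x : M) :
    p x := by
  classical
  obtain ⟨s, hs⟩ := M.exists_sum_proj x
  rw [← hs s subset_rfl]
  exact Finset.sum_induction _ p hadd hz fun i _ => hgr i _ (M.proj_mem i x)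

lemma proj_smul (M : GrMod 𝒜) {k : ℕ} {a : R} (ha : a ∈ 𝒜 k) (i : ℤ) (x : M) :
    M.proj (i + k) (op a • x) = op a • M.proj i x := by
  induction x using M.induction_homogeneous with
  | hz => simp
  | hadd x y hx hy => rw [smul_add, map_add, map_add, smul_add, hx, hy]
  | hgr j x hx =>
    by_cases h : j = i
    · subst h
      rw [M.proj_of_mem hx, M.proj_of_mem (M.smul_mem ha hx)]
    · rw [M.proj_of_mem_ne hx h, smul_zero, M.proj_of_mem_ne (M.smul_mem ha hx) (by lia)]

/-- Only additivity is available for an arbitrary `L`; linearity of the degree zero part uses that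
homogeneous elements generate the ring, and is treated in `exists_degree_zero_part`. -/
lemma exists_additive_part (M N : GrMod 𝒜) (L : M →+ N) :
    ∃ φ : M →+ N, ∀ (i : ℤ) (x : M), x ∈ M.gr i → φ x = N.proj i (L x) := by
  classical
  let _ : DirectSum.Decomposition M.gr := M.isInternal.chooseDecomposition
  refine ⟨(DirectSum.toAddMonoid fun i => ((N.proj i).comp L).comp (M.gr i).subtype).comp
    (DirectSum.decomposeAddEquiv M.gr).toAddMonoidHom, fun i x hx => ?_⟩
  change DirectSum.toAddMonoid _ (DirectSum.decompose M.gr x) = _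
  rw [DirectSum.decompose_of_mem _ hx, DirectSum.toAddMonoid_of]
  rfl

/-- The degree zero part of a linear map. -/
lemma exists_degree_zero_part [IsHomogeneouslyGenerated 𝒜] (M N : GrMod 𝒜)
    (L : M →ₗ[Rᵐᵒᵖ] N) :
    ∃ φ : M ⟶ N, ∀ (i : ℤ) (x : M), x ∈ M.gr i → Hom.toLin φ x = N.proj i (L x) := by
  obtain ⟨φ, hφ⟩ := exists_additive_part M N L.toAddMonoidHom
  have hsmul : ∀ (r : R) (x : M), φ (op r • x) = op r • φ x := by
    intro r
    induction IsHomogeneouslyGenerated.mem_closure (𝒜 := 𝒜) r using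
      AddSubmonoid.closure_induction with
    | mem a ha =>
      obtain ⟨k, ha⟩ := ha
      intro x
      induction x using M.induction_homogeneous with
      | hz => simp
      | hadd x y hx hy => rw [smul_add, map_add, map_add, smul_add, hx, hy]
      | hgr j x hx =>
        rw [hφ _ _ (M.smul_mem ha hx), hφ _ _ hx, ← N.proj_smul ha]
        exact congrArg _ (L.map_smul _ _)
    | zero => intro x; simp
    | add a b _ _ ha hb => intro x; rw [MulOpposite.op_add, add_smul, map_add, ha, hb, add_smul]
  refine ⟨homMk { φ with map_smul' := fun r x => hsmul r.unop x } fun i x hx => ?_, hφ⟩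
  change φ x ∈ _
  rw [hφ i x hx]
  exact N.proj_mem i _

lemma hom_ext_homogeneous {M N : GrMod 𝒜} {f g : M ⟶ N}
    (h : ∀ (i : ℤ) (x : M), x ∈ M.gr i → Hom.toLin f x = Hom.toLin g x) : f = g := by
  ext x
  induction x using M.induction_homogeneous with
  | hz => simp
  | hadd x y hx hy => rw [map_add, map_add, hx, hy]
  | hgr j x hx => exact h j x hx

/-- Graded modules which are projective as modules have the lifting property for graded
surjections. -/
lemma exists_lift_of_projective [IsHomogeneouslyGenerated 𝒜] {P M N : GrMod 𝒜}
    [Module.Projective Rᵐᵒᵖ P] (f : M ⟶ N) (hf : Function.Surjective (Hom.toLin f)) (g : P ⟶ N) :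
    ∃ h : P ⟶ M, h ≫ f = g := by
  obtain ⟨L, hL⟩ := Module.projective_lifting_property (Hom.toLin f) (Hom.toLin g) hf
  -- The degree zero part of an ungraded lift is still a lift, because `f` and `g` preserve degrees.
  obtain ⟨h, hh⟩ := exists_degree_zero_part P M L
  refine ⟨h, hom_ext_homogeneous fun i x hx => ?_⟩
  rw [comp_apply, hh i x hx, map_proj, ← LinearMap.comp_apply, hL,
    N.proj_of_mem (Hom.toLin_mem g hx)]

lemma IsFiniteFree.projective {P : GrMod 𝒜} (hP : IsFiniteFree P) : Module.Projective Rᵐᵒᵖ P := by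
  obtain ⟨ι, _, b, -⟩ := hP
  exact Module.Projective.of_basis b

lemma IsFiniteFree.exists_lift [IsHomogeneouslyGenerated 𝒜] {P M N : GrMod 𝒜}
    (hP : IsFiniteFree P) (f : M ⟶ N) (hf : Function.Surjective (Hom.toLin f)) (g : P ⟶ N) :
    ∃ h : P ⟶ M, h ≫ f = g :=
  have := hP.projective
  exists_lift_of_projective f hf g

/-- A graded module has a homogeneous basis with at most `r` elements. -/
def HasHomogeneousBasis (M : GrMod 𝒜) (r : ℕ) : Prop :=
  ∃ (ι : Type) (_ : Fintype ι) (b : Module.Basis ι Rᵐᵒᵖ M) (d : ι → ℤ),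
    (∀ i, b i ∈ M.gr (d i)) ∧ Fintype.card ι ≤ r

lemma HasHomogeneousBasis.isFiniteFree {M : GrMod 𝒜} {r : ℕ} (h : HasHomogeneousBasis M r) :
    IsFiniteFree M := by
  obtain ⟨ι, _, b, d, hb, -⟩ := h
  exact ⟨ι, inferInstance, b, d, hb⟩

lemma hasHomogeneousBasis_zeroObj : HasHomogeneousBasis (zeroObj 𝒜) 0 :=
  ⟨Empty, inferInstance, (Module.Basis.empty PUnit.{u + 1} :
    Module.Basis Empty Rᵐᵒᵖ PUnit.{u + 1}),
    fun _ => 0, fun i => i.elim, le_rfl⟩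

/-- Each generator is replaced by its components. Degrees are stored alongside the elements since
`0` lies in every component. -/
lemma exists_homogeneous_generators (M : GrMod 𝒜) (hM : isFG 𝒜 M) :
    ∃ s : Finset (ℤ × M), (∀ p ∈ s, p.2 ∈ M.gr p.1) ∧
      Submodule.span Rᵐᵒᵖ (Prod.snd '' (s : Set (ℤ × M))) = ⊤ := by
  classical
  obtain ⟨t, ht⟩ := hM.fg_top
  choose s hs using M.exists_sum_proj
  refine ⟨t.biUnion fun x => (s x).image fun i => (i, M.proj i x), fun p hp => ?_,
    eq_top_iff.2 ?_⟩
  · simp only [Finset.mem_biUnion, Finset.mem_image] at hp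
    obtain ⟨x, -, i, -, rfl⟩ := hp
    exact M.proj_mem i x
  · rw [← ht, Submodule.span_le]
    intro x hx
    rw [← hs x (s x) subset_rfl]
    refine sum_mem fun i hi => Submodule.subset_span ⟨(i, M.proj i x), ?_, rfl⟩
    simp only [Finset.mem_coe, Finset.mem_biUnion, Finset.mem_image]
    exact ⟨x, hx, i, hi, rfl⟩

lemma surjective_of_span_eq_top {P M : GrMod 𝒜} (φ : P ⟶ M) {s : Finset (ℤ × M)}
    (hs : Submodule.span Rᵐᵒᵖ (Prod.snd '' (s : Set (ℤ × M))) = ⊤)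
    (h : ∀ p ∈ s, p.2 ∈ LinearMap.range (Hom.toLin φ)) : Function.Surjective (Hom.toLin φ) := by
  rw [← LinearMap.range_eq_top, eq_top_iff, ← hs, Submodule.span_le]
  rintro _ ⟨p, hp, rfl⟩
  exact h p hp

/-- The universal property of the direct sum, from the left. -/
def desc {M N P : GrMod 𝒜} (f : M ⟶ P) (g : N ⟶ P) : M.prod N ⟶ P :=
  fst M N ≫ f + snd M N ≫ g

/-- The morphism from a twist attached to a morphism to the opposite twist. -/
def ofTwist {M N : GrMod 𝒜} (m n : ℤ) (h : m + n = 0) (f : M ⟶ (twist m).obj N) :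
    (twist n).obj M ⟶ N :=
  homMk (M := (twist n).obj M) (N := N) (Hom.toLin (M := M) (N := (twist m).obj N) f)
    fun i x hx => by
      have : Hom.toLin f x ∈ N.gr (m + (n + i)) := Hom.toLin_mem f hx
      rwa [← add_assoc, h, zero_add] at this

end Homogeneous

section FG

variable {R : Type u} [Ring R] {σ : Type*} [SetLike σ R] {𝒜 : ℕ → σ}

/-- The explicit cokernel is a quotient of `N`, hence available as a test object inside `FG`. -/
lemma surjective_of_epi_FG {M N : FG 𝒜} (f : M ⟶ N) [Epi f] :
    Function.Surjective (Hom.toLin f.hom) := by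
  intro y
  let Z : FG 𝒜 := ⟨coker f.hom, isFG_coker _ N.property⟩
  let π : N ⟶ Z := ObjectProperty.homMk (cokerπ f.hom)
  have h : π = 0 := by
    rw [← cancel_epi f, comp_zero]
    ext1
    exact comp_cokerπ f.hom
  have h' : cokerπ f.hom = 0 := congrArg (fun φ : N ⟶ Z => φ.hom) h
  exact (Submodule.Quotient.mk_eq_zero _).1 (congrArg (fun φ => Hom.toLin φ y) h')

lemma epi_of_surjective_FG {M N : FG 𝒜} (f : M ⟶ N)
    (hf : Function.Surjective (Hom.toLin f.hom)) : Epi f where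
  left_cancellation g h hgh := by
    ext1
    ext x
    obtain ⟨y, rfl⟩ := hf x
    have := congrArg (fun φ : M ⟶ _ => φ.hom) hgh
    exact congrArg (fun φ => Hom.toLin φ y) this

lemma mono_of_injective_FG {M N : FG 𝒜} (f : M ⟶ N)
    (hf : Function.Injective (Hom.toLin f.hom)) : Mono f where
  right_cancellation g h hgh := by
    ext1
    ext x
    have := congrArg (fun φ : _ ⟶ N => φ.hom) hgh
    exact hf (congrArg (fun φ => Hom.toLin φ x) this)

/-- Lift a morphism through an injective morphism. -/
def liftOfInjective {M N P : GrMod 𝒜} (f : M ⟶ N) (hf : Function.Injective (Hom.toLin f))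
    (g : P ⟶ N) (hg : ∀ x, Hom.toLin g x ∈ LinearMap.range (Hom.toLin f)) : P ⟶ M :=
  homMk ((LinearEquiv.ofInjective (Hom.toLin f) hf).symm.toLinearMap ∘ₗ
    (Hom.toLin g).codRestrict _ hg) fun i x hx => by
      refine mem_gr_of_injective f hf ?_
      have := LinearEquiv.ofInjective_symm_apply (f := Hom.toLin f) (h := hf)
        ((Hom.toLin g).codRestrict _ hg x)
      exact this.symm ▸ Hom.toLin_mem g hx

lemma liftOfInjective_comp {M N P : GrMod 𝒜} (f : M ⟶ N) (hf : Function.Injective (Hom.toLin f))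
    (g : P ⟶ N) (hg : ∀ x, Hom.toLin g x ∈ LinearMap.range (Hom.toLin f)) :
    liftOfInjective f hf g hg ≫ f = g := by
  ext x
  exact LinearEquiv.ofInjective_symm_apply (f := Hom.toLin f) (h := hf) ((Hom.toLin g).codRestrict _ hg x)

lemma shortExact_FG [IsNoetherianRing Rᵐᵒᵖ] (S : ShortComplex (FG 𝒜))
    (hf : Function.Injective (Hom.toLin S.f.hom)) (hg : Function.Surjective (Hom.toLin S.g.hom))
    (hfg : ∀ x, Hom.toLin S.g.hom x = 0 → ∃ y, Hom.toLin S.f.hom y = x) : S.ShortExact where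
  exact := S.exact_of_f_is_kernel (KernelFork.IsLimit.ofι _ _
    (fun {P} k hk => ObjectProperty.homMk (liftOfInjective S.f.hom hf k.hom fun x =>
      hfg _ (congrArg (fun φ : P ⟶ S.X₃ => Hom.toLin φ.hom x) hk)))
    (fun {P} k hk => by
      ext1
      exact liftOfInjective_comp _ _ _ _)
    (fun {P} k hk m hm => by
      have := mono_of_injective_FG S.f hf
      rw [← cancel_mono S.f, hm]
      ext1
      exact (liftOfInjective_comp _ _ _ _).symm))
  mono_f := mono_of_injective_FG _ hf
  epi_g := epi_of_surjective_FG _ hg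

end FG

section Free

variable {k : Type*} [Field k] {B : Type u} [Ring B] [Algebra k B] (𝒜 : ℕ → Submodule k B)
  [GradedAlgebra 𝒜]

instance : IsHomogeneouslyGenerated 𝒜 where
  mem_closure r := by
    classical
    rw [← DirectSum.sum_support_decompose 𝒜 r]
    exact sum_mem fun i _ => AddSubmonoid.subset_closure ⟨i, SetLike.coe_mem _⟩

/-- The homogeneous components of the free module of rank one. -/
def unitGr (i : ℤ) : AddSubgroup Bᵐᵒᵖ where
  -- The clause `0 ≤ i` matters: `toNat` sends every negative degree to `0`.
  carrier := {x | (0 ≤ i ∧ unop x ∈ 𝒜 i.toNat) ∨ x = 0}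
  zero_mem' := Or.inr rfl
  add_mem' := by
    rintro x y (⟨hi, hx⟩ | rfl) (⟨hi', hy⟩ | rfl)
    · exact Or.inl ⟨hi, add_mem hx hy⟩
    · exact Or.inl ⟨hi, by simpa using hx⟩
    · exact Or.inl ⟨hi', by simpa using hy⟩
    · exact Or.inr (add_zero 0)
  neg_mem' := by
    rintro x (⟨hi, hx⟩ | rfl)
    · exact Or.inl ⟨hi, neg_mem hx⟩
    · exact Or.inr neg_zero

/-- The free graded module of rank one. -/
def unit : GrMod 𝒜 where
  carrier := Bᵐᵒᵖ
  gr := unitGr 𝒜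
  isInternal := by
    classical
    refine isInternal_of _ (fun x => ?_) (fun s v hv h i hi => ?_)
    · refine ⟨(DirectSum.decompose 𝒜 x.unop).support.map ⟨Int.ofNat, Int.ofNat_injective⟩,
        fun i => if 0 ≤ i then op (DirectSum.decompose 𝒜 x.unop i.toNat : B) else 0,
        fun i => ?_, ?_⟩
      · dsimp only
        split_ifs with h
        · exact Or.inl ⟨h, SetLike.coe_mem _⟩
        · exact zero_mem _
      · rw [Finset.sum_map]
        apply unop_injective
        conv_rhs => rw [← DirectSum.sum_support_decompose 𝒜 x.unop]
        simp
    · rcases hv i with ⟨hi₀, h'⟩ | h'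
      · have h₂ : (DirectSum.decompose 𝒜 (∑ j ∈ s, v j).unop i.toNat : B) = 0 := by simp [h]
        have h₃ : (∑ j ∈ s, v j).unop = ∑ j ∈ s, (v j).unop :=
          map_sum (opAddEquiv (α := B)).symm _ _
        rw [h₃, DirectSum.decompose_sum, DFinsupp.finsetSum_apply,
          AddSubmonoidClass.coe_finsetSum, Finset.sum_eq_single i,
          DirectSum.decompose_of_mem_same 𝒜 h'] at h₂
        · exact unop_injective h₂
        · intro j _ hji
          rcases hv j with ⟨hj, h'⟩ | h'
          · exact DirectSum.decompose_of_mem_ne 𝒜 h' (by lia)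
          · simp [h']
        · exact fun h => (h hi).elim
      · exact h'
  smul_mem {i j a x} ha hx := by
    rcases hx with ⟨hj, hx⟩ | rfl
    · refine Or.inl ⟨by lia, ?_⟩
      rw [show (j + i).toNat = j.toNat + i by lia]
      exact SetLike.mul_mem_graded hx ha
    · rw [smul_zero]
      exact zero_mem _

lemma one_mem_unit : (1 : Bᵐᵒᵖ) ∈ (unit 𝒜).gr 0 := Or.inl ⟨le_rfl, SetLike.one_mem_graded 𝒜⟩

variable {𝒜}

/-- The twist by `-e` puts the generator `1` in degree `e`. The count of basis elements is tracked
for the minimality argument in `isFiniteFree_of_projective`. -/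
lemma HasHomogeneousBasis.twist_unit_prod {M : GrMod 𝒜} {r : ℕ} (h : HasHomogeneousBasis M r)
    (e : ℤ) : HasHomogeneousBasis (((twist (-e)).obj (unit 𝒜)).prod M) (r + 1) := by
  obtain ⟨ι, _, b, d, hb, hι⟩ := h
  let c : Module.Basis Unit Bᵐᵒᵖ ((twist (-e)).obj (unit 𝒜)) := Module.Basis.singleton Unit Bᵐᵒᵖ
  have hc : c () ∈ ((twist (-e)).obj (unit 𝒜)).gr e := by
    have h : (Module.Basis.singleton Unit Bᵐᵒᵖ) () = 1 := Module.Basis.singleton_apply _ _ _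
    have h' : (1 : Bᵐᵒᵖ) ∈ (unit 𝒜).gr (-e + e) := by
      rw [neg_add_cancel]
      exact one_mem_unit 𝒜
    exact h.symm ▸ h'
  refine ⟨Unit ⊕ ι, inferInstance, c.prod b, Sum.elim (fun _ => e) d, ?_, ?_⟩
  · rintro (i | i)
    · have h : c.prod b (Sum.inl i) = (c i, 0) := by simp [Module.Basis.prod_apply]
      exact h ▸ ⟨hc, (M.gr _).zero_mem⟩
    · have h : c.prod b (Sum.inr i) = (0, b i) := by simp [Module.Basis.prod_apply]
      exact h ▸ ⟨zero_mem _, hb i⟩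
  · simpa [add_comm] using hι

/-- The morphism from a twist of the free module of rank one given by a homogeneous element. -/
def unitHom (M : GrMod 𝒜) {e : ℤ} {x : M} (hx : x ∈ M.gr e) : (twist (-e)).obj (unit 𝒜) ⟶ M :=
  homMk (M := (twist (-e)).obj (unit 𝒜)) (N := M)
    (LinearMap.toSpanSingleton Bᵐᵒᵖ M x : Bᵐᵒᵖ →ₗ[Bᵐᵒᵖ] M) fun i y hy => by
      rcases hy with ⟨h, hy⟩ | rfl
      · have := M.smul_mem hy hx
        rwa [show e + (-e + i).toNat = i by lia] at this
      · exact (congrArg (· ∈ M.gr i) (zero_smul Bᵐᵒᵖ x)).mpr (zero_mem _)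

lemma exists_free_of_finset (M : GrMod 𝒜) (s : Finset (ℤ × M)) (hs : ∀ p ∈ s, p.2 ∈ M.gr p.1) :
    ∃ (P : GrMod 𝒜) (φ : P ⟶ M), HasHomogeneousBasis P s.card ∧
      ∀ p ∈ s, p.2 ∈ LinearMap.range (Hom.toLin φ) := by
  classical
  induction s using Finset.induction_on with
  | empty => exact ⟨zeroObj 𝒜, 0, hasHomogeneousBasis_zeroObj, by simp⟩
  | insert p s hp ih =>
    obtain ⟨P, φ, hP, h⟩ := ih fun q hq => hs q (Finset.mem_insert_of_mem hq)
    refine ⟨((twist (-p.1)).obj (unit 𝒜)).prod P,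
      desc (unitHom M (hs p (Finset.mem_insert_self _ _))) φ, ?_, fun q hq => ?_⟩
    · rw [Finset.card_insert_of_notMem hp]
      exact hP.twist_unit_prod _
    rcases Finset.mem_insert.1 hq with rfl | hq
    · refine ⟨((1 : Bᵐᵒᵖ), (0 : P)), ?_⟩
      refine (congrArg₂ (· + ·) (one_smul _ _) (map_zero (Hom.toLin φ))).trans (add_zero _)
    · obtain ⟨y, hy⟩ := h q hq
      refine ⟨((0 : Bᵐᵒᵖ), y), ?_⟩
      exact (congrArg₂ (· + ·) (zero_smul _ _) hy).trans (zero_add _)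

lemma exists_free_cover (M : GrMod 𝒜) (hM : isFG 𝒜 M) :
    ∃ (P : GrMod 𝒜) (φ : P ⟶ M), IsFiniteFree P ∧ Function.Surjective (Hom.toLin φ) := by
  obtain ⟨s, hs, hspan⟩ := M.exists_homogeneous_generators hM
  obtain ⟨P, φ, hP, h⟩ := M.exists_free_of_finset s hs
  exact ⟨P, φ, hP.isFiniteFree, surjective_of_span_eq_top φ hspan h⟩

/-- A finitely generated graded module is a quotient of the twist of a free module. -/
lemma exists_twist_free_cover (n : ℤ) (M : GrMod 𝒜) (hM : isFG 𝒜 M) :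
    ∃ (P : GrMod 𝒜) (φ : (twist n).obj P ⟶ M), IsFiniteFree P ∧
      Function.Surjective (Hom.toLin φ) := by
  obtain ⟨P, φ, hP, hφ⟩ := exists_free_cover ((twist (-n)).obj M) hM
  exact ⟨P, ofTwist (-n) n (by simp) φ, hP, hφ⟩

end Free

end GrMod

/-! ### Restriction of scalars and multiplication by `W` -/

namespace Superpotential

variable {k : Type*} [Field k] {B : Type u} [Ring B] [Algebra k B] {𝒜 : ℕ → Submodule k B}
  {n : ℕ} (W : Superpotential 𝒜 n)

/-- Restriction of scalars of graded modules along `B → B / WB`. -/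
def restrict (M : GrMod W.quotGrading) : GrMod 𝒜 where
  carrier := M
  module := Module.compHom M (RingHom.op (Ideal.Quotient.mk W.ideal))
  gr := M.gr
  isInternal := M.isInternal
  smul_mem ha hx := M.smul_mem ⟨_, ha, rfl⟩ hx

lemma restrict_smul (M : GrMod W.quotGrading) (b : B) (x : M) :
    (op b • (show W.restrict M from x) : W.restrict M) = op (Ideal.Quotient.mk W.ideal b) • x := rfl

lemma restrict_elt_smul (M : GrMod W.quotGrading) (x : W.restrict M) : op W.elt • x = 0 := by
  have h : Ideal.Quotient.mk W.ideal W.elt = 0 :=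
    Ideal.Quotient.eq_zero_iff_mem.2 (Ideal.mem_span_singleton_self _)
  refine (W.restrict_smul M W.elt x).trans ?_
  rw [h]
  exact zero_smul (W.Quot)ᵐᵒᵖ (show M.carrier from x)

/-- Restriction of scalars of morphisms. -/
def restrictMap {M N : GrMod W.quotGrading} (f : M ⟶ N) : W.restrict M ⟶ W.restrict N :=
  GrMod.homMk (M := W.restrict M) (N := W.restrict N)
    { toFun := fun x => GrMod.Hom.toLin f x
      map_add' := fun x y => map_add (GrMod.Hom.toLin f) x y
      map_smul' := fun b x =>
        (GrMod.Hom.toLin f).map_smul (op (Ideal.Quotient.mk W.ideal b.unop)) x }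
    (fun _ _ h => GrMod.Hom.toLin_mem f h)

/-- Morphisms from a graded `B`-module annihilated by `W` to a restriction are morphisms of
`A`-modules. -/
def ofRestrict {K : GrMod 𝒜} (hK : ∀ x : K, op W.elt • x = 0) {M : GrMod W.quotGrading}
    (f : K ⟶ W.restrict M) : W.quotModule K hK ⟶ M :=
  GrMod.homMk (M := W.quotModule K hK) (N := M)
    { toFun := fun x => GrMod.Hom.toLin f x
      map_add' := fun x y => map_add (GrMod.Hom.toLin f) x y
      map_smul' := by
        intro a x
        obtain ⟨b, hb⟩ := Ideal.Quotient.mk_surjective a.unop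
        obtain rfl : op (Ideal.Quotient.mk W.ideal b) = a := unop_injective hb
        exact (GrMod.Hom.toLin f).map_smul (op b) x }
    (fun _ _ h => GrMod.Hom.toLin_mem f h)

lemma isFG_restrict {M : GrMod W.quotGrading} (hM : GrMod.isFG W.quotGrading M) :
    GrMod.isFG 𝒜 (W.restrict M) := by
  obtain ⟨s, hs⟩ := hM.fg_top
  let _ : Module Bᵐᵒᵖ M := Module.compHom M (RingHom.op (Ideal.Quotient.mk W.ideal))
  change Module.Finite Bᵐᵒᵖ M
  refine ⟨⟨s, eq_top_iff.2 fun x _ => ?_⟩⟩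
  have hx : x ∈ Submodule.span (W.Quot)ᵐᵒᵖ (s : Set M) := hs ▸ Submodule.mem_top
  induction hx using Submodule.span_induction with
  | mem x hx => exact Submodule.subset_span hx
  | zero => exact Submodule.zero_mem _
  | add x y _ _ hx hy => exact Submodule.add_mem _ (hx trivial) (hy trivial)
  | smul a x _ hx =>
    obtain ⟨b, hb⟩ := Ideal.Quotient.mk_surjective a.unop
    obtain rfl : op (Ideal.Quotient.mk W.ideal b) = a := unop_injective hb
    exact Submodule.smul_mem _ (op b) (hx trivial)

lemma mul_naturality {M N : GrMod 𝒜} (f : M ⟶ N) :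
    f ≫ W.mul N = W.mul M ≫ (GrMod.twist n).map f := by
  ext x
  exact ((GrMod.Hom.toLin f).map_smul (op W.elt) x).symm

lemma twist_map_mul (M : GrMod 𝒜) :
    (GrMod.twist n).map (W.mul M) = W.mul ((GrMod.twist n).obj M) := by
  ext x
  rfl

/-- In the coordinates of a basis this is the regularity of `W` in `B`. -/
lemma eq_zero_of_elt_smul_eq_zero {M : GrMod 𝒜} (hM : GrMod.IsFiniteFree M) {x : M}
    (hx : op W.elt • x = 0) : x = 0 := by
  obtain ⟨ι, _, b, -⟩ := hM
  apply b.repr.injective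
  rw [map_zero]
  ext i
  have h := congrArg (fun y => b.repr y i) hx
  simp only [map_smul, map_zero, Finsupp.smul_apply, Finsupp.zero_apply, smul_eq_mul] at h
  rw [Finsupp.zero_apply]
  exact unop_injective (W.regular _ (congrArg unop h))

lemma mul_injective {M : GrMod 𝒜} (hM : GrMod.IsFiniteFree M) :
    Function.Injective (GrMod.Hom.toLin (W.mul M)) := by
  rw [injective_iff_map_eq_zero]
  exact fun x hx => W.eq_zero_of_elt_smul_eq_zero hM hx

end Superpotential

/-! ### Cokernels, homotopies and cones of graded pairs -/

namespace GrPair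

open GrMod

variable {k : Type*} [Field k] {B : Type u} [Ring B] [Algebra k B] {𝒜 : ℕ → Submodule k B}
  {n : ℕ} {W : Superpotential 𝒜 n}

/-- The composite `p₀ p₁ = W` is injective on a free module. Thus `p₁` is a free resolution over `B`
of the cokernel, the source of all lifting arguments below. -/
lemma p₁_injective (P : GrPair W) : Function.Injective (GrMod.Hom.toLin P.p₁) := by
  have h := W.mul_injective P.free₁
  rw [← P.p₁_p₀] at h
  exact Function.Injective.of_comp (f := GrMod.Hom.toLin P.p₀) h

lemma p₀_injective (P : GrPair W) : Function.Injective (GrMod.Hom.toLin P.p₀) := by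
  have h := W.mul_injective P.free₀
  rw [← P.p₀_p₁] at h
  exact Function.Injective.of_comp (f := GrMod.Hom.toLin ((twist n).map P.p₁)) h

/-- The projection to the cokernel, over `B`. -/
def cokProj (P : GrPair W) : P.P₀ ⟶ W.restrict ((cok W).obj P).obj :=
  homMk (M := P.P₀) (N := W.restrict ((cok W).obj P).obj)
    { toFun := fun x => GrMod.Hom.toLin (cokerπ P.p₁) x
      map_add' := fun x y => map_add (GrMod.Hom.toLin (cokerπ P.p₁)) x y
      map_smul' := fun b x => (GrMod.Hom.toLin (cokerπ P.p₁)).map_smul b x }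
    (fun _ _ h => GrMod.Hom.toLin_mem (cokerπ P.p₁) h)

lemma cokProj_surjective (P : GrPair W) : Function.Surjective (GrMod.Hom.toLin P.cokProj) :=
  Submodule.mkQ_surjective (LinearMap.range (GrMod.Hom.toLin P.p₁))

lemma cokProj_eq_zero_iff (P : GrPair W) (x : P.P₀) :
    GrMod.Hom.toLin P.cokProj x = 0 ↔ x ∈ LinearMap.range (GrMod.Hom.toLin P.p₁) :=
  Submodule.Quotient.mk_eq_zero (LinearMap.range (GrMod.Hom.toLin P.p₁))

lemma p₁_cokProj (P : GrPair W) : P.p₁ ≫ P.cokProj = 0 := by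
  ext x
  exact (P.cokProj_eq_zero_iff _).2 ⟨x, rfl⟩

lemma cokProj_naturality {P Q : GrPair W} (f : P ⟶ Q) :
    P.cokProj ≫ W.restrictMap ((cok W).map f).hom = Hom.f₀ f ≫ Q.cokProj := by
  ext x
  rfl

/-- Morphisms out of the cokernel of a graded pair. -/
def cokDesc (P : GrPair W) {M : FG W.quotGrading} (φ : P.P₀ ⟶ W.restrict M.obj)
    (hφ : P.p₁ ≫ φ = 0) : (cok W).obj P ⟶ M :=
  ObjectProperty.homMk (W.ofRestrict P.smul_coker (cokerDesc P.p₁ φ hφ))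

lemma cok_hom_ext (P : GrPair W) {M : FG W.quotGrading} {f g : (cok W).obj P ⟶ M}
    (h : P.cokProj ≫ W.restrictMap f.hom = P.cokProj ≫ W.restrictMap g.hom) : f = g := by
  ext1
  ext x
  obtain ⟨y, rfl⟩ := P.cokProj_surjective x
  exact congrArg (fun φ => GrMod.Hom.toLin φ y) h

instance (P Q : GrPair W) : Zero (P ⟶ Q) := ⟨⟨0, 0, by simp, by simp⟩⟩

lemma cok_map_zero (P Q : GrPair W) : (cok W).map (0 : P ⟶ Q) = 0 := by
  apply cok_hom_ext
  rw [cokProj_naturality]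
  ext x
  exact map_zero (GrMod.Hom.toLin Q.cokProj)

/-- Morphisms with the same cokernel are homotopic. -/
lemma homotopic_of_cok_map_eq {P Q : GrPair W} {f g : P ⟶ Q} (h : (cok W).map f = (cok W).map g) :
    Homotopic f g := by
  have h₀ : (Hom.f₀ f - Hom.f₀ g) ≫ Q.cokProj = 0 := by
    rw [Preadditive.sub_comp, ← cokProj_naturality, ← cokProj_naturality, h, sub_self]
  have hr : ∀ x, GrMod.Hom.toLin (Hom.f₀ f - Hom.f₀ g) x ∈
      LinearMap.range (GrMod.Hom.toLin Q.p₁) := fun x =>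
    (Q.cokProj_eq_zero_iff _).1 (congrArg (fun φ => GrMod.Hom.toLin φ x) h₀)
  have hs := liftOfInjective_comp Q.p₁ Q.p₁_injective _ hr
  -- The difference `f₀ - g₀` lands in the image of the injective `q₁`, which defines `s`; then `t =
  -- 0` suffices.
  refine ⟨liftOfInjective Q.p₁ Q.p₁_injective _ hr, 0, ?_, ?_⟩
  · rw [zero_comp, zero_add]
    congr 1
    ext x
    apply Q.p₁_injective
    have h₁ : (Hom.f₁ f - Hom.f₁ g) ≫ Q.p₁ =
        (P.p₁ ≫ liftOfInjective Q.p₁ Q.p₁_injective _ hr) ≫ Q.p₁ := by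
      rw [Category.assoc, hs, Preadditive.sub_comp, Preadditive.comp_sub, Hom.comm₁, Hom.comm₁]
    exact congrArg (fun φ => GrMod.Hom.toLin φ x) h₁
  · rw [hs, comp_zero, zero_add]

/-- The contractible graded pair `(F, F(n))` attached to a free module `F`. -/
def trivial (W : Superpotential 𝒜 n) (F : GrMod 𝒜) (hF : IsFiniteFree F) : GrPair W where
  P₁ := F
  P₀ := (twist n).obj F
  free₁ := hF
  free₀ := hF.twist n
  p₁ := W.mul F
  p₀ := 𝟙 _
  p₁_p₀ := Category.comp_id _
  p₀_p₁ := by rw [Category.id_comp, W.twist_map_mul]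

/-- `A`-modules are killed by `W`, so every map from `F(n)` to one descends to `F(n)/WF`, the
cokernel of `trivial`. -/
lemma mul_comp_restrict {F : GrMod 𝒜} {M : GrMod W.quotGrading}
    (φ : (twist n).obj F ⟶ W.restrict M) : W.mul F ≫ φ = 0 := by
  ext x
  exact ((GrMod.Hom.toLin φ).map_smul (op W.elt) x).trans (W.restrict_elt_smul M _)

/-- Homotopic morphisms induce morphisms on cokernels whose difference factors through the
cokernel of a contractible pair. -/
lemma exists_factorization_of_homotopic {P Q : GrPair W} {f g : P ⟶ Q} (h : Homotopic f g) :
    ∃ (a : (cok W).obj P ⟶ (cok W).obj (trivial W P.P₁ P.free₁))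
      (b : (cok W).obj (trivial W P.P₁ P.free₁) ⟶ (cok W).obj Q),
      (cok W).map f - (cok W).map g = a ≫ b := by
  obtain ⟨s, t, -, h₀⟩ := h
  -- Modulo the image of `q₁` the homotopy formula for `f₀ - g₀` reduces to `t p₀`, which passes
  -- through `P₁(n)/W P₁`.
  let T := trivial W P.P₁ P.free₁
  let π : (twist n).obj P.P₁ ⟶ W.restrict ((cok W).obj T).obj := T.cokProj
  let a : (cok W).obj P ⟶ (cok W).obj T := P.cokDesc (P.p₀ ≫ π) (by
    rw [← Category.assoc, P.p₁_p₀, mul_comp_restrict])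
  let b : (cok W).obj T ⟶ (cok W).obj Q := T.cokDesc (t ≫ Q.cokProj) (mul_comp_restrict _)
  refine ⟨a, b, P.cok_hom_ext ?_⟩
  have h₁ : P.cokProj ≫ W.restrictMap ((cok W).map f - (cok W).map g).hom =
      (Hom.f₀ f - Hom.f₀ g) ≫ Q.cokProj := by
    ext x
    exact (map_sub (GrMod.Hom.toLin Q.cokProj) _ _).symm
  have h₂ : P.cokProj ≫ W.restrictMap (a ≫ b).hom = P.p₀ ≫ t ≫ Q.cokProj := by
    ext x
    rfl
  rw [h₁, h₂, h₀, Preadditive.add_comp, Category.assoc, Category.assoc, p₁_cokProj, comp_zero,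
    add_zero]

section

variable [GradedAlgebra 𝒜]

/-- Morphisms between cokernels lift to graded pairs. -/
lemma exists_cok_map_eq {P Q : GrPair W} (g : (cok W).obj P ⟶ (cok W).obj Q) :
    ∃ f : P ⟶ Q, (cok W).map f = g := by
  obtain ⟨f₀, hf₀⟩ := P.free₀.exists_lift Q.cokProj Q.cokProj_surjective
    (P.cokProj ≫ W.restrictMap g.hom)
  have h₀ : (P.p₁ ≫ f₀) ≫ Q.cokProj = 0 := by
    rw [Category.assoc, hf₀, ← Category.assoc, p₁_cokProj, zero_comp]
  have hr : ∀ x, GrMod.Hom.toLin (P.p₁ ≫ f₀) x ∈ LinearMap.range (GrMod.Hom.toLin Q.p₁) := fun x =>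
    (Q.cokProj_eq_zero_iff _).1 (congrArg (fun φ => GrMod.Hom.toLin φ x) h₀)
  let f₁ := liftOfInjective Q.p₁ Q.p₁_injective _ hr
  have hf₁ : f₁ ≫ Q.p₁ = P.p₁ ≫ f₀ := liftOfInjective_comp Q.p₁ Q.p₁_injective _ hr
  -- The second relation is automatic: after composing with the injective `q₁(n)` it becomes
  -- naturality of multiplication by `W`.
  have h₁ : P.p₀ ≫ (twist n).map f₁ = f₀ ≫ Q.p₀ := by
    have h₂ : (P.p₀ ≫ (twist n).map f₁) ≫ (twist n).map Q.p₁ =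
        (f₀ ≫ Q.p₀) ≫ (twist n).map Q.p₁ := by
      rw [Category.assoc, Category.assoc, ← Functor.map_comp, hf₁, Functor.map_comp, Q.p₀_p₁,
        ← Category.assoc, P.p₀_p₁, W.mul_naturality]
    ext x
    exact Q.p₁_injective (congrArg (fun φ => GrMod.Hom.toLin φ x) h₂)
  let f : P ⟶ Q := ⟨f₁, f₀, hf₁.symm, h₁⟩
  exact ⟨f, P.cok_hom_ext ((cokProj_naturality f).trans hf₀)⟩

/-- Maps out of `F(n)/WF` to `A`-modules are maps out of the graded free `B`-module `F(n)`, and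
these lift along surjections. -/
instance projective_cok_trivial (F : GrMod 𝒜) (hF : IsFiniteFree F) :
    Projective ((cok W).obj (trivial W F hF)) where
  factors {E N} g f _ := by
    obtain ⟨ψ, hψ⟩ := (hF.twist n).exists_lift (W.restrictMap f.hom) (surjective_of_epi_FG f)
      ((trivial W F hF).cokProj ≫ W.restrictMap g.hom)
    refine ⟨(trivial W F hF).cokDesc ψ (mul_comp_restrict ψ), cok_hom_ext _ ?_⟩
    exact hψ

/-- A contraction factors the identity of the cokernel through a free `A`-module. -/
lemma projective_cok_of_homotopic {P : GrPair W} (h : Homotopic (𝟙 P) 0) :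
    Projective ((cok W).obj P) := by
  obtain ⟨a, b, hab⟩ := exists_factorization_of_homotopic h
  rw [cok_map_zero, sub_zero, CategoryTheory.Functor.map_id] at hab
  exact Retract.projective ⟨a, b, hab.symm⟩

lemma exists_trivial_cover (M : FG W.quotGrading) :
    ∃ (F : GrMod 𝒜) (hF : IsFiniteFree F) (f : (cok W).obj (trivial W F hF) ⟶ M),
      Function.Surjective (GrMod.Hom.toLin f.hom) := by
  obtain ⟨F, φ, hF, hφ⟩ := exists_twist_free_cover n (W.restrict M.obj) (W.isFG_restrict M.property)
  refine ⟨F, hF, (trivial W F hF).cokDesc φ (mul_comp_restrict φ), fun y => ?_⟩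
  obtain ⟨x, hx⟩ := hφ y
  exact ⟨GrMod.Hom.toLin (trivial W F hF).cokProj x, hx⟩

end

/-- As for complexes, the contraction carries the summand of the target identically onto its copy in
the shifted source and kills the other summand. -/
lemma homotopic_id_cone (P : GrPair W) : Homotopic (𝟙 (cone (𝟙 P))) 0 := by
  let s : (cone (𝟙 P)).P₀ ⟶ (cone (𝟙 P)).P₁ :=
    GrMod.lift (M := P.P₁) (N := P.P₀) 0 (fst P.P₀ ((twist n).obj P.P₁))
  let t : (twist n).obj (cone (𝟙 P)).P₁ ⟶ (cone (𝟙 P)).P₀ :=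
    GrMod.lift (M := P.P₀) (N := (twist n).obj P.P₁) 0 ((twist n).map (fst P.P₁ P.P₀))
  refine ⟨s, t, ?_, ?_⟩
  · ext ⟨a, b⟩
    refine Prod.ext ((sub_zero a).trans ?_) ((sub_zero b).trans ?_)
    · exact ((add_zero _).trans
        ((congrArg (fun u : P.P₁.carrier => u + a) (map_zero (GrMod.Hom.toLin P.p₀))).trans
          (zero_add a))).symm
    · exact (neg_add_cancel_left (GrMod.Hom.toLin P.p₁ a) b).symm
  · ext ⟨a, b⟩
    refine Prod.ext ((sub_zero a).trans ?_) ((sub_zero b).trans ?_)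
    · exact ((zero_add _).trans
        ((congrArg (· + _) (map_zero (GrMod.Hom.toLin P.p₁))).trans (zero_add a))).symm
    · exact (add_neg_cancel_comm (GrMod.Hom.toLin P.p₀ a) b).symm

lemma neg_p₀_neg_p₁ (P : GrPair W) (x : P.P₁) :
    -GrMod.Hom.toLin P.p₀ (-GrMod.Hom.toLin P.p₁ x) = GrMod.Hom.toLin (W.mul P.P₁) x := by
  rw [map_neg, neg_neg]
  exact P.p₀_p₁_apply x

lemma neg_p₁_neg_p₀ (P : GrPair W) (x : P.P₀) :
    -GrMod.Hom.toLin ((twist n).map P.p₁) (-GrMod.Hom.toLin P.p₀ x) =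
      GrMod.Hom.toLin (W.mul P.P₀) x := by
  rw [map_neg, neg_neg]
  exact P.p₁_p₀_apply x

/-- The inverse of the translation on objects. -/
def untranslate (P : GrPair W) : GrPair W where
  P₁ := (twist (-n : ℤ)).obj P.P₀
  P₀ := P.P₁
  free₁ := P.free₀.twist _
  free₀ := P.free₁
  p₁ := -ofTwist (n : ℤ) (-n) (by simp) P.p₀
  p₀ := homMk (M := P.P₁) (N := (twist n).obj ((twist (-n : ℤ)).obj P.P₀))
    (-GrMod.Hom.toLin P.p₁) fun i x hx => by
      change -GrMod.Hom.toLin P.p₁ x ∈ P.P₀.gr (-n + (n + i))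
      rw [neg_add_cancel_left]
      exact neg_mem (GrMod.Hom.toLin_mem P.p₁ hx)
  p₁_p₀ := by
    ext x
    exact P.neg_p₁_neg_p₀ x
  p₀_p₁ := by
    ext x
    exact P.neg_p₀_neg_p₁ x

/-- The translation of `P.untranslate` is `P`. -/
def translationUntranslateIso (P : GrPair W) : translation.obj P.untranslate ≅ P where
  hom :=
    { f₁ := 𝟙 P.P₁
      -- The double twist has components of degree `-n + (n + i)`, so the identity map is an
      -- isomorphism between formally different graded modules.
      f₀ := homMk (M := (twist n).obj ((twist (-n : ℤ)).obj P.P₀)) (N := P.P₀) LinearMap.id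
        fun i x hx => by
          change x ∈ P.P₀.gr (-n + (n + i)) at hx
          rwa [neg_add_cancel_left] at hx
      comm₁ := by
        ext x
        exact neg_neg (GrMod.Hom.toLin P.p₁ x)
      comm₀ := by
        ext x
        exact neg_neg (GrMod.Hom.toLin P.p₀ x) }
  inv :=
    { f₁ := 𝟙 P.P₁
      f₀ := homMk (M := P.P₀) (N := (twist n).obj ((twist (-n : ℤ)).obj P.P₀)) LinearMap.id
        fun i x hx => by
          change x ∈ P.P₀.gr (-n + (n + i))
          rwa [neg_add_cancel_left]
      comm₁ := by
        ext x
        exact (neg_neg (GrMod.Hom.toLin P.p₁ x)).symm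
      comm₀ := by
        ext x
        exact (neg_neg (GrMod.Hom.toLin P.p₀ x)).symm }
  hom_inv_id := rfl
  inv_hom_id := rfl

/-- The sequence of cokernels of a mapping cone. -/
abbrev coneSequence {P Q : GrPair W} (f : P ⟶ Q) : ShortComplex (FG W.quotGrading) where
  X₁ := (cok W).obj Q
  X₂ := (cok W).obj (cone f)
  X₃ := (cok W).obj (translation.obj P)
  f := (cok W).map (coneInclusion f)
  g := (cok W).map (coneProjection f)
  zero := by
    rw [← Functor.map_comp, ← cok_map_zero]
    congr 1
    ext x
    · exact neg_zero
    · exact neg_zero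

/-- Before taking cokernels the cone is a termwise split extension of `translation.obj P` by `Q`. By
the snake lemma, injectivity of `p₀` keeps the sequence of cokernels left exact. -/
lemma coneSequence_shortExact [IsNoetherianRing (W.Quot)ᵐᵒᵖ] {P Q : GrPair W} (f : P ⟶ Q) :
    (coneSequence f).ShortExact := by
  apply shortExact_FG
  · rw [injective_iff_map_eq_zero]
    intro x hx
    obtain ⟨y, rfl⟩ := Q.cokProj_surjective x
    obtain ⟨⟨a, b⟩, hab⟩ := ((cone f).cokProj_eq_zero_iff
      (GrMod.Hom.toLin (Hom.f₀ (coneInclusion f)) y)).1 hx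
    have h₁ : GrMod.Hom.toLin Q.p₁ a + GrMod.Hom.toLin (Hom.f₀ f) b = y := congrArg Prod.fst hab
    have h₂ : -GrMod.Hom.toLin P.p₀ b = 0 := congrArg Prod.snd hab
    have h₃ : b = 0 := by
      apply P.p₀_injective
      rw [neg_eq_zero.1 h₂, map_zero]
    rw [h₃, map_zero, add_zero] at h₁
    exact (Q.cokProj_eq_zero_iff y).2 ⟨a, h₁⟩
  · intro x
    obtain ⟨y, rfl⟩ := (translation.obj P).cokProj_surjective x
    refine ⟨GrMod.Hom.toLin (cone f).cokProj ((0 : Q.P₀), -y), ?_⟩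
    exact congrArg (GrMod.Hom.toLin (translation.obj P).cokProj) (neg_neg y)
  · intro x hx
    obtain ⟨⟨y, z⟩, rfl⟩ := (cone f).cokProj_surjective x
    obtain ⟨b, hb⟩ := ((translation.obj P).cokProj_eq_zero_iff (-z)).1 hx
    have hb' : GrMod.Hom.toLin P.p₀ b = z := neg_injective hb
    refine ⟨GrMod.Hom.toLin Q.cokProj (y + GrMod.Hom.toLin (Hom.f₀ f) b), ?_⟩
    refine sub_eq_zero.1 ((map_sub (GrMod.Hom.toLin (cone f).cokProj)
      (y + GrMod.Hom.toLin (Hom.f₀ f) b, 0) (y, z)).symm.trans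
        (((cone f).cokProj_eq_zero_iff _).2 ⟨((0 : Q.P₁), b), Prod.ext ?_ ?_⟩))
    · exact ((congrArg (· + _) (map_zero (GrMod.Hom.toLin Q.p₁))).trans (zero_add _)).trans
        (add_sub_cancel_left y _).symm
    · exact (congrArg Neg.neg hb').trans (zero_sub z).symm

/-- Morphisms to the cokernel of a contractible pair extend to the cone of the identity. -/
lemma exists_extension_trivial [GradedAlgebra 𝒜] (P : GrPair W) (F : GrMod 𝒜) (hF : IsFiniteFree F)
    (g : (cok W).obj P ⟶ (cok W).obj (trivial W F hF)) :
    ∃ g' : (cok W).obj (cone (𝟙 P)) ⟶ (cok W).obj (trivial W F hF),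
      (cok W).map (coneInclusion (𝟙 P)) ≫ g' = g := by
  obtain ⟨f, rfl⟩ := exists_cok_map_eq g
  -- Since `trivial` has `p₀ = 𝟙`, one has `f₀ = f₁(n) p₀`. Therefore `(f₀, f₁(n))` composed with
  -- the cone's `p₁` sends `(a, b)` to `W f₁(a)`, which dies in the cokernel.
  let φ : (cone (𝟙 P)).P₀ ⟶ (twist n).obj F := desc (M := P.P₀) (N := (twist n).obj P.P₁)
    (Hom.f₀ f) ((twist n).map (Hom.f₁ f))
  refine ⟨(cone (𝟙 P)).cokDesc (φ ≫ (trivial W F hF).cokProj) ?_, cok_hom_ext _ ?_⟩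
  · ext x
    obtain ⟨a, b⟩ := x
    refine ((trivial W F hF).cokProj_eq_zero_iff _).2 ⟨GrMod.Hom.toLin (Hom.f₁ f) a, ?_⟩
    have h₁ : GrMod.Hom.toLin (Hom.f₀ f) (GrMod.Hom.toLin P.p₁ a) =
        GrMod.Hom.toLin (W.mul F) (GrMod.Hom.toLin (Hom.f₁ f) a) :=
      congrArg (fun φ => GrMod.Hom.toLin φ a) (Hom.comm₁ f)
    have h₂ : GrMod.Hom.toLin (Hom.f₁ f) (GrMod.Hom.toLin P.p₀ b) =
        GrMod.Hom.toLin (Hom.f₀ f) b :=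
      congrArg (fun φ => GrMod.Hom.toLin φ b) (Hom.comm₀ f)
    refine Eq.symm ((congrArg₂ (fun u v : F.carrier => u + v)
      (map_add (GrMod.Hom.toLin (Hom.f₀ f)) (GrMod.Hom.toLin P.p₁ a) b)
      (map_neg (GrMod.Hom.toLin (Hom.f₁ f)) (GrMod.Hom.toLin P.p₀ b))).trans ?_)
    exact (congrArg₂ (fun u v : F.carrier =>
      (u + (show F.carrier from GrMod.Hom.toLin (Hom.f₀ f) b)) + -v) h₁ h₂).trans
      (add_neg_cancel_right _ _)
  · ext x
    exact congrArg (GrMod.Hom.toLin (trivial W F hF).cokProj)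
      ((congrArg (_ + ·) (map_zero (GrMod.Hom.toLin (Hom.f₁ f)))).trans (add_zero _))

end GrPair

/-! ### The formal triangulated argument -/

/-- A functor `cok` from a category with translations and mapping cones, and a congruence,
to an abelian category, such that mapping cones give exact sequences and the morphisms in the
congruence are detected by factorizations through projective objects. -/
structure ConeSystem {𝒦 : Type*} [Category* 𝒦] (r : HomRel 𝒦) (C : Type*) [Category* C]
    [Abelian C] where
  cok : 𝒦 ⥤ C
  translation : 𝒦 ⥤ 𝒦
  rel_translation {P Q : 𝒦} {f g : P ⟶ Q} : r f g → r (translation.map f) (translation.map g)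
  cone {P Q : 𝒦} (f : P ⟶ Q) : 𝒦
  inclusion {P Q : 𝒦} (f : P ⟶ Q) : Q ⟶ cone f
  projection {P Q : 𝒦} (f : P ⟶ Q) : cone f ⟶ translation.obj P
  zero {P Q : 𝒦} (f : P ⟶ Q) : cok.map (inclusion f) ≫ cok.map (projection f) = 0
  shortExact {P Q : 𝒦} (f : P ⟶ Q) :
    (ShortComplex.mk (cok.map (inclusion f)) (cok.map (projection f)) (zero f)).ShortExact
  projective_cone_id (P : 𝒦) : Projective (cok.obj (cone (𝟙 P)))
  exists_extension {P : 𝒦} {L : C} [Projective L] (g : cok.obj P ⟶ L) :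
    ∃ g', cok.map (inclusion (𝟙 P)) ≫ g' = g
  exists_coneMap {P Q P' Q' : 𝒦} {f : P ⟶ Q} {g : P' ⟶ Q'} (a : P ⟶ P') (b : Q ⟶ Q') :
    f ≫ b = a ≫ g → ∃ c : cone f ⟶ cone g, inclusion f ≫ c = b ≫ inclusion g ∧
      c ≫ projection g = projection f ≫ translation.map a
  exists_cok_map_eq {P Q : 𝒦} (g : cok.obj P ⟶ cok.obj Q) : ∃ f, cok.map f = g
  exists_factorization {P Q : 𝒦} {f g : P ⟶ Q} : r f g →
    ∃ (L : C) (_ : Projective L) (a : cok.obj P ⟶ L) (b : L ⟶ cok.obj Q),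
      cok.map f - cok.map g = a ≫ b
  rel_of_factorization {P Q : 𝒦} {f g : P ⟶ Q} {L : C} [Projective L] {a : cok.obj P ⟶ L}
    {b : L ⟶ cok.obj Q} : cok.map f - cok.map g = a ≫ b → r f g
  exists_translation_iso (P : 𝒦) : ∃ P', Nonempty (translation.obj P' ≅ P)

namespace ConeSystem

open SingularityCategory Pretriangulated ZeroObject

variable {𝒦 : Type*} [Category* 𝒦] {r : HomRel 𝒦} {C : Type*} [Category* C] [Abelian C]
  (S : ConeSystem r C)

/-- The exact sequence attached to a mapping cone. -/
abbrev sequence {P Q : 𝒦} (f : P ⟶ Q) : ShortComplex C :=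
  ShortComplex.mk (S.cok.map (S.inclusion f)) (S.cok.map (S.projection f)) (S.zero f)

variable [HasDerivedCategory.{w} C]

/-- A strictly commutative square induces a map of cones, hence of exact sequences, and connecting
morphisms are natural. -/
lemma sesδ_comp_map {P Q P' Q' : 𝒦} {f : P ⟶ Q} {g : P' ⟶ Q'} (a : P ⟶ P') (b : Q ⟶ Q')
    (h : f ≫ b = a ≫ g) :
    sesδ (S.shortExact f) ≫ ((toSingularityCategory C).map (S.cok.map b))⟦(1 : ℤ)⟧' =
      (toSingularityCategory C).map (S.cok.map (S.translation.map a)) ≫ sesδ (S.shortExact g) := by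
  obtain ⟨c, h₁, h₂⟩ := S.exists_coneMap a b h
  exact sesδ_naturality (S.shortExact f) (S.shortExact g)
    { τ₁ := S.cok.map b
      τ₂ := S.cok.map c
      τ₃ := S.cok.map (S.translation.map a)
      comm₁₂ := by
        change S.cok.map b ≫ S.cok.map (S.inclusion g) = S.cok.map (S.inclusion f) ≫ S.cok.map c
        rw [← Functor.map_comp, ← Functor.map_comp, h₁]
      comm₂₃ := by
        change S.cok.map c ≫ S.cok.map (S.projection g) =
          S.cok.map (S.projection f) ≫ S.cok.map (S.translation.map a)
        rw [← Functor.map_comp, ← Functor.map_comp, h₂] }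

/-- Every object is a translation, and the cone of an identity exhibits one cokernel as a syzygy of
its translate, so the class of cokernels admits dimension shifting. -/
lemma isExtOrthogonal (P : 𝒦) : IsExtOrthogonal (S.cok.obj P) := by
  refine isExtOrthogonal_of_class (fun M => ∃ P, Nonempty (S.cok.obj P ≅ M)) ?_
    ⟨P, ⟨Iso.refl _⟩⟩
  rintro M ⟨P, ⟨e⟩⟩
  obtain ⟨P', ⟨e'⟩⟩ := S.exists_translation_iso P
  exact ⟨S.sequence (𝟙 P'), S.shortExact _, ⟨S.cok.mapIso e' ≪≫ e⟩, ⟨P', ⟨Iso.refl _⟩⟩,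
    S.projective_cone_id P', fun L _ g => S.exists_extension g⟩

/-- Both sides mean that the difference on cokernels factors through a projective. One direction
makes the functor well defined on the quotient, the other makes it faithful. -/
lemma map_eq_iff {P Q : 𝒦} {f g : P ⟶ Q} :
    (toSingularityCategory C).map (S.cok.map f) = (toSingularityCategory C).map (S.cok.map g) ↔
      r f g := by
  refine ⟨fun h => ?_, fun h => ?_⟩
  · obtain ⟨L, _, a, b, hab⟩ := exists_sub_eq_comp_of_toSingularityCategory_map_eq
      (S.isExtOrthogonal P) h
    exact S.rel_of_factorization hab.symm
  · obtain ⟨L, _, a, b, hab⟩ := S.exists_factorization h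
    exact toSingularityCategory_map_eq_of_sub_eq_comp hab

/-- The connecting morphism of the cone of the identity is an isomorphism. -/
instance (P : 𝒦) : IsIso (sesδ (S.shortExact (𝟙 P))) := by
  have := S.projective_cone_id P
  exact (Triangle.isZero₂_iff_isIso₃ _ (sesδ_distinguished (S.shortExact (𝟙 P)))).1
    (isZero_toSingularityCategory_obj (S.cok.obj (S.cone (𝟙 P))))

/-- The functor `cok` commutes with translations up to isomorphism in the singularity category. -/
def translationIso (P : 𝒦) : (toSingularityCategory C).obj (S.cok.obj (S.translation.obj P)) ≅
    ((toSingularityCategory C).obj (S.cok.obj P))⟦(1 : ℤ)⟧ where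
  -- The sign compensates the one in the rotation of triangles, where `-f⟦1⟧` has to correspond to
  -- the connecting morphism of `f`.
  hom := -sesδ (S.shortExact (𝟙 P))
  inv := -inv (sesδ (S.shortExact (𝟙 P)))
  hom_inv_id := by
    rw [Preadditive.neg_comp_neg]
    exact IsIso.hom_inv_id (sesδ (S.shortExact (𝟙 P)))
  inv_hom_id := by
    rw [Preadditive.neg_comp_neg]
    exact IsIso.inv_hom_id (sesδ (S.shortExact (𝟙 P)))

lemma translationIso_naturality {P Q : 𝒦} (f : P ⟶ Q) :
    (toSingularityCategory C).map (S.cok.map (S.translation.map f)) ≫ (S.translationIso Q).hom =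
      (S.translationIso P).hom ≫ ((toSingularityCategory C).map (S.cok.map f))⟦(1 : ℤ)⟧' := by
  have h := S.sesδ_comp_map (f := 𝟙 P) (g := 𝟙 Q) f f
    (by rw [Category.id_comp, Category.comp_id])
  exact (Preadditive.comp_neg _ _).trans ((congrArg Neg.neg h.symm).trans
    (Preadditive.neg_comp _ _).symm)

/-- The square formed by `𝟙 P` and `f` maps the cone of `𝟙 P` to the cone of `f` over the identity
of the translation, which expresses one connecting morphism by the other. -/
lemma translationIso_hom_comp {P Q : 𝒦} (f : P ⟶ Q) :
    (S.translationIso P).hom ≫ (-((toSingularityCategory C).map (S.cok.map f))⟦(1 : ℤ)⟧') =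
      sesδ (S.shortExact f) := by
  have h := S.sesδ_comp_map (f := 𝟙 P) (g := f) (𝟙 P) f rfl
  refine (Preadditive.neg_comp_neg _ _).trans (h.trans ?_)
  rw [CategoryTheory.Functor.map_id, CategoryTheory.Functor.map_id, CategoryTheory.Functor.map_id]
  exact Category.id_comp _

/-- Mapping cones are sent to distinguished triangles. -/
lemma cone_distinguished {P Q : 𝒦} (f : P ⟶ Q) :
    Triangle.mk ((toSingularityCategory C).map (S.cok.map f))
      ((toSingularityCategory C).map (S.cok.map (S.inclusion f)))
      ((toSingularityCategory C).map (S.cok.map (S.projection f)) ≫ (S.translationIso P).hom) ∈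
        distTriang _ := by
  rw [rotate_distinguished_triangle]
  refine isomorphic_distinguished _ (sesδ_distinguished (S.shortExact f)) _
    (Triangle.isoMk _ _ (Iso.refl _) (Iso.refl _) (S.translationIso P).symm ?_ ?_ ?_)
  · exact (Category.comp_id _).trans (Category.id_comp _).symm
  · exact (Category.assoc _ _ _).trans ((congrArg (_ ≫ ·) (S.translationIso P).hom_inv_id).trans
      ((Category.comp_id _).trans (Category.id_comp _).symm))
  · refine ((congrArg (_ ≫ ·) (CategoryTheory.Functor.map_id _ _)).trans
      (Category.comp_id _)).trans ?_
    exact (S.translationIso P).eq_inv_comp.2 (S.translationIso_hom_comp f)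

/-- The translation functor of the quotient category. -/
def quotientTranslation : CategoryTheory.Quotient r ⥤ CategoryTheory.Quotient r :=
  CategoryTheory.Quotient.lift _ (S.translation ⋙ CategoryTheory.Quotient.functor r)
    fun _ _ _ _ h => CategoryTheory.Quotient.sound _ (S.rel_translation h)

/-- The functor from the quotient category to the singularity category. -/
def functor : CategoryTheory.Quotient r ⥤ SingularityCategory C :=
  CategoryTheory.Quotient.lift _ (S.cok ⋙ toSingularityCategory C)
    fun _ _ _ _ h => S.map_eq_iff.2 h

instance : S.functor.Full where
  map_surjective {X Y} φ := by
    obtain ⟨g, hg⟩ := exists_toSingularityCategory_map_eq (S.isExtOrthogonal X.as)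
      (S.cok.obj Y.as) φ
    obtain ⟨f, rfl⟩ := S.exists_cok_map_eq g
    exact ⟨(CategoryTheory.Quotient.functor r).map f, hg⟩

instance : S.functor.Faithful where
  map_injective {X Y} f g h := by
    obtain ⟨f, rfl⟩ := (CategoryTheory.Quotient.functor r).map_surjective (X := X.as) (Y := Y.as) f
    obtain ⟨g, rfl⟩ := (CategoryTheory.Quotient.functor r).map_surjective (X := X.as) (Y := Y.as) g
    exact CategoryTheory.Quotient.sound _ (S.map_eq_iff.1 h)

/-- The functor to the singularity category commutes with translations. -/
def functorTranslationIso : S.quotientTranslation ⋙ S.functor ≅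
    S.functor ⋙ shiftFunctor (SingularityCategory C) (1 : ℤ) :=
  CategoryTheory.Quotient.natIsoLift _ (NatIso.ofComponents
    (fun P => S.translationIso P) (fun f => S.translationIso_naturality f))

/-- Triangles isomorphic to the triangle of a mapping cone are sent to distinguished triangles. -/
lemma distinguished_of_cone_iso {X Y Z : CategoryTheory.Quotient r} {f : X ⟶ Y} {g : Y ⟶ Z}
    {h : Z ⟶ S.quotientTranslation.obj X} {K L : 𝒦} (φ : K ⟶ L)
    (a : X ≅ (CategoryTheory.Quotient.functor r).obj K)
    (b : Y ≅ (CategoryTheory.Quotient.functor r).obj L)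
    (c : Z ≅ (CategoryTheory.Quotient.functor r).obj (S.cone φ))
    (h₁ : f ≫ b.hom = a.hom ≫ (CategoryTheory.Quotient.functor r).map φ)
    (h₂ : g ≫ c.hom = b.hom ≫ (CategoryTheory.Quotient.functor r).map (S.inclusion φ))
    (h₃ : h ≫ S.quotientTranslation.map a.hom =
      c.hom ≫ (CategoryTheory.Quotient.functor r).map (S.projection φ)) :
    Triangle.mk (S.functor.map f) (S.functor.map g)
      (S.functor.map h ≫ S.functorTranslationIso.hom.app X) ∈ distTriang _ := by
  refine isomorphic_distinguished _ (S.cone_distinguished φ) _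
    (Triangle.isoMk _ _ (S.functor.mapIso a) (S.functor.mapIso b) (S.functor.mapIso c) ?_ ?_ ?_)
  · exact (S.functor.map_comp _ _).symm.trans
      ((congrArg S.functor.map h₁).trans (S.functor.map_comp _ _))
  · exact (S.functor.map_comp _ _).symm.trans
      ((congrArg S.functor.map h₂).trans (S.functor.map_comp _ _))
  · have h₄ := S.functorTranslationIso.hom.naturality a.hom
    refine (Category.assoc _ _ _).trans ((congrArg (_ ≫ ·) h₄.symm).trans ?_)
    refine (Category.assoc _ _ _).symm.trans ?_
    refine (congrArg (· ≫ _) ((S.functor.map_comp _ _).symm.trans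
      ((congrArg S.functor.map h₃).trans (S.functor.map_comp _ _)))).trans ?_
    exact Category.assoc _ _ _

/-- Triangles sent to distinguished triangles are isomorphic to the triangle of a mapping cone. -/
lemma exists_cone_iso_of_distinguished {X Y Z : CategoryTheory.Quotient r} {f : X ⟶ Y} {g : Y ⟶ Z}
    {h : Z ⟶ S.quotientTranslation.obj X}
    (hT : Triangle.mk (S.functor.map f) (S.functor.map g)
      (S.functor.map h ≫ S.functorTranslationIso.hom.app X) ∈ distTriang _) :
    ∃ (K L : 𝒦) (φ : K ⟶ L) (a : X ≅ (CategoryTheory.Quotient.functor r).obj K)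
      (b : Y ≅ (CategoryTheory.Quotient.functor r).obj L)
      (c : Z ≅ (CategoryTheory.Quotient.functor r).obj (S.cone φ)),
      f ≫ b.hom = a.hom ≫ (CategoryTheory.Quotient.functor r).map φ ∧
      g ≫ c.hom = b.hom ≫ (CategoryTheory.Quotient.functor r).map (S.inclusion φ) ∧
      h ≫ S.quotientTranslation.map a.hom =
        c.hom ≫ (CategoryTheory.Quotient.functor r).map (S.projection φ) := by
  -- Two distinguished triangles with the same first map are isomorphic; the isomorphism of third
  -- vertices is pulled back along the fully faithful functor.
  obtain ⟨φ, hφ⟩ := (CategoryTheory.Quotient.functor r).map_surjective (X := X.as) (Y := Y.as) f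
  let e := isoTriangleOfIso₁₂ _ _ hT (S.cone_distinguished φ) (Iso.refl _) (Iso.refl _)
    ((Category.comp_id _).trans ((congrArg S.functor.map hφ).symm.trans
      (Category.id_comp _).symm))
  let c : Z ≅ (CategoryTheory.Quotient.functor r).obj (S.cone φ) :=
    S.functor.preimageIso (Triangle.π₃.mapIso e)
  have hc : S.functor.map c.hom = e.hom.hom₃ := S.functor.map_preimage _
  refine ⟨X.as, Y.as, φ, Iso.refl _, Iso.refl _, c, ?_, ?_, ?_⟩
  · exact (Category.comp_id f).trans (hφ.symm.trans (Category.id_comp _).symm)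
  · apply S.functor.map_injective
    refine (S.functor.map_comp _ _).trans ((congrArg (_ ≫ ·) hc).trans
      (e.hom.comm₂.trans ?_))
    exact (Category.id_comp _).trans (congrArg S.functor.map (Category.id_comp
      ((CategoryTheory.Quotient.functor r).map (S.inclusion φ))).symm)
  · apply S.functor.map_injective
    rw [← cancel_mono (S.functorTranslationIso.hom.app X)]
    have h₃ := e.hom.comm₃
    have h₄ : h ≫ S.quotientTranslation.map (𝟙 X) = h :=
      (congrArg (h ≫ ·) (CategoryTheory.Functor.map_id S.quotientTranslation X)).trans
        (Category.comp_id h)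
    refine (congrArg (fun x => S.functor.map x ≫
      S.functorTranslationIso.hom.app X) h₄).trans ?_
    refine ((Category.comp_id _).symm.trans
      (congrArg (_ ≫ ·) (CategoryTheory.Functor.map_id (shiftFunctor (SingularityCategory C) (1 : ℤ))
        (S.functor.obj X)).symm)).trans (h₃.trans ?_)
    refine (congrArg (· ≫ _) hc.symm).trans ((Category.assoc _ _ _).symm.trans ?_)
    exact congrArg (· ≫ _) (S.functor.map_comp c.hom
      ((CategoryTheory.Quotient.functor r).map (S.projection φ))).symm

/-- The objects of `C` are generated by the cokernels. -/
def Generates : Prop := ∀ (p : ObjectProperty C) [p.IsClosedUnderIsomorphisms],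
  (∀ P, p (S.cok.obj P)) → (∀ T : ShortComplex C, T.ShortExact → p T.X₁ → Projective T.X₂ →
    p T.X₃) → ∀ M, p M

/-- Positive shifts are translations; negative ones use that every object is a translation up to
isomorphism. -/
lemma essImage_shift (m : ℤ) {X : SingularityCategory C} (hX : S.functor.essImage X) :
    S.functor.essImage (X⟦m⟧) := by
  have h₁ : ∀ {X : SingularityCategory C}, S.functor.essImage X →
      S.functor.essImage (X⟦(1 : ℤ)⟧) := by
    rintro X ⟨Y, ⟨e⟩⟩
    exact ⟨_, ⟨S.functorTranslationIso.app Y ≪≫ (shiftFunctor _ (1 : ℤ)).mapIso e⟩⟩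
  have h₂ : ∀ {X : SingularityCategory C}, S.functor.essImage X →
      S.functor.essImage (X⟦(-1 : ℤ)⟧) := by
    rintro X ⟨Y, ⟨e⟩⟩
    obtain ⟨P', ⟨e'⟩⟩ := S.exists_translation_iso Y.as
    exact ⟨(CategoryTheory.Quotient.functor r).obj P',
      ⟨((shiftFunctorCompIsoId _ (1 : ℤ) (-1) (by simp)).app _).symm ≪≫
      (shiftFunctor _ (-1 : ℤ)).mapIso ((S.translationIso P').symm ≪≫
        (toSingularityCategory C).mapIso (S.cok.mapIso e') ≪≫ e)⟩⟩
  induction m using Int.induction_on with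
  | zero =>
    exact S.functor.essImage.prop_of_iso ((shiftFunctorZero _ ℤ).symm.app X) hX
  | succ i ih =>
    exact S.functor.essImage.prop_of_iso
      ((shiftFunctorAdd' _ (i : ℤ) 1 _ rfl).symm.app X) (h₁ ih)
  | pred i ih =>
    exact S.functor.essImage.prop_of_iso
      ((shiftFunctorAdd' _ (-i : ℤ) (-1) _ (by lia)).symm.app X) (h₂ ih)

/-- By fullness the first map comes from `𝒦`, so the third vertex is the image of a mapping cone. -/
lemma essImage_cone {T : Triangle (SingularityCategory C)} (hT : T ∈ distTriang _)
    (h₁ : S.functor.essImage T.obj₁) (h₂ : S.functor.essImage T.obj₂) :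
    S.functor.essImage T.obj₃ := by
  obtain ⟨X, ⟨a⟩⟩ := h₁
  obtain ⟨Y, ⟨b⟩⟩ := h₂
  obtain ⟨f, hf⟩ := S.functor.map_surjective (a.hom ≫ T.mor₁ ≫ b.inv)
  obtain ⟨φ, hφ⟩ := (CategoryTheory.Quotient.functor r).map_surjective (X := X.as) (Y := Y.as) f
  have e := isoTriangleOfIso₁₂ _ _ (S.cone_distinguished φ) hT a b (by
    have h : (S.functor.map f) ≫ b.hom = a.hom ≫ T.mor₁ := by
      rw [hf, Category.assoc, Category.assoc, b.inv_hom_id, Category.comp_id]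
    exact (congrArg (fun x => S.functor.map x ≫ b.hom) hφ).trans h)
  exact ⟨(CategoryTheory.Quotient.functor r).obj (S.cone φ), ⟨Triangle.π₃.mapIso e⟩⟩

lemma essSurj (hS : S.Generates) : S.functor.EssSurj := by
  -- Applying `Generates` to the constant property `Nonempty 𝒦` yields an object; the cone of its
  -- identity then provides a zero object in the essential image.
  obtain ⟨P⟩ : Nonempty 𝒦 := by
    have : ObjectProperty.IsClosedUnderIsomorphisms (fun _ : C => Nonempty 𝒦) := ⟨fun _ h => h⟩
    exact hS (fun _ => Nonempty 𝒦) (fun P => ⟨P⟩) (fun _ _ h _ => h) (0 : C)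
  have h₀ : S.functor.essImage.ContainsZero := by
    have := S.projective_cone_id P
    exact ⟨_, isZero_toSingularityCategory_obj (S.cok.obj (S.cone (𝟙 P))),
      ⟨(CategoryTheory.Quotient.functor r).obj _, ⟨Iso.refl _⟩⟩⟩
  have h₁ : S.functor.essImage.IsStableUnderShift ℤ := ⟨fun m => ⟨fun X hX =>
    S.essImage_shift m hX⟩⟩
  have h₂ : S.functor.essImage.IsTriangulatedClosed₂ := .mk' (fun T hT h h' =>
    S.essImage_cone (inv_rot_of_distTriang _ hT) (S.essImage_shift (-1) h') h)
  have h₃ : S.functor.essImage.IsTriangulated := { }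
  refine ⟨fun X => prop_of_isTriangulated S.functor.essImage (fun M => ?_) X⟩
  refine hS (S.functor.essImage.inverseImage (toSingularityCategory C))
    (fun P => ⟨(CategoryTheory.Quotient.functor r).obj P, ⟨Iso.refl _⟩⟩) (fun T hT h h' => ?_) M
  -- The projective `T.X₂` becomes zero, and zero lies in the essential image.
  exact S.essImage_cone (sesδ_distinguished hT) h (S.functor.essImage.prop_of_iso
    ((isZero_toSingularityCategory_obj T.X₂).iso h₀.exists_zero.choose_spec.1).symm
      h₀.exists_zero.choose_spec.2)

end ConeSystem

/-! ### Graded pairs form a cone system -/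

namespace GrPair

open GrMod SingularityCategory Pretriangulated

variable {k : Type v} [Field k] {B : Type u} [Ring B] [Algebra k B] {𝒜 : ℕ → Submodule k B}
  {n : ℕ} {W : Superpotential 𝒜 n}

/-- The morphism of mapping cones induced by a commutative square. -/
def coneMap {P Q P' Q' : GrPair W} {f : P ⟶ Q} {g : P' ⟶ Q'} (u : P ⟶ P') (v : Q ⟶ Q')
    (h : f ≫ v = u ≫ g) : cone f ⟶ cone g where
  f₁ := GrMod.lift (fst Q.P₁ P.P₀ ≫ Hom.f₁ v) (snd Q.P₁ P.P₀ ≫ Hom.f₀ u)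
  f₀ := GrMod.lift (fst Q.P₀ ((twist n).obj P.P₁) ≫ Hom.f₀ v)
    (snd Q.P₀ ((twist n).obj P.P₁) ≫ (twist n).map (Hom.f₁ u))
  comm₁ := by
    ext ⟨a, b⟩
    have h₁ : GrMod.Hom.toLin (Hom.f₀ v) (GrMod.Hom.toLin Q.p₁ a) =
        GrMod.Hom.toLin Q'.p₁ (GrMod.Hom.toLin (Hom.f₁ v) a) :=
      congrArg (fun φ => GrMod.Hom.toLin φ a) (Hom.comm₁ v)
    have h₂ : GrMod.Hom.toLin (Hom.f₀ v) (GrMod.Hom.toLin (Hom.f₀ f) b) =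
        GrMod.Hom.toLin (Hom.f₀ g) (GrMod.Hom.toLin (Hom.f₀ u) b) :=
      congrArg (fun φ => GrMod.Hom.toLin (Hom.f₀ φ) b) h
    have h₃ : GrMod.Hom.toLin (Hom.f₁ u) (GrMod.Hom.toLin P.p₀ b) =
        GrMod.Hom.toLin P'.p₀ (GrMod.Hom.toLin (Hom.f₀ u) b) :=
      congrArg (fun φ => GrMod.Hom.toLin φ b) (Hom.comm₀ u)
    refine Prod.ext ?_ ?_
    · exact (map_add (GrMod.Hom.toLin (Hom.f₀ v)) _ _).trans (congrArg₂ (· + ·) h₁ h₂)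
    · exact (map_neg (GrMod.Hom.toLin (Hom.f₁ u)) _).trans (congrArg Neg.neg h₃)
  comm₀ := by
    ext ⟨a, b⟩
    have h₁ : GrMod.Hom.toLin (Hom.f₁ v) (GrMod.Hom.toLin Q.p₀ a) =
        GrMod.Hom.toLin Q'.p₀ (GrMod.Hom.toLin (Hom.f₀ v) a) :=
      congrArg (fun φ => GrMod.Hom.toLin φ a) (Hom.comm₀ v)
    have h₂ : GrMod.Hom.toLin (Hom.f₁ v) (GrMod.Hom.toLin (Hom.f₁ f) b) =
        GrMod.Hom.toLin (Hom.f₁ g) (GrMod.Hom.toLin (Hom.f₁ u) b) :=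
      congrArg (fun φ => GrMod.Hom.toLin (Hom.f₁ φ) b) h
    have h₃ : GrMod.Hom.toLin (Hom.f₀ u) (GrMod.Hom.toLin P.p₁ b) =
        GrMod.Hom.toLin P'.p₁ (GrMod.Hom.toLin (Hom.f₁ u) b) :=
      congrArg (fun φ => GrMod.Hom.toLin φ (show P.P₁ from b)) (Hom.comm₁ u)
    refine Prod.ext ?_ ?_
    · exact (map_add (GrMod.Hom.toLin (Hom.f₁ v)) _ _).trans (congrArg₂ (· + ·) h₁ h₂)
    · exact (map_neg (GrMod.Hom.toLin (Hom.f₀ u)) _).trans (congrArg Neg.neg h₃)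

lemma coneInclusion_comp_coneMap {P Q P' Q' : GrPair W} {f : P ⟶ Q} {g : P' ⟶ Q'} (u : P ⟶ P')
    (v : Q ⟶ Q') (h : f ≫ v = u ≫ g) : coneInclusion f ≫ coneMap u v h = v ≫ coneInclusion g := by
  ext x
  · exact Prod.ext rfl (map_zero (GrMod.Hom.toLin (Hom.f₀ u)))
  · exact Prod.ext rfl (map_zero (GrMod.Hom.toLin (Hom.f₁ u)))

lemma coneMap_comp_coneProjection {P Q P' Q' : GrPair W} {f : P ⟶ Q} {g : P' ⟶ Q'} (u : P ⟶ P')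
    (v : Q ⟶ Q') (h : f ≫ v = u ≫ g) :
    coneMap u v h ≫ coneProjection g = coneProjection f ≫ translation.map u := by
  ext ⟨a, b⟩
  · exact (map_neg (GrMod.Hom.toLin (Hom.f₀ u)) b).symm
  · exact (map_neg (GrMod.Hom.toLin (Hom.f₁ u)) b).symm

instance (P Q : GrPair W) : Sub (P ⟶ Q) := ⟨fun f g =>
  { f₁ := Hom.f₁ f - Hom.f₁ g
    f₀ := Hom.f₀ f - Hom.f₀ g
    comm₁ := by rw [Preadditive.comp_sub, Preadditive.sub_comp, Hom.comm₁, Hom.comm₁]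
    comm₀ := by
      rw [Functor.map_sub, Preadditive.comp_sub, Preadditive.sub_comp, Hom.comm₀, Hom.comm₀] }⟩

lemma cok_map_sub {P Q : GrPair W} (f g : P ⟶ Q) :
    (cok W).map (f - g) = (cok W).map f - (cok W).map g := by
  apply cok_hom_ext
  ext x
  exact map_sub (GrMod.Hom.toLin Q.cokProj) _ _

lemma homotopic_of_sub {P Q : GrPair W} {f g : P ⟶ Q} (h : Homotopic (f - g) 0) :
    Homotopic f g := by
  obtain ⟨s, t, h₁, h₀⟩ := h
  refine ⟨s, t, ?_, ?_⟩
  · rw [← h₁]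
    exact congrArg (twist n).map (sub_zero (Hom.f₁ f - Hom.f₁ g)).symm
  · rw [← h₀]
    exact (sub_zero (Hom.f₀ f - Hom.f₀ g)).symm

/-- Since `p₀` is the identity, `t = 𝟙` and `s = 0` contract the pair. -/
lemma homotopic_id_trivial (F : GrMod 𝒜) (hF : IsFiniteFree F) :
    Homotopic (𝟙 (trivial W F hF)) 0 := by
  refine ⟨0, 𝟙 _, ?_, ?_⟩
  · ext x
    exact (sub_zero x).trans (add_zero x).symm
  · ext x
    exact (sub_zero x).trans ((congrArg (fun y : F.carrier => (show F.carrier from x) + y)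
      (map_zero (GrMod.Hom.toLin (W.mul F)))).trans (add_zero x)).symm

lemma homotopic_translation_map {P Q : GrPair W} {f g : P ⟶ Q} (h : Homotopic f g) :
    Homotopic (translation.map f) (translation.map g) :=
  (CategoryTheory.Quotient.functor_map_eq_iff _ _ _).1
    (congrArg (DGrB.translation W).map (CategoryTheory.Quotient.sound _ h))

variable [GradedAlgebra 𝒜]

/-- Projective objects are retracts of cokernels of contractible pairs. -/
lemma exists_retract_trivial (L : FG W.quotGrading) [Projective L] :
    ∃ (F : GrMod 𝒜) (hF : IsFiniteFree F) (i : L ⟶ (cok W).obj (trivial W F hF))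
      (r : (cok W).obj (trivial W F hF) ⟶ L), i ≫ r = 𝟙 L := by
  obtain ⟨F, hF, r, hr⟩ := exists_trivial_cover L
  have := epi_of_surjective_FG r hr
  exact ⟨F, hF, Projective.factorThru (𝟙 L) r, r, Projective.factorThru_comp _ _⟩

lemma exists_extension (P : GrPair W) (L : FG W.quotGrading) [Projective L]
    (g : (cok W).obj P ⟶ L) : ∃ g', (cok W).map (coneInclusion (𝟙 P)) ≫ g' = g := by
  obtain ⟨F, hF, i, r, hir⟩ := exists_retract_trivial L
  obtain ⟨g', hg'⟩ := exists_extension_trivial P F hF (g ≫ i)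
  refine ⟨g' ≫ r, ?_⟩
  rw [← Category.assoc, hg', Category.assoc, hir, Category.comp_id]

/-- The projective `L` is a retract of the cokernel of a contractible pair. Both factors lift to
morphisms of pairs, so `f - g` has the same cokernel map as a composite through that pair, which is
null-homotopic. -/
lemma homotopic_of_factorization {P Q : GrPair W} {f g : P ⟶ Q} {L : FG W.quotGrading}
    [Projective L] {a : (cok W).obj P ⟶ L} {b : L ⟶ (cok W).obj Q}
    (hab : (cok W).map f - (cok W).map g = a ≫ b) : Homotopic f g := by
  obtain ⟨F, hF, i, r, hir⟩ := exists_retract_trivial L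
  obtain ⟨x, hx⟩ := exists_cok_map_eq (a ≫ i)
  obtain ⟨y, hy⟩ := exists_cok_map_eq (r ≫ b)
  have h₁ : (cok W).map (f - g) = (cok W).map (x ≫ y) := by
    rw [cok_map_sub, Functor.map_comp, hx, hy, Category.assoc, reassoc_of% hir, hab]
  have h₂ : Homotopic (x ≫ 𝟙 _ ≫ y) (x ≫ 0 ≫ y) :=
    HomRel.comp_left _ (HomRel.comp_right _ (homotopic_id_trivial F hF))
  have h₃ : x ≫ (0 : trivial W F hF ⟶ trivial W F hF) ≫ y = 0 := by
    ext z
    · exact map_zero (GrMod.Hom.toLin (Hom.f₁ y))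
    · exact map_zero (GrMod.Hom.toLin (Hom.f₀ y))
  rw [h₃, Category.id_comp] at h₂
  exact homotopic_of_sub (Congruence.equivalence.trans (homotopic_of_cok_map_eq h₁) h₂)

variable (W) [IsNoetherianRing (W.Quot)ᵐᵒᵖ]

/-- The system of mapping cones of graded pairs. -/
def coneSystem : ConeSystem (Homotopic (W := W)) (FG W.quotGrading) where
  cok := cok W
  translation := translation
  rel_translation := homotopic_translation_map
  cone := cone
  inclusion := coneInclusion
  projection := coneProjection
  zero f := (coneSequence f).zero
  shortExact := coneSequence_shortExact
  projective_cone_id P := projective_cok_of_homotopic (homotopic_id_cone P)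
  exists_extension := exists_extension _ _
  exists_coneMap u v h :=
    ⟨coneMap u v h, coneInclusion_comp_coneMap u v h, coneMap_comp_coneProjection u v h⟩
  exists_cok_map_eq := exists_cok_map_eq
  exists_factorization h := by
    obtain ⟨a, b, hab⟩ := exists_factorization_of_homotopic h
    exact ⟨_, inferInstance, a, b, hab⟩
  rel_of_factorization := homotopic_of_factorization
  exists_translation_iso P := ⟨P.untranslate, ⟨P.translationUntranslateIso⟩⟩

end GrPair

/-! ### Graded Nakayama: graded projectives over a connected algebra are free -/

namespace GrMod

variable {k : Type v} [Field k] {B : Type u} [Ring B] [Algebra k B] {𝒜 : ℕ → Submodule k B}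
  [GradedAlgebra 𝒜]

/-- The element `a'` is the component of `a` of degree `m - d`, which is zero when this degree is
negative. -/
lemma exists_proj_smul_eq (M : GrMod 𝒜) {d : ℤ} {x : M} (hx : x ∈ M.gr d) (m : ℤ) (a : B) :
    ∃ a' : B, (d ≤ m → a' ∈ 𝒜 (m - d).toNat) ∧ (m < d → a' = 0) ∧
      M.proj m (op a • x) = op a' • x := by
  induction IsHomogeneouslyGenerated.mem_closure (𝒜 := 𝒜) a using
    AddSubmonoid.closure_induction with
  | mem a ha =>
    obtain ⟨i, ha⟩ := ha
    by_cases h : d + i = m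
    · refine ⟨a, fun _ => ?_, fun _ => by lia, ?_⟩
      · rwa [show (m - d).toNat = i by lia]
      · rw [← h, M.proj_of_mem (M.smul_mem ha hx)]
    · refine ⟨0, fun _ => zero_mem _, fun _ => rfl, ?_⟩
      rw [M.proj_of_mem_ne (M.smul_mem ha hx) h, MulOpposite.op_zero, zero_smul]
  | zero => exact ⟨0, fun _ => zero_mem _, fun _ => rfl, by simp⟩
  | add a b _ _ ha hb =>
    obtain ⟨a', h₁, h₂, h₃⟩ := ha
    obtain ⟨b', h₁', h₂', h₃'⟩ := hb
    refine ⟨a' + b', fun h => add_mem (h₁ h) (h₁' h), fun h => by rw [h₂ h, h₂' h, add_zero], ?_⟩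
    rw [MulOpposite.op_add, MulOpposite.op_add, add_smul, add_smul, map_add, h₃, h₃']

lemma exists_homogeneous_coefficients (M : GrMod 𝒜) {ι : Type*} [Fintype ι] {d : ι → ℤ} {x : ι → M}
    (hx : ∀ i, x i ∈ M.gr (d i)) {m : ℤ} {y : M} (hy : y ∈ M.gr m) (a : ι → Bᵐᵒᵖ)
    (h : ∑ i, a i • x i = y) :
    ∃ a' : ι → B, (∀ i, d i ≤ m → a' i ∈ 𝒜 (m - d i).toNat) ∧ (∀ i, m < d i → a' i = 0) ∧
      ∑ i, op (a' i) • x i = y := by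
  choose a' h₁ h₂ h₃ using fun i => M.exists_proj_smul_eq (hx i) m (a i).unop
  refine ⟨a', h₁, h₂, ?_⟩
  rw [← M.proj_of_mem hy, ← h, map_sum]
  exact Finset.sum_congr rfl fun i _ => (h₃ i).symm

/-- Finitely generated graded projective modules over a connected graded algebra are free. -/
lemma isFiniteFree_of_projective (hconnected : ∀ b ∈ 𝒜 0, ∃ c : k, algebraMap k B c = b)
    (K : GrMod 𝒜) (hK : isFG 𝒜 K) [Module.Projective Bᵐᵒᵖ K] : IsFiniteFree K := by
  classical
  have hex : ∃ r, ∃ s : Finset (ℤ × K), s.card = r ∧ (∀ p ∈ s, p.2 ∈ K.gr p.1) ∧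
      Submodule.span Bᵐᵒᵖ (Prod.snd '' (s : Set (ℤ × K))) = ⊤ := by
    obtain ⟨s, hs, hspan⟩ := K.exists_homogeneous_generators hK
    exact ⟨_, s, rfl, hs, hspan⟩
  obtain ⟨s, hcard, hs, hspan⟩ := Nat.find_spec hex
  obtain ⟨P, φ, ⟨ι, _, b, d, hb, hι⟩, h⟩ := K.exists_free_of_finset s hs
  have hφ := surjective_of_span_eq_top φ hspan h
  have hspan' : Submodule.span Bᵐᵒᵖ (Set.range fun i => Hom.toLin φ (b i)) = ⊤ := by
    have : Set.range (fun i => Hom.toLin φ (b i)) = Hom.toLin φ '' Set.range b :=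
      Set.range_comp (Hom.toLin φ) b
    rw [this, Submodule.span_image, b.span_eq, Submodule.map_top, LinearMap.range_eq_top.2 hφ]
  -- The generating set has least cardinality and the basis is no larger, so no image of a basis
  -- element is redundant.
  have hmin : ∀ j, Hom.toLin φ (b j) ∉
      Submodule.span Bᵐᵒᵖ ((fun i => Hom.toLin φ (b i)) '' {i | i ≠ j}) := by
    intro j hj
    let s' : Finset (ℤ × K) := (Finset.univ.erase j).image fun i => (d i, Hom.toLin φ (b i))
    have hs' : s'.card < Nat.find hex := by
      refine (Finset.card_image_le.trans_lt ?_).trans_le (hι.trans hcard.le)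
      exact Finset.card_lt_card (Finset.erase_ssubset (Finset.mem_univ j))
    refine Nat.find_min hex hs' ⟨s', rfl, fun p hp => ?_, eq_top_iff.2 ?_⟩
    · obtain ⟨i, -, rfl⟩ := Finset.mem_image.1 hp
      exact Hom.toLin_mem φ (hb i)
    · have hle : (fun i => Hom.toLin φ (b i)) '' {i | i ≠ j} ⊆
          Prod.snd '' (s' : Set (ℤ × K)) := by
        rintro _ ⟨i, hi, rfl⟩
        exact ⟨(d i, Hom.toLin φ (b i)), Finset.mem_coe.2 (Finset.mem_image.2
          ⟨i, Finset.mem_erase.2 ⟨hi, Finset.mem_univ i⟩, rfl⟩), rfl⟩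
      rw [← hspan', Submodule.span_le]
      rintro _ ⟨i, rfl⟩
      by_cases hij : i = j
      · exact hij ▸ Submodule.span_mono hle hj
      · exact Submodule.subset_span (hle ⟨i, hij, rfl⟩)
  obtain ⟨σ, hσ⟩ := exists_lift_of_projective φ hφ (𝟙 K)
  have hσ' : ∀ x, Hom.toLin φ (Hom.toLin σ x) = x := fun x =>
    congrArg (fun f => Hom.toLin f x) hσ
  -- `q` projects `P` onto the kernel of `φ`; freeness of `K` amounts to `q = 0`.
  let q : P ⟶ P := 𝟙 P - φ ≫ σ
  have hφq : ∀ x, Hom.toLin φ (Hom.toLin q x) = 0 := fun x =>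
    (map_sub (Hom.toLin φ) x _).trans (sub_eq_zero.2 (hσ' _).symm)
  have hq : ∀ x, Hom.toLin φ x = 0 → Hom.toLin q x = x := fun x hx => by
    change x - Hom.toLin σ (Hom.toLin φ x) = x
    rw [hx, map_zero, sub_zero]
  obtain ⟨m₀, hm₀⟩ := (Set.finite_range d).bddBelow
  -- Induction on degree: expand `q (b i)` with homogeneous coefficients `a j` and apply `q` again.
  -- If `d j < d i` then `q (b j) = 0` by induction; if `d j > d i` then `a j = 0`; if the degrees
  -- agree, `a j` is a scalar by connectedness, and a nonzero scalar would contradict minimality.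
  have hqb : ∀ (N : ℕ) (i : ι), d i < m₀ + N → Hom.toLin q (b i) = 0 := by
    intro N
    induction N with
    | zero =>
      intro i hi
      have : m₀ ≤ d i := hm₀ ⟨i, rfl⟩
      lia
    | succ N ih =>
      intro i hi
      obtain ⟨a, ha, ha₀, hsum⟩ := P.exists_homogeneous_coefficients hb (Hom.toLin_mem q (hb i))
        (fun j => b.repr (Hom.toLin q (b i)) j) (b.sum_repr _)
      have hsum' : ∑ j, op (a j) • Hom.toLin φ (b j) = 0 := by
        rw [← hφq (b i), ← hsum, map_sum]
        exact Finset.sum_congr rfl fun j _ => ((Hom.toLin φ).map_smul _ _).symm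
      rw [← hq _ (hφq (b i)), ← hsum, map_sum]
      refine Finset.sum_eq_zero fun j _ => ((Hom.toLin q).map_smul _ _).trans ?_
      rcases lt_trichotomy (d j) (d i) with hj | hj | hj
      · rw [ih j (by push_cast at hi; lia), smul_zero]
      · obtain ⟨c, hc⟩ := hconnected (a j) (by simpa [hj] using ha j hj.le)
        by_cases hc₀ : c = 0
        · rw [← hc, hc₀, map_zero, MulOpposite.op_zero, zero_smul]
        · refine (hmin j ?_).elim
          have h₁ : op (algebraMap k B c⁻¹) • op (a j) • Hom.toLin φ (b j) = Hom.toLin φ (b j) := by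
            rw [smul_smul, ← op_mul, ← hc, ← map_mul, mul_inv_cancel₀ hc₀, map_one, op_one,
              one_smul]
          rw [← h₁]
          refine Submodule.smul_mem _ _ ?_
          rw [← Finset.add_sum_erase _ _ (Finset.mem_univ j)] at hsum'
          rw [eq_neg_of_add_eq_zero_left hsum']
          exact neg_mem (sum_mem fun l hl => Submodule.smul_mem _ _
            (Submodule.subset_span ⟨l, Finset.ne_of_mem_erase hl, rfl⟩))
      · rw [ha₀ j hj, MulOpposite.op_zero, zero_smul]
  have hq₀ : Hom.toLin q = 0 := b.ext fun i => by
    have : m₀ ≤ d i := hm₀ ⟨i, rfl⟩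
    exact hqb (d i - m₀ + 1).toNat i (by lia)
  have hinj : Function.Injective (Hom.toLin φ) := by
    rw [injective_iff_map_eq_zero]
    intro x hx
    rw [← hq x hx, hq₀, LinearMap.zero_apply]
  refine ⟨ι, inferInstance, b.map (LinearEquiv.ofBijective (Hom.toLin φ) ⟨hinj, hφ⟩), d,
    fun i => ?_⟩
  rw [Module.Basis.map_apply]
  exact Hom.toLin_mem φ (hb i)

end GrMod

/-! ### Generation by cokernels, using finite homological dimension of `B` -/

namespace GrPair

open GrMod

/-- An exact sequence of modules as a short complex. -/
lemma exists_shortExact_moduleCat {R : Type*} [Ring R] {L M N : Type u} [AddCommGroup L]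
    [AddCommGroup M] [AddCommGroup N] [Module R L] [Module R M] [Module R N] (f : L →ₗ[R] M)
    (g : M →ₗ[R] N) (hf : Function.Injective f) (hg : Function.Surjective g)
    (hfg : ∀ x, g x = 0 ↔ x ∈ LinearMap.range f) :
    ∃ S : ShortComplex (ModuleCat.{u} R), S.ShortExact ∧ S.X₁ = ModuleCat.of R L ∧
      S.X₂ = ModuleCat.of R M ∧ S.X₃ = ModuleCat.of R N := by
  have hw : ModuleCat.ofHom f ≫ ModuleCat.ofHom g = 0 := by
    ext x
    exact (hfg _).2 ⟨x, rfl⟩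
  refine ⟨ShortComplex.mk _ _ hw, { exact := ?_, mono_f := ?_, epi_g := ?_ }, rfl, rfl, rfl⟩
  · rw [ShortComplex.moduleCat_exact_iff]
    exact fun x hx => (hfg x).1 hx
  · exact (ModuleCat.mono_iff_injective _).2 hf
  · exact (ModuleCat.epi_iff_surjective _).2 hg

variable {k : Type v} [Field k] {B : Type u} [Ring B] [Algebra k B] {𝒜 : ℕ → Submodule k B}
  {n : ℕ} {W : Superpotential 𝒜 n}

lemma hasProjectiveDimensionLT_of_isFiniteFree {F : GrMod 𝒜} (hF : IsFiniteFree F) (m : ℕ) :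
    HasProjectiveDimensionLT (ModuleCat.of Bᵐᵒᵖ F) (m + 1) := by
  have := hF.projective
  infer_instance

/-- Multiplication by `W` from `F` to `F(n)` is a free resolution of length one over `B`. -/
lemma hasProjectiveDimensionLT_cok_trivial (F : GrMod 𝒜) (hF : IsFiniteFree F) (m : ℕ) :
    HasProjectiveDimensionLT
      (ModuleCat.of Bᵐᵒᵖ (W.restrict ((cok W).obj (trivial W F hF)).obj)) (m + 2) := by
  obtain ⟨S, hS, h₁, h₂, h₃⟩ := exists_shortExact_moduleCat
    (GrMod.Hom.toLin (trivial W F hF).p₁) (GrMod.Hom.toLin (trivial W F hF).cokProj)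
    (p₁_injective _) (cokProj_surjective _) (cokProj_eq_zero_iff _)
  rw [← h₃]
  refine hS.hasProjectiveDimensionLT_X₃ (m + 1) ?_ ?_
  · rw [h₁]
    exact hasProjectiveDimensionLT_of_isFiniteFree hF m
  · rw [h₂]
    exact hasProjectiveDimensionLT_of_isFiniteFree (hF.twist n) (m + 1)

variable [IsNoetherianRing (W.Quot)ᵐᵒᵖ]

lemma exists_kernel_FG {N M : FG W.quotGrading} (f : N ⟶ M) :
    ∃ (K : FG W.quotGrading) (i : K ⟶ N), Function.Injective (GrMod.Hom.toLin i.hom) ∧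
      i ≫ f = 0 ∧ ∀ x, GrMod.Hom.toLin f.hom x = 0 → ∃ y, GrMod.Hom.toLin i.hom y = x := by
  have hN : Module.Finite (W.Quot)ᵐᵒᵖ N.obj := N.property
  have : IsNoetherian (W.Quot)ᵐᵒᵖ N.obj := isNoetherian_of_isNoetherianRing_of_finite _ _
  have hK : Module.Finite (W.Quot)ᵐᵒᵖ (LinearMap.ker (GrMod.Hom.toLin f.hom)) := inferInstance
  refine ⟨⟨ker f.hom, hK⟩, ObjectProperty.homMk (kerι f.hom), Subtype.val_injective, ?_,
    fun x hx => ⟨⟨x, hx⟩, rfl⟩⟩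
  ext1
  exact kerι_comp f.hom

variable [GradedAlgebra 𝒜]

/-- Modules of projective dimension at most one over `B` are cokernels of graded pairs. -/
lemma exists_cok_iso (hconnected : ∀ b ∈ 𝒜 0, ∃ c : k, algebraMap k B c = b)
    (M : FG W.quotGrading)
    (hM : HasProjectiveDimensionLT (ModuleCat.of Bᵐᵒᵖ (W.restrict M.obj)) 2) :
    ∃ P : GrPair W, Nonempty ((cok W).obj P ≅ M) := by
  obtain ⟨F, hF, f, hf⟩ := exists_trivial_cover M
  let T := trivial W F hF
  let φ : T.P₀ ⟶ W.restrict M.obj := T.cokProj ≫ W.restrictMap f.hom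
  have hφ : Function.Surjective (GrMod.Hom.toLin φ) := hf.comp T.cokProj_surjective
  obtain ⟨N, i, hi, hif, hN⟩ := exists_kernel_FG f
  -- `B` need not be Noetherian. The image of `ker φ` under `cokProj` is the kernel over `A`,
  -- finitely generated because `A` is Noetherian, and the remaining part is the image of the
  -- finitely generated module `F` under `W`.
  have hK : isFG 𝒜 (ker φ) := by
    have h₁ : Module.Finite Bᵐᵒᵖ (W.restrict N.obj) := W.isFG_restrict N.property
    have h₂ : Module.Finite Bᵐᵒᵖ T.P₁ := hF.isFG
    change Module.Finite Bᵐᵒᵖ (LinearMap.ker (GrMod.Hom.toLin φ))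
    rw [Module.Finite.iff_fg]
    refine Submodule.fg_of_fg_map_of_fg_inf_ker (GrMod.Hom.toLin T.cokProj) ?_ ?_
    · have : (LinearMap.ker (GrMod.Hom.toLin φ)).map (GrMod.Hom.toLin T.cokProj) =
          LinearMap.range (GrMod.Hom.toLin (W.restrictMap i.hom)) := by
        ext x
        constructor
        · rintro ⟨y, hy, rfl⟩
          exact hN _ hy
        · rintro ⟨y, rfl⟩
          obtain ⟨z, hz⟩ := T.cokProj_surjective (GrMod.Hom.toLin (W.restrictMap i.hom) y)
          refine ⟨z, ?_, hz⟩
          exact (congrArg (GrMod.Hom.toLin (W.restrictMap f.hom)) hz).trans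
            (congrArg (fun φ : N ⟶ M => GrMod.Hom.toLin φ.hom y) hif)
      rw [this, ← Module.Finite.iff_fg]
      infer_instance
    · have : LinearMap.ker (GrMod.Hom.toLin φ) ⊓ LinearMap.ker (GrMod.Hom.toLin T.cokProj) =
          LinearMap.range (GrMod.Hom.toLin T.p₁) := by
        ext x
        constructor
        · rintro ⟨-, hx⟩
          exact (T.cokProj_eq_zero_iff x).1 hx
        · intro hx
          have hx' := (T.cokProj_eq_zero_iff x).2 hx
          exact ⟨(congrArg (GrMod.Hom.toLin (W.restrictMap f.hom)) hx').trans
            (map_zero (GrMod.Hom.toLin (W.restrictMap f.hom))), hx'⟩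
      rw [this, ← Module.Finite.iff_fg]
      infer_instance
  -- A first syzygy of a module of projective dimension at most one.
  have hproj : Module.Projective Bᵐᵒᵖ (ker φ) := by
    obtain ⟨S, hS, h₁, h₂, h₃⟩ := exists_shortExact_moduleCat (GrMod.Hom.toLin (kerι φ))
      (GrMod.Hom.toLin φ) Subtype.val_injective hφ
      (fun x => ⟨fun hx => ⟨⟨x, hx⟩, rfl⟩, by rintro ⟨y, rfl⟩; exact y.2⟩)
    rw [IsProjective.iff_projective, projective_iff_hasProjectiveDimensionLT_one, ← h₁]
    refine hS.hasProjectiveDimensionLT_X₁ 1 ?_ ?_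
    · rw [h₂]
      exact hasProjectiveDimensionLT_of_isFiniteFree (hF.twist n) 0
    · rw [h₃]
      exact hM
  -- `W` kills `M`, so multiplication by `W` on `P₀` factors through the kernel; the factorization
  -- is `p₀`.
  have hr : ∀ x, GrMod.Hom.toLin (W.mul T.P₀) x ∈
      LinearMap.range (GrMod.Hom.toLin ((twist n).map (kerι φ))) := fun x =>
    ⟨⟨op W.elt • x, ((GrMod.Hom.toLin φ).map_smul (op W.elt) x).trans
      (W.restrict_elt_smul M.obj _)⟩, rfl⟩
  let P : GrPair W :=
    { P₁ := ker φ
      P₀ := T.P₀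
      free₁ := isFiniteFree_of_projective hconnected _ hK
      free₀ := hF.twist n
      p₁ := kerι φ
      p₀ := liftOfInjective ((twist n).map (kerι φ)) Subtype.val_injective (W.mul T.P₀) hr
      p₁_p₀ := by
        have h := liftOfInjective_comp ((twist n).map (kerι φ)) Subtype.val_injective
          (W.mul T.P₀) hr
        ext x
        refine Subtype.val_injective ?_
        exact congrArg (fun ψ => GrMod.Hom.toLin ψ (GrMod.Hom.toLin (kerι φ) x)) h
      p₀_p₁ := liftOfInjective_comp _ _ _ _ }
  let g : (cok W).obj P ⟶ M := P.cokDesc φ (kerι_comp φ)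
  have hg : ∀ x, GrMod.Hom.toLin g.hom (GrMod.Hom.toLin P.cokProj x) = GrMod.Hom.toLin φ x :=
    fun x => rfl
  have := epi_of_surjective_FG g fun y => by
    obtain ⟨x, hx⟩ := hφ y
    exact ⟨GrMod.Hom.toLin P.cokProj x, hx⟩
  have := mono_of_injective_FG g ((injective_iff_map_eq_zero _).2 fun x hx => by
    obtain ⟨y, rfl⟩ := P.cokProj_surjective x
    exact (P.cokProj_eq_zero_iff y).2 ⟨⟨y, hx⟩, rfl⟩)
  have := isIso_of_mono_of_epi g
  exact ⟨P, ⟨asIso g⟩⟩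

/-- A free cover over `A` has projective dimension at most one over `B`, so passing to the kernel
lowers the bound on the `B`-projective dimension. The induction ends at dimension one, where
`exists_cok_iso` applies. -/
lemma prop_of_hasProjectiveDimensionLT
    (hconnected : ∀ b ∈ 𝒜 0, ∃ c : k, algebraMap k B c = b) (p : ObjectProperty (FG W.quotGrading))
    [p.IsClosedUnderIsomorphisms] (hcok : ∀ P, p ((cok W).obj P))
    (hp : ∀ S : ShortComplex (FG W.quotGrading), S.ShortExact → p S.X₁ → Projective S.X₂ → p S.X₃)
    (m : ℕ) (M : FG W.quotGrading)
    (hM : HasProjectiveDimensionLT (ModuleCat.of Bᵐᵒᵖ (W.restrict M.obj)) (m + 2)) : p M := by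
  induction m generalizing M with
  | zero =>
    obtain ⟨P, ⟨e⟩⟩ := exists_cok_iso hconnected M hM
    exact p.prop_of_iso e (hcok P)
  | succ m ih =>
    obtain ⟨F, hF, f, hf⟩ := exists_trivial_cover M
    obtain ⟨N, i, hi, hif, hN⟩ := exists_kernel_FG f
    refine hp (ShortComplex.mk i f hif) (shortExact_FG _ hi hf hN) (ih N ?_)
      (projective_cok_trivial F hF)
    obtain ⟨S, hS, h₁, h₂, h₃⟩ := exists_shortExact_moduleCat
      (GrMod.Hom.toLin (W.restrictMap i.hom)) (GrMod.Hom.toLin (W.restrictMap f.hom)) hi hf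
      (fun x => ⟨hN x, by
        rintro ⟨y, rfl⟩
        exact congrArg (fun φ : N ⟶ M => GrMod.Hom.toLin φ.hom y) hif⟩)
    rw [← h₁]
    refine hS.hasProjectiveDimensionLT_X₁ (m + 2) ?_ ?_
    · rw [h₂]
      exact hasProjectiveDimensionLT_cok_trivial F hF m
    · rw [h₃]
      exact hM

variable (W) in
lemma generates_coneSystem (hconnected : ∀ b ∈ 𝒜 0, ∃ c : k, algebraMap k B c = b)
    (hdim : ∃ d : ℕ, ∀ M : ModuleCat.{u} Bᵐᵒᵖ, HasProjectiveDimensionLE M d) :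
    (coneSystem W).Generates := by
  obtain ⟨d, hd⟩ := hdim
  intro p _ hcok hp M
  have := hd (ModuleCat.of Bᵐᵒᵖ (W.restrict M.obj))
  exact prop_of_hasProjectiveDimensionLT hconnected p hcok hp d M
    -- The strict bound `d + 1` is relaxed to `d + 2`, since the induction is based at the bound
    -- `2`.
    (hasProjectiveDimensionLT_of_ge _ (d + 1) (d + 2) (by lia))

end GrPair

end

theorem mainTheorem2 {k : Type v} [Field k] {B : Type u} [Ring B] [Nontrivial B] [Algebra k B]
    [Algebra.FiniteType k B] (𝒜 : ℕ → Submodule k B) [GradedAlgebra 𝒜]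
    (hconnected : ∀ b ∈ 𝒜 0, ∃ c : k, algebraMap k B c = b)
    (hdim : ∃ d : ℕ, ∀ M : ModuleCat.{u} Bᵐᵒᵖ, HasProjectiveDimensionLE M d)
    {n : ℕ} (W : Superpotential 𝒜 n) [IsNoetherianRing (W.Quot)ᵐᵒᵖ]
    [HasDerivedCategory.{w} (GrMod.FG W.quotGrading)] :
    ∃ F : DGrB W ⥤ SingularityCategory (GrMod.FG W.quotGrading),
      -- `F` is the unique functor induced by `Cok`
      DGrB.proj W ⋙ F = GrPair.cok W ⋙ toSingularityCategory (GrMod.FG W.quotGrading) ∧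
      (∀ F' : DGrB W ⥤ SingularityCategory (GrMod.FG W.quotGrading),
        DGrB.proj W ⋙ F' = GrPair.cok W ⋙ toSingularityCategory (GrMod.FG W.quotGrading) →
          F' = F) ∧
      -- `F` is an equivalence of categories
      F.IsEquivalence ∧
      -- `F` commutes with the translations, and preserves and reflects exact triangles
      ∃ e : DGrB.translation W ⋙ F ≅
          F ⋙ shiftFunctor (SingularityCategory (GrMod.FG W.quotGrading)) (1 : ℤ),
        ∀ {X Y Z : DGrB W} (f : X ⟶ Y) (g : Y ⟶ Z) (h : Z ⟶ (DGrB.translation W).obj X),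
          DGrB.IsExactTriangle f g h ↔
            Pretriangulated.Triangle.mk (F.map f) (F.map g) (F.map h ≫ e.hom.app X) ∈
              Pretriangulated.distinguishedTriangles := by
  let S := GrPair.coneSystem W
  have hS : S.functor.EssSurj := S.essSurj (GrPair.generates_coneSystem W hconnected hdim)
  -- The empty structure collects fullness, faithfulness and `hS`; `S.quotientTranslation` agrees
  -- with `DGrB.translation W` by unfolding.
  refine ⟨S.functor, CategoryTheory.Quotient.lift_spec _ _ _,
    fun F' h => CategoryTheory.Quotient.lift_unique _ _ _ F' h, { },
    S.functorTranslationIso, fun f g h => ⟨?_, fun hT => ?_⟩⟩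
  · rintro ⟨K, L, φ, a, b, c, h₁, h₂, h₃⟩
    exact S.distinguished_of_cone_iso φ a b c h₁ h₂ h₃
  · exact S.exists_cone_iso_of_distinguished hT
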